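/- Let $\mathrm{Sym}_0(3)$ be the space of symmetric traceless real $3\times 3$ matrices with the Frobenius norm $|A|=\sqrt{\mathrm{tr}(A^2)}$. Fix $\delta>0$ and $a,b,c>0$ with $b^2>27ac$, and consider the $\mathrm{Sym}_0(3)$-valued equation $$\frac{\partial Q}{\partial t}=\Delta Q-aQ+b\left(Q^2-\tfrac13\mathrm{tr}(Q^2)I\right)-c\,\mathrm{tr}(Q^2)\,Q\qquad\text{on }\mathbb R^3\times(0,\infty). \tag{1}$$ A smooth solution of (1) with initial datum $Q_0$ is a map $Q\in C^\infty(\mathbb R^3\times(0,\infty);\mathrm{Sym}_0(3))$ which satisfies (1) pointwise, with $Q(\cdot,t)\in H:=L^2(\mathbb R^3)\cap L^6(\mathbb R^3)$ for every $t>0$, such that $t\mapsto Q(\cdot,t)$ is continuous from $(0,\infty)$ to $H$ and $Q(\cdot,t)\to Q_0$ in $H$ as $t\to0^+$. Let $\Phi_1(x,t)=(4\pi(t+1))^{-3/2}e^{-|x|^2/4(t+1)}$, and let $X_0$ be the set of all continuous maps $V:\mathbb R^3\times[0,\infty)\to\mathrm{Sym}_0(3)$ with $$\sup_{x\in\mathbb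 R^3,\,t\ge0}\left(1+\frac{|x|}{\sqrt{t+1}}\right)^{4+\delta/2}(t+1)^2\,|V(x,t)|<\infty .$$ For $\eta>0$ let $\mathcal A^\circ_\eta$ be the set of all measurable $R:\mathbb R^3\to\mathrm{Sym}_0(3)$ with $\operatorname{ess\,sup}_{x\in\mathbb R^3}(1+|x|)^{8+\delta}|R(x)|<\eta$. For $\alpha>0$ set $$\lambda_\alpha(x)=-\frac{\alpha}{(1+|x|)^{8+\delta}},\qquad Q_{0,\alpha}=\mathrm{diag}(\lambda_\alpha,\lambda_\alpha,-2\lambda_\alpha).$$ Then for every $\eta>0$ there is $\alpha_0>0$ such that for every $0<\alpha<\alpha_0$: the datum $Q_{0,\alpha}$ belongs to $\mathcal A^\circ_\eta$; equation (1) has a smooth solution $Q$ with initial datum $Q_{0,\alpha}$ of the form $$Q(x,t)=A\,e^{-at}\,\Phi_1(x,t)+e^{-at}\,V(x,t)\qquad (x\in\mathbb R^3,\ t>0) \tag{2}$$ with $A\in\mathrm{Sym}_0(3)$ and $V\in X_0$; and whenever a smooth solution of (1) with initial datum $Q_{0,\alpha}$ has the form (2) with $A\in\mathrm{Sym}_0(3)$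 and $V\in X_0$, one has $A\neq0$. In particular, for every $\eta>0$ the assignment $Q_0\mapsto A$ is not identically zero on $\mathcal A^\circ_\eta$. -/

import Mathlib

open MeasureTheory Set Filter Topology
open scoped ContDiff ENNReal

noncomputable section

namespace QTensor

/-- Physical space `ℝ³` with its Euclidean norm. -/
abbrev Space : Type := EuclideanSpace ℝ (Fin 3)

/-- Real `3 × 3` matrices, the ambient space of Q-tensors. -/
abbrev Mat : Type := Matrix (Fin 3) (Fin 3) ℝ

/-- `Sym₀(3)`: symmetric traceless `3 × 3` real matrices. -/
def Sym0 : Set Mat := {A | A.IsSymm ∧ A.trace = 0}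

/-- The Frobenius norm `|A| = √(A : A) = √(tr (A A))` of a symmetric matrix. -/
def frob (A : Mat) : ℝ := Real.sqrt (A * A).trace

/-- The region `𝒟` of uniaxial bistability in parameter space. -/
def bistable : Set (ℝ × ℝ × ℝ) :=
  {p | 0 < p.1 ∧ 0 < p.2.1 ∧ 0 < p.2.2 ∧ 27 * p.1 * p.2.2 < p.2.1 ^ 2}

/-- The reaction term
`- a Q + b (Q² - (1/3) tr(Q²) I) - c tr(Q²) Q` of the Q-tensor equation. -/
def reaction (a b c : ℝ) (Q : Mat) : Mat :=
  -(a • Q) + b • (Q * Q - ((1 / 3 : ℝ) * (Q * Q).trace) • (1 : Mat))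
    - (c * (Q * Q).trace) • Q

/-- The heat kernel `Φ(x, t) = exp(-|x|² / 4t) / (4πt)^{3/2}` on `ℝ³`. -/
def heatKernel (x : Space) (t : ℝ) : ℝ :=
  Real.exp (-‖x‖ ^ 2 / (4 * t)) / (4 * Real.pi * t) ^ (3 / 2 : ℝ)

/-- The time-shifted heat kernel `Φ₁(x, t) = Φ(x, t + 1)`. -/
def heatKernel₁ (x : Space) (t : ℝ) : ℝ := heatKernel x (t + 1)

/-- Convergence of a family of fields to `R` in the phase space
`H = L² ∩ L⁶` with norm `max (‖·‖₂, ‖·‖₆)`. -/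
def TendstoH (Q : ℝ → Space → Mat) (l : Filter ℝ) (R : Space → Mat) : Prop :=
  Tendsto (fun s => max (eLpNorm (fun x => frob (Q s x - R x)) 2 volume)
    (eLpNorm (fun x => frob (Q s x - R x)) 6 volume)) l (𝓝 0)

/-- `Q` (of which only the values at times `t > 0` matter) is a global smooth solution on
`ℝ³ × (0, ∞)` of the Q-tensor equation
`∂ₜ Q = ΔQ - a Q + b (Q² - (1/3) tr(Q²) I) - c tr(Q²) Q`
with values in `Sym₀(3)` and initial datum `Q₀`: it is `C^∞` jointly in space and time, solves the
equation pointwise, lies in `H = L² ∩ L⁶` at each time, and the trajectory that starts from `Q₀`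
at time `0` is continuous in `H` on `[0, ∞)`. -/
structure IsSmoothSolution (a b c : ℝ) (Q₀ : Space → Mat) (Q : ℝ → Space → Mat) : Prop where
  mem_sym0 : ∀ t : ℝ, 0 < t → ∀ x : Space, Q t x ∈ Sym0
  smooth : ∀ i j : Fin 3,
    ContDiffOn ℝ ∞ (fun p : Space × ℝ => Q p.2 p.1 i j) (univ ×ˢ Ioi (0 : ℝ))
  equation : ∀ t : ℝ, 0 < t → ∀ x : Space, ∀ i j : Fin 3,
    deriv (fun s : ℝ => Q s x i j) t =
      Laplacian.laplacian (fun y : Space => Q t y i j) x + reaction a b c (Q t x) i j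
  memLp_two : ∀ t : ℝ, 0 < t → MemLp (fun x => frob (Q t x)) 2 volume
  memLp_six : ∀ t : ℝ, 0 < t → MemLp (fun x => frob (Q t x)) 6 volume
  continuous_H : ∀ t : ℝ, 0 < t → TendstoH Q (𝓝 t) (Q t)
  initial_H : TendstoH Q (𝓝[>] 0) Q₀

/-- The space-time weight `ω(x, t) = (1 + |x| / √(t+1))^{4 + δ/2} (t+1)²`. -/
def weight (δ : ℝ) (x : Space) (t : ℝ) : ℝ :=
  (1 + ‖x‖ / Real.sqrt (t + 1)) ^ (4 + δ / 2) * (t + 1) ^ 2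

/-- `V` belongs to `X₀`: it is continuous on `ℝ³ × [0, ∞)` with values in `Sym₀(3)` and
`sup ω |V| < ∞` there. Values of `V` at negative times are irrelevant. -/
structure MemX0 (δ : ℝ) (V : ℝ → Space → Mat) : Prop where
  mem_sym0 : ∀ t : ℝ, 0 ≤ t → ∀ x : Space, V t x ∈ Sym0
  continuousOn : ContinuousOn (fun p : Space × ℝ => V p.2 p.1) (univ ×ˢ Ici (0 : ℝ))
  bounded : ∃ M : ℝ, ∀ t : ℝ, 0 ≤ t → ∀ x : Space, weight δ x t * frob (V t x) ≤ M

/-- The decomposition `Q(x, t) = A e^{-at} Φ₁(x, t) + e^{-at} V(x, t)` on `ℝ³ × (0, ∞)` with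
`A ∈ Sym₀(3)` and `V ∈ X₀`. -/
structure IsDecomposition (a δ : ℝ) (Q : ℝ → Space → Mat) (A : Mat) (V : ℝ → Space → Mat) :
    Prop where
  coeff_mem : A ∈ Sym0
  remainder_mem : MemX0 δ V
  eq : ∀ t : ℝ, 0 < t → ∀ x : Space,
    Q t x = (Real.exp (-a * t) * heatKernel₁ x t) • A + Real.exp (-a * t) • V t x

/-- The set `𝒜°` of measurable `Sym₀(3)`-valued data with
`ess sup (1 + |x|)^{8 + δ} |R(x)| < η`; the weight is at least `1`, so such data are in `L^∞`. -/
def smallData (δ η : ℝ) : Set (Space → Mat) :=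
  {R | AEStronglyMeasurable R volume ∧ (∀ᵐ x : Space, R x ∈ Sym0) ∧
    essSup (fun x : Space => ENNReal.ofReal ((1 + ‖x‖) ^ (8 + δ) * frob (R x))) volume
      < ENNReal.ofReal η}

/-- The profile `λ_α(x) = -α (1 + |x|)^{-8-δ}`. -/
def lam (δ α : ℝ) (x : Space) : ℝ := -(α / (1 + ‖x‖) ^ (8 + δ))

/-- The uniaxial datum `Q_{0,α} = diag(λ_α, λ_α, -2 λ_α)`. -/
def uniaxialDatum (δ α : ℝ) (x : Space) : Mat :=
  Matrix.diagonal ![lam δ α x, lam δ α x, -2 * lam δ α x]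

end QTensor

end

/-! The reaction maps the line spanned by `axial` = diag(1, 1, -2) to itself. Writing Q = -w `axial`
turns the system into the scalar equation w_t = Δw - a w + b w² - 6c w³ with the positive datum α (1
+ |x|)^(-8-δ). While 0 ≤ w ≤ b/(6c), the source f = b w² - 6c w³ is nonnegative. Undoing the
damping, e^{at} w solves the heat equation with source e^{as} f, so it approaches L Φ₁, where L is
the mass of the datum plus the integral of e^{as} ∫ f over all times. The first term is positive and
the second is nonnegative, so nothing cancels and A = -L `axial` is nonzero.

Existence (`exists_mild_solution`) is a Banach fixed point among nonnegative fields bounded by K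
e^{-3at/4} (1 + |x|)^(-8-δ). The source is quadratically small and decays like e^{-3at/2}, faster
than e^{-at}, which makes L finite. In `exists_weight_remainder_le` each portion of mass is replaced
by a Gaussian of the same mass. The mean-free errors are handled by `exists_weight_heat_le`: zero
mean gains a factor t^{-1/2} over the heat kernel, which is exactly the extra decay demanded by X₀.

Smoothness (`contDiffAt_of_mild`) comes without bootstrapping. The fields w(x + tμ, λt) solve a mild
equation whose operators depend smoothly on (λ, μ), because all the dependence can be moved into the
Gaussian kernel. The implicit function theorem makes the family smooth in (λ, μ), and at t > 0 these
parameters sweep out a neighbourhood of (x, t). The differential equation then follows from the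
generator of the heat semigroup (`tendsto_heat_quotient`, `deriv_eq_of_mild`).

The claim about every decomposed solution needs uniqueness. The form (2) itself supplies continuity
down to t = 0 and spatial decay, so the squared difference of two solutions obeys a maximum
principle (`eq_zero_of_energy_inequality`, `decompositionField_unique`). Finally A is read off from
the field, since Φ₁(0, t) decays like t^{-3/2} and the remainder like t^{-2} (`coeff_unique`). -/

open MeasureTheory Set Filter Topology
open scoped ContDiff ENNReal

noncomputable section

namespace QTensor

/-! ### The Gaussian measure and the heat semigroup. -/

section GaussianMeasure

open scoped RealInnerProductSpace

/-- The density of the centred Gaussian with covariance `2 I`, the heat kernel at time one. -/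
def gauss (z : Space) : ℝ := Real.exp (-(1 / 4) * ‖z‖ ^ 2) / (4 * Real.pi) ^ (3 / 2 : ℝ)

/-- The centred Gaussian measure with covariance `2 I`. -/
def gaussMeasure : Measure Space := volume.withDensity fun z => ENNReal.ofReal (gauss z)

lemma gauss_pos (z : Space) : 0 < gauss z := by unfold gauss; positivity

lemma continuous_gauss : Continuous gauss := by unfold gauss; fun_prop

lemma integrable_exp_neg_mul_sq_norm {b : ℝ} (hb : 0 < b) :
    Integrable (fun z : Space => Real.exp (-b * ‖z‖ ^ 2)) := by
  have h := (GaussianFourier.integrable_cexp_neg_mul_sq_norm_add (V := Space) (b := (b : ℂ))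
    (by simpa using hb) 0 0).norm
  refine h.congr (Eventually.of_forall fun z => ?_)
  simp only [Complex.norm_exp]
  congr 1
  have : (-(b : ℂ) * (‖z‖ : ℂ) ^ 2 + 0 * ((inner ℝ (0 : Space) z : ℝ) : ℂ))
      = ((-b * ‖z‖ ^ 2 : ℝ) : ℂ) := by push_cast; ring
  rw [this, Complex.ofReal_re]

lemma integral_exp_neg_mul_sq_norm_add {b : ℝ} (hb : 0 < b) (c : ℝ) (w : Space) :
    ∫ z : Space, Real.exp (-b * ‖z‖ ^ 2 + c * ⟪w, z⟫) =
      (Real.pi / b) ^ (3 / 2 : ℝ) * Real.exp (c ^ 2 * ‖w‖ ^ 2 / (4 * b)) := by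
  have h := GaussianFourier.integral_cexp_neg_mul_sq_norm_add (V := Space) (b := (b : ℂ))
    (by simpa using hb) c w
  have h1 : ∀ z : Space, Complex.exp (-(b : ℂ) * (‖z‖ : ℂ) ^ 2 + c * ((⟪w, z⟫ : ℝ) : ℂ))
      = ((Real.exp (-b * ‖z‖ ^ 2 + c * ⟪w, z⟫) : ℝ) : ℂ) := by
    intro z; push_cast; rfl
  simp_rw [h1] at h
  rw [integral_complex_ofReal] at h
  apply Complex.ofReal_injective
  rw [h]
  push_cast
  rw [Complex.ofReal_cpow (by positivity)]
  simp

lemma integral_gauss : ∫ z, gauss z = 1 := by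
  unfold gauss
  rw [integral_div]
  have h := integral_exp_neg_mul_sq_norm_add (b := 1 / 4) (by norm_num) 0 0
  simp only [zero_mul, add_zero] at h
  rw [h]
  have : Real.pi / (1 / 4) = 4 * Real.pi := by ring
  rw [this]
  simp only [ne_eq, OfNat.ofNat_ne_zero, not_false_eq_true, zero_pow, norm_zero, mul_zero, zero_div,
    Real.exp_zero, mul_one]
  exact div_self (by positivity)

lemma integrable_gauss : Integrable gauss :=
  (integrable_exp_neg_mul_sq_norm (by norm_num)).div_const _

lemma integral_gaussMeasure {E : Type*} [NormedAddCommGroup E] [NormedSpace ℝ E] (f : Space → E) :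
    ∫ z, f z ∂gaussMeasure = ∫ z, gauss z • f z := by
  unfold gaussMeasure
  rw [integral_withDensity_eq_integral_toReal_smul
    continuous_gauss.measurable.ennreal_ofReal (by simp)]
  simp [ENNReal.toReal_ofReal (gauss_pos _).le]

lemma integrable_gaussMeasure_iff {f : Space → ℝ} :
    Integrable f gaussMeasure ↔ Integrable (fun z => gauss z * f z) := by
  unfold gaussMeasure
  rw [integrable_withDensity_iff_integrable_smul'
    continuous_gauss.measurable.ennreal_ofReal (by simp)]
  simp [ENNReal.toReal_ofReal (gauss_pos _).le]

instance : IsProbabilityMeasure gaussMeasure where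
  measure_univ := by
    unfold gaussMeasure
    rw [withDensity_apply _ MeasurableSet.univ, setLIntegral_univ,
      ← ofReal_integral_eq_lintegral_ofReal integrable_gauss
        (Eventually.of_forall fun z => (gauss_pos z).le), integral_gauss, ENNReal.ofReal_one]

lemma integrable_exp_gaussMeasure {η : ℝ} (hη : η < 1 / 4) :
    Integrable (fun z : Space => Real.exp (η * ‖z‖ ^ 2)) gaussMeasure := by
  rw [integrable_gaussMeasure_iff]
  refine ((integrable_exp_neg_mul_sq_norm (b := 1 / 4 - η) (by linarith)).div_const
    ((4 * Real.pi) ^ (3 / 2 : ℝ))).congr (Eventually.of_forall fun z => ?_)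
  simp only [gauss]
  rw [div_mul_eq_mul_div, ← Real.exp_add]
  congr 2; ring

lemma charFun_gaussMeasure (t : Space) : charFun gaussMeasure t = Complex.exp (-‖t‖ ^ 2) := by
  rw [charFun_apply, integral_gaussMeasure]
  have h := GaussianFourier.integral_cexp_neg_mul_sq_norm_add (V := Space) (b := (1 / 4 : ℂ))
    (by norm_num) Complex.I t
  have h1 : ∀ z : Space, gauss z • Complex.exp ((⟪z, t⟫ : ℝ) * Complex.I)
      = Complex.exp (-(1 / 4 : ℂ) * (‖z‖ : ℂ) ^ 2 + Complex.I * ((⟪t, z⟫ : ℝ) : ℂ)) *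
        (((4 * Real.pi) ^ (3 / 2 : ℝ) : ℝ) : ℂ)⁻¹ := by
    intro z
    rw [Complex.exp_add, Complex.real_smul, gauss, real_inner_comm]
    push_cast
    ring_nf
  simp_rw [h1]
  rw [integral_mul_const, h]
  have h2 : (((4 * Real.pi) ^ (3 / 2 : ℝ) : ℝ) : ℂ)
      = ((Real.pi : ℂ) / (1 / 4)) ^ ((Module.finrank ℝ Space : ℂ) / 2) := by
    rw [Complex.ofReal_cpow (by positivity)]
    simp only [finrank_euclideanSpace, Fintype.card_fin]
    push_cast
    congr 1
    ring
  rw [← h2]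
  have h3 : (((4 * Real.pi) ^ (3 / 2 : ℝ) : ℝ) : ℂ) ≠ 0 := by
    exact_mod_cast (by positivity : (4 * Real.pi) ^ (3 / 2 : ℝ) ≠ 0)
  field_simp
  simp [Complex.I_sq]

/-- Gaussian stability: the characteristic functions multiply and their exponents add up to |t|².
This is the source of the semigroup law. -/
lemma gaussMeasure_map_add {c d : ℝ} (h : c ^ 2 + d ^ 2 = 1) :
    (gaussMeasure.prod gaussMeasure).map (fun z : Space × Space => c • z.1 + d • z.2)
      = gaussMeasure := by
  have hm : Measurable (fun z : Space × Space => c • z.1 + d • z.2) := by fun_prop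
  have := Measure.isProbabilityMeasure_map (μ := gaussMeasure.prod gaussMeasure) hm.aemeasurable
  refine Measure.ext_of_charFun (funext fun t => ?_)
  rw [charFun_gaussMeasure, charFun_apply, integral_map hm.aemeasurable (by fun_prop)]
  have h1 : ∀ z : Space × Space, Complex.exp ((⟪c • z.1 + d • z.2, t⟫ : ℝ) * Complex.I)
      = Complex.exp ((⟪z.1, c • t⟫ : ℝ) * Complex.I) *
        Complex.exp ((⟪z.2, d • t⟫ : ℝ) * Complex.I) := by
    intro z
    rw [← Complex.exp_add, inner_add_left, real_inner_smul_left, real_inner_smul_left,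
      real_inner_smul_right, real_inner_smul_right]
    push_cast
    ring_nf
  simp_rw [h1]
  rw [integral_prod_mul (μ := gaussMeasure) (ν := gaussMeasure)
    (fun z : Space => Complex.exp ((⟪z, c • t⟫ : ℝ) * Complex.I))
    (fun z : Space => Complex.exp ((⟪z, d • t⟫ : ℝ) * Complex.I)),
    ← charFun_apply, ← charFun_apply, charFun_gaussMeasure, charFun_gaussMeasure,
    ← Complex.exp_add]
  congr 1
  rw [norm_smul, norm_smul]
  have h' : (c : ℂ) ^ 2 + (d : ℂ) ^ 2 = 1 := by exact_mod_cast h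
  have hc : ((‖c‖ : ℝ) : ℂ) ^ 2 = (c : ℂ) ^ 2 := by
    have := sq_abs c
    exact_mod_cast this
  have hd : ((‖d‖ : ℝ) : ℂ) ^ 2 = (d : ℂ) ^ 2 := by
    have := sq_abs d
    exact_mod_cast this
  push_cast
  rw [mul_pow, mul_pow, hc, hd]
  linear_combination -((‖t‖ : ℝ) : ℂ) ^ 2 * h'

/-- The covariance is twice the identity, so off-diagonal terms vanish. The factor 2 cancels the 1/2
of the Taylor expansion when the Laplacian is identified as generator. -/
lemma integral_bilin_gaussMeasure (B : Space →L[ℝ] Space →L[ℝ] ℝ) :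
    ∫ z, B z z ∂gaussMeasure = 2 * ∑ i, B (EuclideanSpace.basisFun (Fin 3) ℝ i)
      (EuclideanSpace.basisFun (Fin 3) ℝ i) := by
  open ProbabilityTheory in
  have hmap : (stdGaussian Space).map (fun z => Real.sqrt 2 • z) = gaussMeasure := by
    have hm : Measurable (fun z : Space => Real.sqrt 2 • z) := by fun_prop
    have := Measure.isProbabilityMeasure_map (μ := stdGaussian Space) hm.aemeasurable
    refine Measure.ext_of_charFun (funext fun t => ?_)
    rw [charFun_gaussMeasure, charFun_map_smul, charFun_stdGaussian]
    rw [norm_smul]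
    congr 1
    have : ((‖Real.sqrt 2‖ : ℝ) : ℂ) ^ 2 = 2 := by
      have : ‖Real.sqrt 2‖ ^ 2 = 2 := by simp
      exact_mod_cast this
    push_cast
    rw [mul_pow, this]; ring
  have h2 : MemLp id 2 (ProbabilityTheory.stdGaussian Space) :=
    ProbabilityTheory.IsGaussian.memLp_two_id
  have hint : ∀ i j : Fin 3, Integrable (fun z : Space => z i * z j)
      (ProbabilityTheory.stdGaussian Space) := by
    intro i j
    have hi : ∀ i : Fin 3, MemLp (fun z : Space => z i) 2
        (ProbabilityTheory.stdGaussian Space) := fun i =>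
      (h2.continuousLinearMap_comp (EuclideanSpace.proj i : Space →L[ℝ] ℝ) :)
    exact (hi i).integrable_mul (hi j)
  have hcov : ∀ i j : Fin 3, ∫ z : Space, z i * z j ∂(ProbabilityTheory.stdGaussian Space)
      = if i = j then 1 else 0 := by
    intro i j
    have h := ProbabilityTheory.covarianceBilin_apply h2
      (EuclideanSpace.basisFun (Fin 3) ℝ i) (EuclideanSpace.basisFun (Fin 3) ℝ j)
    rw [ProbabilityTheory.covarianceBilin_stdGaussian] at h
    have hz : ∫ z, id z ∂(ProbabilityTheory.stdGaussian Space) = 0 :=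
      ProbabilityTheory.integral_id_stdGaussian
    simp only [hz, innerSL_apply_apply ℝ] at h
    simp only [EuclideanSpace.basisFun_apply, EuclideanSpace.inner_single_left, map_one, one_mul,
      sub_zero] at h
    rw [← h]
    by_cases hij : i = j <;> simp [hij]
  have hB : ∀ z : Space, B z z = ∑ i : Fin 3, ∑ j : Fin 3, (z i * z j) *
      B (EuclideanSpace.basisFun (Fin 3) ℝ i) (EuclideanSpace.basisFun (Fin 3) ℝ j) := by
    intro z
    have hz : z = ∑ i, z i • EuclideanSpace.basisFun (Fin 3) ℝ i := by
      have := (EuclideanSpace.basisFun (Fin 3) ℝ).sum_repr z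
      simpa using this.symm
    conv_lhs => rw [hz]
    simp only [map_sum, map_smul, _root_.sum_apply, _root_.smul_apply,
      smul_eq_mul, Finset.mul_sum]
    rw [Finset.sum_comm]
    refine Finset.sum_congr rfl fun i _ => Finset.sum_congr rfl fun j _ => ?_
    ring
  rw [← hmap, integral_map (by fun_prop) (by fun_prop)]
  have h3 : ∀ z : Space, B (Real.sqrt 2 • z) (Real.sqrt 2 • z) = 2 * B z z := by
    intro z
    simp only [map_smul, _root_.smul_apply, smul_eq_mul]
    rw [← mul_assoc, Real.mul_self_sqrt (by norm_num)]
  simp_rw [h3]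
  rw [integral_const_mul]
  congr 1
  simp_rw [hB]
  rw [integral_finsetSum _ fun i _ => integrable_finsetSum _ fun j _ => (hint i j).mul_const _]
  refine Finset.sum_congr rfl fun i _ => ?_
  rw [integral_finsetSum _ fun j _ => (hint i j).mul_const _]
  simp_rw [integral_mul_const, hcov]
  simp

/-- The heat semigroup, written as an average over the Gaussian measure. -/
def heat (t : ℝ) (f : Space → ℝ) (x : Space) : ℝ :=
  ∫ z, f (x - Real.sqrt t • z) ∂gaussMeasure

lemma integrable_of_bounded_gauss {f : Space → ℝ} (hf : Continuous f) {C : ℝ}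
    (hC : ∀ y, |f y| ≤ C) : Integrable f gaussMeasure :=
  Integrable.of_bound hf.aestronglyMeasurable C (Eventually.of_forall hC)

lemma integrable_heat {f : Space → ℝ} (hf : Continuous f) {C : ℝ} (hC : ∀ y, |f y| ≤ C)
    (t : ℝ) (x : Space) : Integrable (fun z => f (x - Real.sqrt t • z)) gaussMeasure :=
  integrable_of_bounded_gauss (by fun_prop) fun _ => hC _

lemma abs_heat_le {f : Space → ℝ} {C : ℝ} (hC : ∀ y, |f y| ≤ C) (t : ℝ) (x : Space) :
    |heat t f x| ≤ C := by
  unfold heat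
  have := norm_integral_le_of_norm_le_const (μ := gaussMeasure)
    (f := fun z => f (x - Real.sqrt t • z)) (C := C) (Eventually.of_forall fun z => hC _)
  simpa using this

lemma heat_zero (f : Space → ℝ) (x : Space) : heat 0 f x = f x := by
  simp [heat]

/-- Two independent Gaussian steps of variances s and t merge into one: normalising by √(s + t)
gives coefficients with squares summing to 1, and stability applies. -/
lemma heat_heat {f : Space → ℝ} (hf : Continuous f) {C : ℝ} (hC : ∀ y, |f y| ≤ C)
    {s t : ℝ} (hs : 0 ≤ s) (ht : 0 ≤ t) (x : Space) :
    heat s (heat t f) x = heat (s + t) f x := by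
  rcases (add_nonneg hs ht).eq_or_lt with h0 | hpos
  · have : s = 0 := by linarith
    have : t = 0 := by linarith
    subst_vars
    simp [heat_zero]
  set r := Real.sqrt (s + t) with hr
  have hrpos : 0 < r := Real.sqrt_pos.2 hpos
  have hr2 : r ^ 2 = s + t := Real.sq_sqrt hpos.le
  have hcd : (Real.sqrt s / r) ^ 2 + (Real.sqrt t / r) ^ 2 = 1 := by
    rw [div_pow, div_pow, Real.sq_sqrt hs, Real.sq_sqrt ht, hr2, ← add_div, div_self hpos.ne']
  have hF : Continuous fun z : Space => f (x - r • z) := by fun_prop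
  have h1 : heat (s + t) f x = ∫ z : Space × Space,
      f (x - r • ((Real.sqrt s / r) • z.1 + (Real.sqrt t / r) • z.2))
        ∂(gaussMeasure.prod gaussMeasure) := by
    unfold heat
    rw [← hr]
    conv_lhs => rw [← gaussMeasure_map_add hcd]
    rw [integral_map (by fun_prop) hF.aestronglyMeasurable]
  rw [h1, integral_prod]
  · unfold heat
    refine integral_congr_ae (Eventually.of_forall fun z1 => ?_)
    refine integral_congr_ae (Eventually.of_forall fun z2 => ?_)
    simp only
    congr 1
    rw [smul_add, smul_smul, smul_smul, mul_div_cancel₀ _ hrpos.ne', mul_div_cancel₀ _ hrpos.ne']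
    abel
  · refine Integrable.of_bound (Continuous.aestronglyMeasurable (by fun_prop)) C
      (Eventually.of_forall fun z => hC _)

lemma heat_eq_convolution (f : Space → ℝ) {t : ℝ} (ht : 0 < t) (x : Space) :
    heat t f x = ∫ y, heatKernel (x - y) t * f y := by
  have hs : 0 < Real.sqrt t := Real.sqrt_pos.2 ht
  unfold heat
  rw [integral_gaussMeasure]
  have h1 := Measure.integral_comp_smul (volume : Measure Space)
    (fun y => heatKernel y t * f (x - y)) (Real.sqrt t)
  have h2 : ∫ y, heatKernel y t * f (x - y) = ∫ y, heatKernel (x - y) t * f y := by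
    rw [← integral_sub_left_eq_self (fun y => heatKernel (x - y) t * f y) volume x]
    simp
  rw [← h2]
  have hfr : Module.finrank ℝ Space = 3 := by simp
  rw [hfr, abs_of_pos (by positivity), smul_eq_mul] at h1
  have h3 : ∫ y, heatKernel y t * f (x - y) = Real.sqrt t ^ 3 *
      ∫ z, heatKernel (Real.sqrt t • z) t * f (x - Real.sqrt t • z) := by
    rw [h1]; field_simp
  rw [h3, ← integral_const_mul]
  refine integral_congr_ae (Eventually.of_forall fun z => ?_)
  simp only [smul_eq_mul]
  rw [← mul_assoc]
  congr 1
  unfold gauss heatKernel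
  rw [norm_smul, Real.norm_of_nonneg hs.le, mul_pow, Real.sq_sqrt ht.le,
    Real.mul_rpow (by positivity) ht.le]
  have h4 : Real.sqrt t ^ 3 = t ^ (3 / 2 : ℝ) := by
    rw [Real.sqrt_eq_rpow, ← Real.rpow_natCast, ← Real.rpow_mul ht.le]; norm_num
  rw [h4]
  have h5 : -(t * ‖z‖ ^ 2) / (4 * t) = -(1 / 4) * ‖z‖ ^ 2 := by field_simp
  rw [h5]
  have : t ^ (3 / 2 : ℝ) ≠ 0 := by positivity
  field_simp

/-- Completing the square in the exponent. It lets Gaussians placed at different times all evolve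
into the single profile Φ₁. -/
lemma heat_heatKernel {t r : ℝ} (ht : 0 ≤ t) (hr : 0 < r) (x : Space) :
    heat t (fun y => heatKernel y r) x = heatKernel x (t + r) := by
  unfold heat
  rw [integral_gaussMeasure]
  have hb : 0 < (r + t) / (4 * r) := by positivity
  have h := integral_exp_neg_mul_sq_norm_add hb (Real.sqrt t / (2 * r)) x
  have h1 : ∀ z : Space, gauss z • heatKernel (x - Real.sqrt t • z) r =
      (Real.exp (-‖x‖ ^ 2 / (4 * r)) / ((4 * Real.pi) ^ (3 / 2 : ℝ) * (4 * Real.pi * r) ^ (3 / 2 : ℝ)))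
      * Real.exp (-((r + t) / (4 * r)) * ‖z‖ ^ 2 + Real.sqrt t / (2 * r) * ⟪x, z⟫) := by
    intro z
    unfold gauss heatKernel
    rw [smul_eq_mul, div_mul_div_comm, ← Real.exp_add, div_mul_eq_mul_div, ← Real.exp_add]
    congr 2
    rw [norm_sub_sq_real, norm_smul, Real.norm_of_nonneg (Real.sqrt_nonneg t), mul_pow,
      Real.sq_sqrt ht, real_inner_smul_right]
    field_simp
    ring
  simp_rw [h1]
  rw [integral_const_mul, h]
  unfold heatKernel
  have hrt : 0 < t + r := by positivity
  have e1 : Real.pi / ((r + t) / (4 * r)) = (4 * Real.pi * r) / (t + r) := by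
    field_simp; ring
  rw [e1, Real.div_rpow (by positivity) hrt.le, Real.mul_rpow (z := (3 / 2 : ℝ)) (x := 4 * Real.pi)
    (y := t + r) (by positivity) hrt.le]
  have e2 : Real.exp (-‖x‖ ^ 2 / (4 * (t + r))) = Real.exp (-‖x‖ ^ 2 / (4 * r)) *
      Real.exp ((Real.sqrt t / (2 * r)) ^ 2 * ‖x‖ ^ 2 / (4 * ((r + t) / (4 * r)))) := by
    rw [← Real.exp_add, div_pow, Real.sq_sqrt ht]
    congr 1
    have : r + t ≠ 0 := by positivity
    field_simp
    ring
  rw [e2]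
  have : (4 * Real.pi * r) ^ (3 / 2 : ℝ) ≠ 0 := by positivity
  have : (4 * Real.pi) ^ (3 / 2 : ℝ) ≠ 0 := by positivity
  have : (t + r) ^ (3 / 2 : ℝ) ≠ 0 := by positivity
  field_simp

end GaussianMeasure

/-! ### The generator of the heat semigroup. -/

lemma isLittleO_second_difference {u : Space → ℝ} {x : Space} (hu : ContDiffAt ℝ 2 u x) :
    (fun y : Space => u (x + y) + u (x - y) - 2 * u x - fderiv ℝ (fderiv ℝ u) x y y)
      =o[𝓝 0] fun y => ‖y‖ ^ 2 := by
  set D := fderiv ℝ (fderiv ℝ u) x with hD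
  have hsymm : ∀ v w, D v w = D w v := fun v w =>
    (hu.isSymmSndFDerivAt (by simp)).eq v w
  have hdiff : DifferentiableAt ℝ (fderiv ℝ u) x :=
    (hu.fderiv_right (m := 1) (by norm_num)).differentiableAt (by norm_num)
  have hlit : (fun y : Space => fderiv ℝ u (x + y) - fderiv ℝ u x - D y) =o[𝓝 0] fun y => y :=
    hasFDerivAt_iff_isLittleO_nhds_zero.1 hdiff.hasFDerivAt
  have hev : ∀ᶠ y in 𝓝 x, DifferentiableAt ℝ u y :=
    (hu.eventually (by simp)).mono fun y hy => hy.differentiableAt (by norm_num)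
  have hev' : ∀ᶠ y in 𝓝 (0 : Space), DifferentiableAt ℝ u (x + y) := by
    have : Tendsto (fun y : Space => x + y) (𝓝 0) (𝓝 x) := by
      have hc : Continuous fun y : Space => x + y := by fun_prop
      simpa using hc.tendsto 0
    exact this.eventually hev
  rw [Asymptotics.isLittleO_iff]
  intro ε hε
  have hb := Asymptotics.isLittleO_iff.1 hlit (show (0 : ℝ) < ε / 2 by positivity)
  obtain ⟨r, hr, hball⟩ := Metric.eventually_nhds_iff.1 (hb.and hev')
  refine Metric.eventually_nhds_iff.2 ⟨r, hr, fun y hy => ?_⟩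
  rw [dist_zero_right] at hy
  set g : Space → ℝ := fun y => u (x + y) + u (x - y) - 2 * u x - D y y with hg
  -- The gradient of the error is a first-order Taylor remainder of the derivative of `u` at w minus
  -- the one at -w, hence o(|y|) on the ball; the mean value inequality turns this into o(|y|²).
  have hder : ∀ w ∈ Metric.closedBall (0 : Space) ‖y‖,
      HasFDerivWithinAt g (fderiv ℝ u (x + w) - fderiv ℝ u (x - w) - (2 : ℝ) • D w)
        (Metric.closedBall (0 : Space) ‖y‖) w := by
    intro w hw
    have hw' : ‖w‖ < r := lt_of_le_of_lt (by simpa using hw) hy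
    have h1 : HasFDerivAt u (fderiv ℝ u (x + w)) (x + w) :=
      (hball (by simpa using hw')).2.hasFDerivAt
    have h2 : HasFDerivAt u (fderiv ℝ u (x - w)) (x - w) := by
      have := (hball (y := -w) (by simpa using hw')).2.hasFDerivAt
      simpa [sub_eq_add_neg] using this
    have h3 : HasFDerivAt (fun w => u (x + w)) (fderiv ℝ u (x + w)) w := by
      exact h1.comp w ((hasFDerivAt_id w).const_add x)
    have h4 : HasFDerivAt (fun w => u (x - w)) (-fderiv ℝ u (x - w)) w := by
      have := h2.comp w ((hasFDerivAt_id w).const_sub x)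
      refine this.congr_fderiv ?_
      ext v; simp
    have h5 : HasFDerivAt (fun w => D w w) ((2 : ℝ) • D w) w := by
      have := D.hasFDerivAt (x := w) |>.clm_apply (hasFDerivAt_id w)
      refine this.congr_fderiv ?_
      ext v
      simp [hsymm v w, two_mul]
    have := ((h3.add h4).sub_const (2 * u x)).sub h5
    refine (this.congr_fderiv ?_).hasFDerivWithinAt
    ext v; simp; ring
  have hbound : ∀ w ∈ Metric.closedBall (0 : Space) ‖y‖,
      ‖fderiv ℝ u (x + w) - fderiv ℝ u (x - w) - (2 : ℝ) • D w‖ ≤ ε * ‖y‖ := by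
    intro w hw
    have hwy : ‖w‖ ≤ ‖y‖ := by simpa using hw
    have hw' : ‖w‖ < r := lt_of_le_of_lt hwy hy
    have h1 := (hball (y := w) (by simpa using hw')).1
    have h2 := (hball (y := -w) (by simpa using hw')).1
    have heq : fderiv ℝ u (x + w) - fderiv ℝ u (x - w) - (2 : ℝ) • D w
        = (fderiv ℝ u (x + w) - fderiv ℝ u x - D w)
          - (fderiv ℝ u (x + -w) - fderiv ℝ u x - D (-w)) := by
      rw [map_neg, ← sub_eq_add_neg, two_smul]; abel
    rw [heq]
    refine (norm_sub_le _ _).trans ?_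
    rw [norm_neg] at h2
    nlinarith
  have := (convex_closedBall (0 : Space) ‖y‖).norm_image_sub_le_of_norm_hasFDerivWithin_le
    hder hbound (x := 0) (y := y) (by simp) (by simp)
  have h0 : g 0 = 0 := by simp [hg]; ring
  rw [h0, sub_zero, sub_zero] at this
  simpa [hg, pow_two, mul_assoc] using this

lemma integrable_norm_sq_gaussMeasure : Integrable (fun z : Space => ‖z‖ ^ 2) gaussMeasure := by
  refine ((integrable_exp_gaussMeasure (η := 1 / 8) (by norm_num)).const_mul 8).mono'
    (by fun_prop) (Eventually.of_forall fun z => ?_)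
  have := Real.add_one_le_exp (1 / 8 * ‖z‖ ^ 2)
  rw [Real.norm_of_nonneg (by positivity)]
  linarith

lemma integral_neg_gaussMeasure (f : Space → ℝ) :
    ∫ z, f (-z) ∂gaussMeasure = ∫ z, f z ∂gaussMeasure := by
  rw [integral_gaussMeasure, integral_gaussMeasure,
    ← integral_neg_eq_self (fun z => gauss z • f z)]
  simp [gauss]

lemma laplacian_eq_sum_fderiv (u : Space → ℝ) (x : Space) :
    Laplacian.laplacian u x = ∑ i, fderiv ℝ (fderiv ℝ u) x (EuclideanSpace.basisFun (Fin 3) ℝ i)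
      (EuclideanSpace.basisFun (Fin 3) ℝ i) := by
  rw [InnerProductSpace.laplacian_eq_iteratedFDeriv_orthonormalBasis u
    (EuclideanSpace.basisFun (Fin 3) ℝ)]
  simp [iteratedFDeriv_two_apply]

/-- The Laplacian generates the heat semigroup, at any point of twice differentiability. -/
lemma tendsto_heat_quotient {u : Space → ℝ} (hc : Continuous u) {C : ℝ} (hC : ∀ y, |u y| ≤ C)
    {x : Space} (hu : ContDiffAt ℝ 2 u x) :
    Tendsto (fun h : ℝ => (heat h u x - u x) / h) (𝓝[>] 0) (𝓝 (Laplacian.laplacian u x)) := by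
  set D := fderiv ℝ (fderiv ℝ u) x with hD
  set R : Space → ℝ := fun y => u (x + y) + u (x - y) - 2 * u x with hR
  have hlit : (fun y => R y - D y y) =o[𝓝 0] fun y => ‖y‖ ^ 2 := isLittleO_second_difference hu
  have hC0 : 0 ≤ C := (abs_nonneg _).trans (hC x)
  have hRC : ∀ y, |R y| ≤ 4 * C := by
    intro y
    have h1 := abs_le.1 (hC (x + y))
    have h2 := abs_le.1 (hC (x - y))
    have h3 := abs_le.1 (hC x)
    rw [abs_le]; constructor <;> simp only [hR] <;> linarith
  -- Taylor expansion gives the quadratic bound near 0 and boundedness of `u` gives it far away.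
  -- After division by h the integrand is dominated by K|z|², uniformly in h.
  obtain ⟨K, hK⟩ : ∃ K : ℝ, ∀ y, |R y| ≤ K * ‖y‖ ^ 2 := by
    obtain ⟨r, hr, hball⟩ := Metric.eventually_nhds_iff.1
      (Asymptotics.isLittleO_iff.1 hlit (show (0 : ℝ) < 1 by norm_num))
    refine ⟨(1 + ‖D‖) + 4 * C / r ^ 2, fun y => ?_⟩
    by_cases hy : ‖y‖ < r
    · have h1 := hball (y := y) (by simpa using hy)
      rw [Real.norm_eq_abs, Real.norm_of_nonneg (by positivity), one_mul] at h1
      have h2 : |D y y| ≤ ‖D‖ * ‖y‖ ^ 2 := by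
        have := D.le_opNorm₂ y y
        rw [Real.norm_eq_abs] at this
        nlinarith
      have h3 : |R y| ≤ |R y - D y y| + |D y y| := by
        have := abs_add_le (R y - D y y) (D y y); simpa using this
      have : 0 ≤ 4 * C / r ^ 2 * ‖y‖ ^ 2 := by positivity
      nlinarith
    · push Not at hy
      have h1 : 4 * C ≤ 4 * C / r ^ 2 * ‖y‖ ^ 2 := by
        rw [div_mul_eq_mul_div, le_div_iff₀ (by positivity)]
        gcongr
      have : 0 ≤ (1 + ‖D‖) * ‖y‖ ^ 2 := by positivity
      have := hRC y
      nlinarith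
  -- Averaging over z and -z replaces the increment by the symmetric second difference, so the
  -- gradient, of order √h, drops out.
  have hquot : ∀ h : ℝ, 0 < h → (heat h u x - u x) / h
      = ∫ z, (1 / 2) * (R (Real.sqrt h • z) / h) ∂gaussMeasure := by
    intro h hh
    have hi1 := integrable_heat hc hC h x
    have hi2 : Integrable (fun z => u (x + Real.sqrt h • z)) gaussMeasure :=
      integrable_of_bounded_gauss (by fun_prop) fun _ => hC _
    have h1 : heat h u x = ∫ z, u (x + Real.sqrt h • z) ∂gaussMeasure := by
      unfold heat
      rw [← integral_neg_gaussMeasure]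
      simp
    have h2 : ∫ z, (1 / 2) * (R (Real.sqrt h • z) / h) ∂gaussMeasure
        = (1 / (2 * h)) * ∫ z, R (Real.sqrt h • z) ∂gaussMeasure := by
      rw [← integral_const_mul]; congr 1; ext z; field_simp
    rw [h2]
    simp only [hR]
    rw [integral_sub (f := fun z => u (x + Real.sqrt h • z) + u (x - Real.sqrt h • z))
      (hi2.add hi1) (integrable_const _), integral_add hi2 hi1, ← h1]
    simp only [integral_const, probReal_univ, one_smul]
    change _ = 1 / (2 * h) * (heat h u x + heat h u x - 2 * u x)
    field_simp
    ring
  have hlim : Tendsto (fun h : ℝ => ∫ z, (1 / 2) * (R (Real.sqrt h • z) / h) ∂gaussMeasure)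
      (𝓝[>] 0) (𝓝 (∫ z, (1 / 2) * D z z ∂gaussMeasure)) := by
    refine tendsto_integral_filter_of_dominated_convergence (fun z => K * ‖z‖ ^ 2)
      (Eventually.of_forall fun h => Continuous.aestronglyMeasurable (by fun_prop)) ?_
      (integrable_norm_sq_gaussMeasure.const_mul K) (Eventually.of_forall fun z => ?_)
    · filter_upwards [self_mem_nhdsWithin] with h hh
      refine Eventually.of_forall fun z => ?_
      have hh : 0 < h := hh
      have := hK (Real.sqrt h • z)
      rw [norm_smul, mul_pow, Real.norm_of_nonneg (Real.sqrt_nonneg h), Real.sq_sqrt hh.le] at this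
      rw [norm_mul, norm_div (R _), Real.norm_of_nonneg hh.le, Real.norm_eq_abs, Real.norm_eq_abs]
      have h3 : |R (Real.sqrt h • z)| / h ≤ K * ‖z‖ ^ 2 := by
        rw [div_le_iff₀ hh]; linarith
      have : 0 ≤ |R (Real.sqrt h • z)| / h := by positivity
      rw [abs_of_pos (by norm_num)]
      linarith
    · have ht : Tendsto (fun h : ℝ => Real.sqrt h • z) (𝓝[>] 0) (𝓝 0) := by
        have : Continuous fun h : ℝ => Real.sqrt h • z := by fun_prop
        simpa using (this.tendsto 0).mono_left nhdsWithin_le_nhds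
      have h1 := hlit.comp_tendsto ht
      have h2 : (fun h : ℝ => R (Real.sqrt h • z) / h - D z z) =o[𝓝[>] 0]
          fun _ => (1 : ℝ) := by
        rw [Asymptotics.isLittleO_iff] at h1 ⊢
        intro ε hε
        have hz : 0 < ‖z‖ ^ 2 + 1 := by positivity
        filter_upwards [h1 (show 0 < ε / (‖z‖ ^ 2 + 1) by positivity), self_mem_nhdsWithin]
          with h hh1 hh
        have hh : 0 < h := hh
        simp only [Function.comp, map_smul, _root_.smul_apply, smul_eq_mul, norm_smul, mul_pow,
          Real.norm_of_nonneg (Real.sqrt_nonneg h)] at hh1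
        rw [Real.norm_of_nonneg (by positivity : 0 ≤ Real.sqrt h ^ 2 * ‖z‖ ^ 2),
          Real.sq_sqrt hh.le, ← mul_assoc, Real.mul_self_sqrt hh.le] at hh1
        have h3 : R (Real.sqrt h • z) / h - D z z = (R (Real.sqrt h • z) - h * D z z) / h := by
          field_simp
        rw [h3, norm_div, Real.norm_of_nonneg hh.le, div_le_iff₀ hh]
        simp only [norm_one, mul_one]
        refine hh1.trans ?_
        rw [div_mul_eq_mul_div, div_le_iff₀ hz]
        nlinarith [mul_pos hε hh]
      rw [Asymptotics.isLittleO_one_iff] at h2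
      have := (h2.add_const (D z z)).const_mul (1 / 2)
      simpa using this
  rw [integral_const_mul, integral_bilin_gaussMeasure, ← mul_assoc] at hlim
  norm_num at hlim
  rw [laplacian_eq_sum_fderiv]
  refine Tendsto.congr' ?_ (by simpa using hlim)
  filter_upwards [self_mem_nhdsWithin] with h hh
  rw [hquot h hh]
  simp

/-! ### Weighted decay estimates for the heat flow. -/

lemma exists_rpow_le_exp {p η : ℝ} (hp : 0 < p) (hη : 0 < η) :
    ∃ C : ℝ, 0 < C ∧ ∀ s : ℝ, 0 ≤ s → (1 + s) ^ p ≤ C * Real.exp (η * s) := by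
  refine ⟨Real.exp (p * (η / p - 1 - Real.log (η / p))), Real.exp_pos _, fun s hs => ?_⟩
  have hq : 0 < η / p := by positivity
  have h1 : 0 < 1 + s := by linarith
  rw [← Real.exp_add, Real.rpow_def_of_pos h1]
  apply Real.exp_le_exp.2
  have h2 := Real.log_le_sub_one_of_pos (mul_pos hq h1)
  rw [Real.log_mul hq.ne' h1.ne'] at h2
  have h3 : Real.log (1 + s) * p ≤ (η / p * (1 + s) - 1 - Real.log (η / p)) * p := by
    gcongr; linarith
  refine h3.trans (le_of_eq ?_)
  field_simp
  ring

lemma exists_rpow_sqrt_le_exp {p η : ℝ} (hp : 0 < p) (hη : 0 < η) :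
    ∃ C : ℝ, 0 < C ∧ ∀ (τ : ℝ) (z : Space), 0 ≤ τ →
      (1 + Real.sqrt τ * ‖z‖) ^ p ≤ C * (Real.exp (η * τ) * Real.exp (η * ‖z‖ ^ 2)) := by
  obtain ⟨C, hC, h⟩ := exists_rpow_le_exp hp (show 0 < 2 * η by positivity)
  refine ⟨C, hC, fun τ z hτ => ?_⟩
  have h1 : Real.sqrt τ * ‖z‖ ≤ (τ + ‖z‖ ^ 2) / 2 := by
    nlinarith [sq_nonneg (Real.sqrt τ - ‖z‖), Real.sq_sqrt hτ]
  calc (1 + Real.sqrt τ * ‖z‖) ^ p ≤ (1 + (τ + ‖z‖ ^ 2) / 2) ^ p := by gcongr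
    _ ≤ C * Real.exp (2 * η * ((τ + ‖z‖ ^ 2) / 2)) := h _ (by positivity)
    _ = _ := by rw [← Real.exp_add]; congr 2; ring

lemma one_add_norm_le_mul (x y : Space) : 1 + ‖x‖ ≤ (1 + ‖x - y‖) * (1 + ‖y‖) := by
  have : ‖x‖ ≤ ‖x - y‖ + ‖y‖ := by simpa using norm_add_le (x - y) y
  nlinarith [norm_nonneg (x - y), norm_nonneg y]

/-- A Peetre-type inequality: a translation by y costs at most the factor (1 + |y|)^p, which a
Gaussian integrates. -/
lemma inv_rpow_le {p : ℝ} (hp : 0 ≤ p) (x y : Space) :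
    1 / (1 + ‖x - y‖) ^ p ≤ (1 + ‖y‖) ^ p * (1 / (1 + ‖x‖) ^ p) := by
  rw [mul_one_div, div_le_div_iff₀ (by positivity) (by positivity), one_mul,
    ← Real.mul_rpow (by positivity) (by positivity), mul_comm (1 + ‖y‖)]
  exact Real.rpow_le_rpow (by positivity) (one_add_norm_le_mul x y) hp

/-- The gradient of the Gaussian decays faster than any power. Integrating it along the segment
yields the factor |v|, and the Peetre inequality moves the weight from the intermediate point back
to u. -/
lemma exists_gauss_sub_le {m : ℝ} (hm : 0 < m) :
    ∃ C : ℝ, 0 < C ∧ ∀ u v : Space,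
      |gauss (u - v) - gauss u| ≤ C * (‖v‖ * (1 + ‖v‖) ^ m) * (1 / (1 + ‖u‖) ^ m) := by
  obtain ⟨C, hC, h⟩ := exists_rpow_sqrt_le_exp (p := m + 1) (by linarith)
    (show (0 : ℝ) < 1 / 4 by norm_num)
  set P := (4 * Real.pi) ^ (3 / 2 : ℝ) with hP
  have hP0 : 0 < P := by positivity
  refine ⟨C * Real.exp (1 / 4) / P, by positivity, fun u v => ?_⟩
  have hgrad : ∀ w : Space, gauss w * ‖w‖ ≤ C * Real.exp (1 / 4) / P * (1 / (1 + ‖w‖) ^ m) := by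
    intro w
    have h1 := h 1 w zero_le_one
    rw [Real.sqrt_one, one_mul, mul_one, Real.rpow_add_one (by positivity)] at h1
    have h2 : gauss w = Real.exp (-(1 / 4) * ‖w‖ ^ 2) / P := rfl
    rw [h2, mul_one_div, div_mul_eq_mul_div, div_div, div_le_div_iff₀ (by positivity)
      (by positivity)]
    have h3 : Real.exp (-(1 / 4) * ‖w‖ ^ 2) * Real.exp (1 / 4 * ‖w‖ ^ 2) = 1 := by
      rw [← Real.exp_add]; simp
    have h4 : (1 + ‖w‖) ^ m * ‖w‖ ≤ (1 + ‖w‖) ^ m * (1 + ‖w‖) := by gcongr; linarith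
    calc Real.exp (-(1 / 4) * ‖w‖ ^ 2) * ‖w‖ * (P * (1 + ‖w‖) ^ m)
        = Real.exp (-(1 / 4) * ‖w‖ ^ 2) * P * ((1 + ‖w‖) ^ m * ‖w‖) := by ring
      _ ≤ Real.exp (-(1 / 4) * ‖w‖ ^ 2) * P *
          (C * (Real.exp (1 / 4) * Real.exp (1 / 4 * ‖w‖ ^ 2))) :=
          mul_le_mul_of_nonneg_left (h4.trans h1) (by positivity)
      _ = C * Real.exp (1 / 4) * P * (Real.exp (-(1 / 4) * ‖w‖ ^ 2) *
          Real.exp (1 / 4 * ‖w‖ ^ 2)) := by ring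
      _ = _ := by rw [h3, mul_one]
  set φ : ℝ → ℝ := fun θ => gauss (u - θ • v) with hφ
  have hder : ∀ θ ∈ Icc (0 : ℝ) 1, HasDerivWithinAt φ
      (gauss (u - θ • v) * (-(1 / 4) * (2 * inner ℝ (u - θ • v) (-v)))) (Icc 0 1) θ := by
    intro θ _
    have h1 : HasDerivAt (fun θ : ℝ => u - θ • v) (-v) θ := by
      simpa using ((hasDerivAt_id θ).smul_const v).const_sub u
    have h2 := ((h1.norm_sq.const_mul (-(1 / 4))).exp).div_const P
    refine (h2.congr_deriv ?_).hasDerivWithinAt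
    change _ = Real.exp (-(1 / 4) * ‖u - θ • v‖ ^ 2) / P * _
    ring
  have hbound : ∀ θ ∈ Ico (0 : ℝ) 1,
      ‖gauss (u - θ • v) * (-(1 / 4) * (2 * inner ℝ (u - θ • v) (-v)))‖
      ≤ C * Real.exp (1 / 4) / P * (‖v‖ * (1 + ‖v‖) ^ m) * (1 / (1 + ‖u‖) ^ m) := by
    intro θ hθ
    set w := u - θ • v with hw
    have h1 : |inner ℝ w (-v)| ≤ ‖w‖ * ‖v‖ := by
      simpa using abs_real_inner_le_norm w (-v)
    have h2 := hgrad w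
    have h3 : 1 / (1 + ‖w‖) ^ m ≤ (1 + ‖v‖) ^ m * (1 / (1 + ‖u‖) ^ m) := by
      refine (inv_rpow_le hm.le u (θ • v)).trans ?_
      have : ‖θ • v‖ ≤ ‖v‖ := by
        rw [norm_smul, Real.norm_of_nonneg hθ.1]
        nlinarith [norm_nonneg v, hθ.2]
      gcongr
    rw [norm_mul, norm_mul, norm_mul, Real.norm_of_nonneg (gauss_pos w).le, norm_neg,
      Real.norm_eq_abs, Real.norm_eq_abs, Real.norm_eq_abs, abs_of_pos (by norm_num),
      abs_of_pos (by norm_num : (0 : ℝ) < 2)]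
    calc gauss w * (1 / 4 * (2 * |inner ℝ w (-v)|))
        ≤ gauss w * (1 / 4 * (2 * (‖w‖ * ‖v‖))) := by
          have := (gauss_pos w).le
          gcongr
      _ = (gauss w * ‖w‖) * ‖v‖ / 2 := by ring
      _ ≤ (gauss w * ‖w‖) * ‖v‖ := by
          have : 0 ≤ (gauss w * ‖w‖) * ‖v‖ := by
            have := (gauss_pos w).le
            positivity
          linarith
      _ ≤ (C * Real.exp (1 / 4) / P * ((1 + ‖v‖) ^ m * (1 / (1 + ‖u‖) ^ m))) * ‖v‖ :=
          mul_le_mul_of_nonneg_right (h2.trans (by gcongr)) (norm_nonneg v)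
      _ = _ := by ring
  have := norm_image_sub_le_of_norm_deriv_le_segment' hder hbound 1 (by simp)
  simpa [hφ] using this

lemma heatKernel_eq_gauss {t : ℝ} (ht : 0 < t) (x : Space) :
    heatKernel x t = gauss ((Real.sqrt t)⁻¹ • x) / t ^ (3 / 2 : ℝ) := by
  unfold heatKernel gauss
  rw [norm_smul, norm_inv, Real.norm_of_nonneg (Real.sqrt_nonneg t), mul_pow, inv_pow,
    Real.sq_sqrt ht.le, Real.mul_rpow (by positivity) ht.le, div_div]
  congr 2
  field_simp

/-- The heat semigroup preserves polynomial decay, with a slowly growing constant. -/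
lemma exists_heat_decay {p η : ℝ} (hp : 0 < p) (hη : 0 < η) :
    ∃ C : ℝ, 0 < C ∧ ∀ (M t : ℝ) (f : Space → ℝ), 0 ≤ M → 0 ≤ t →
      (∀ y, |f y| ≤ M * (1 / (1 + ‖y‖) ^ p)) →
      ∀ x, |heat t f x| ≤ C * Real.exp (η * t) * M * (1 / (1 + ‖x‖) ^ p) := by
  -- The Gaussian integrates exp(η|z|²) only for η < 1/4, hence the cap.
  have hη' : 0 < min η (1 / 8) := by positivity
  obtain ⟨C, hC, h⟩ := exists_rpow_sqrt_le_exp hp hη'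
  set I := ∫ z : Space, Real.exp (min η (1 / 8) * ‖z‖ ^ 2) ∂gaussMeasure with hI
  have hint : Integrable (fun z : Space => Real.exp (min η (1 / 8) * ‖z‖ ^ 2)) gaussMeasure :=
    integrable_exp_gaussMeasure ((min_le_right _ _).trans_lt (by norm_num))
  have hI0 : 0 ≤ I := integral_nonneg fun z => (Real.exp_pos _).le
  refine ⟨C * (I + 1), by positivity, fun M t f hM ht hf x => ?_⟩
  have hle : |heat t f x| ≤ ∫ z : Space, (C * Real.exp (η * t) * M * (1 / (1 + ‖x‖) ^ p)) *
      Real.exp (min η (1 / 8) * ‖z‖ ^ 2) ∂gaussMeasure := by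
    unfold heat
    rw [← Real.norm_eq_abs]
    refine norm_integral_le_of_norm_le (hint.const_mul _) (Eventually.of_forall fun z => ?_)
    have h1 := h t z ht
    have h2 : Real.exp (min η (1 / 8) * t) ≤ Real.exp (η * t) := by
      gcongr; exact min_le_left _ _
    calc ‖f (x - Real.sqrt t • z)‖ ≤ M * (1 / (1 + ‖x - Real.sqrt t • z‖) ^ p) := hf _
      _ ≤ M * ((1 + ‖Real.sqrt t • z‖) ^ p * (1 / (1 + ‖x‖) ^ p)) := by
          gcongr; exact inv_rpow_le hp.le _ _
      _ = M * (1 / (1 + ‖x‖) ^ p) * (1 + Real.sqrt t * ‖z‖) ^ p := by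
          rw [norm_smul, Real.norm_of_nonneg (Real.sqrt_nonneg t)]; ring
      _ ≤ M * (1 / (1 + ‖x‖) ^ p) *
          (C * (Real.exp (η * t) * Real.exp (min η (1 / 8) * ‖z‖ ^ 2))) := by
          gcongr
          exact h1.trans (by gcongr)
      _ = _ := by ring
  rw [integral_const_mul] at hle
  refine hle.trans ?_
  rw [← hI]
  have : 0 ≤ C * Real.exp (η * t) * M * (1 / (1 + ‖x‖) ^ p) := by positivity
  nlinarith

lemma integrable_inv_one_add_norm_rpow {p : ℝ} (hp : 3 < p) :
    Integrable (fun y : Space => 1 / (1 + ‖y‖) ^ p) := by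
  have h := integrable_one_add_norm (E := Space) (μ := volume) (r := p) (by simpa using hp)
  refine h.congr (Eventually.of_forall fun y => ?_)
  simp only
  rw [Real.rpow_neg (by positivity), one_div]

lemma weight_nonneg (δ : ℝ) (x : Space) {t : ℝ} : 0 ≤ weight δ x t := by
  unfold weight; positivity

/-- Data of zero mean and fast polynomial decay evolve into the weighted space. -/
lemma exists_weight_heat_le {δ : ℝ} (hδ : 0 < δ) :
    ∃ C : ℝ, 0 < C ∧ ∀ (M t : ℝ) (ρ : Space → ℝ), 0 ≤ M → 0 ≤ t → Continuous ρ →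
      (∀ y, |ρ y| ≤ M * (1 / (1 + ‖y‖) ^ (8 + δ))) → ∫ y, ρ y = 0 →
      ∀ x, weight δ x t * |heat t ρ x| ≤ C * M := by
  obtain ⟨C₁, hC₁, hsmall⟩ := exists_heat_decay (p := 8 + δ) (by linarith) zero_lt_one
  obtain ⟨m, hm⟩ : ∃ m : ℝ, m = 4 + δ / 2 := ⟨_, rfl⟩
  have hm0 : 0 < m := by rw [hm]; positivity
  obtain ⟨C₂, hC₂, hgauss⟩ := exists_gauss_sub_le hm0
  set I := ∫ y : Space, 1 / (1 + ‖y‖) ^ (m - 1) with hI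
  have hint := integrable_inv_one_add_norm_rpow (p := m - 1) (by rw [hm]; linarith)
  have hI0 : 0 ≤ I := integral_nonneg fun y => by positivity
  refine ⟨4 * C₁ * Real.exp 1 + 4 * C₂ * I, by positivity, fun M t ρ hM ht hρ hb h0 x => ?_⟩
  -- For t ≤ 1 preservation of decay suffices; the zero mean is exploited only for t ≥ 1.
  rcases le_total t 1 with ht1 | ht1
  · have h1 := hsmall M t ρ hM ht hb x
    have h2 : weight δ x t ≤ (1 + ‖x‖) ^ m * 4 := by
      unfold weight
      rw [← hm]
      have h3 : 1 ≤ Real.sqrt (t + 1) := by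
        rw [Real.one_le_sqrt]; linarith
      have h4 : ‖x‖ / Real.sqrt (t + 1) ≤ ‖x‖ := div_le_self (norm_nonneg x) h3
      have h5 : (t + 1) ^ 2 ≤ 4 := by nlinarith
      gcongr
    have h3 : (1 + ‖x‖) ^ m * (1 / (1 + ‖x‖) ^ (8 + δ)) ≤ 1 := by
      rw [mul_one_div, div_le_one (by positivity)]
      exact Real.rpow_le_rpow_of_exponent_le (by linarith [norm_nonneg x]) (by rw [hm]; linarith)
    have h4 : Real.exp (1 * t) ≤ Real.exp 1 := by gcongr; linarith
    calc weight δ x t * |heat t ρ x|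
        ≤ ((1 + ‖x‖) ^ m * 4) * (C₁ * Real.exp 1 * M * (1 / (1 + ‖x‖) ^ (8 + δ))) := by
          gcongr
          exact h1.trans (by gcongr)
      _ = 4 * C₁ * Real.exp 1 * M * ((1 + ‖x‖) ^ m * (1 / (1 + ‖x‖) ^ (8 + δ))) := by ring
      _ ≤ 4 * C₁ * Real.exp 1 * M * 1 := by gcongr
      _ ≤ _ := by
          have : 0 ≤ 4 * C₂ * I * M := by positivity
          linarith
  · have htpos : 0 < t := by linarith
    set s := Real.sqrt t with hs
    have hs1 : 1 ≤ s := by rw [hs, Real.one_le_sqrt]; exact ht1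
    have hspos : 0 < s := by linarith
    have hs2 : s ^ 2 = t := Real.sq_sqrt ht
    have hρint : Integrable ρ :=
      ((integrable_inv_one_add_norm_rpow (p := 8 + δ) (by linarith)).const_mul M).mono'
        hρ.aestronglyMeasurable (Eventually.of_forall hb)
    have hKc : Continuous fun y : Space => heatKernel (x - y) t := by
      unfold heatKernel; fun_prop
    have hKb : ∀ y : Space, ‖heatKernel (x - y) t‖ ≤ 1 / (4 * Real.pi * t) ^ (3 / 2 : ℝ) := by
      intro y
      unfold heatKernel
      rw [Real.norm_of_nonneg (by positivity)]
      gcongr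
      rw [Real.exp_le_one_iff]
      apply div_nonpos_of_nonpos_of_nonneg <;> [simp; positivity]
    -- Zero mean allows the kernel centred at 0 to be subtracted, so only kernel differences enter.
    have hrepr : heat t ρ x = ∫ y, (heatKernel (x - y) t - heatKernel x t) * ρ y := by
      rw [heat_eq_convolution ρ htpos]
      simp_rw [sub_mul]
      rw [integral_sub (hρint.bdd_mul hKc.aestronglyMeasurable
        (Eventually.of_forall hKb)) (hρint.const_mul _), integral_const_mul, h0]
      simp
    have hpt : ∀ y, ‖(heatKernel (x - y) t - heatKernel x t) * ρ y‖ ≤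
        (C₂ * M * (1 / t ^ 2) * (1 / (1 + ‖x‖ / s) ^ m)) * (1 / (1 + ‖y‖) ^ (m - 1)) := by
      intro y
      rw [heatKernel_eq_gauss htpos, heatKernel_eq_gauss htpos, ← sub_div, smul_sub, norm_mul,
        norm_div, Real.norm_of_nonneg (by positivity : 0 ≤ t ^ (3 / 2 : ℝ))]
      have h1 := hgauss (s⁻¹ • x) (s⁻¹ • y)
      rw [norm_smul, norm_smul, norm_inv, Real.norm_of_nonneg hspos.le] at h1
      have h2 : (1 + s⁻¹ * ‖y‖) ^ m ≤ (1 + ‖y‖) ^ m := by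
        have : s⁻¹ * ‖y‖ ≤ ‖y‖ := by
          have : s⁻¹ ≤ 1 := inv_le_one_of_one_le₀ hs1
          nlinarith [norm_nonneg y]
        gcongr
      -- The factor 1/√t won from the kernel difference raises the decay t^{-3/2} to the t^{-2} of
      -- the weight.
      have h3 : t ^ (3 / 2 : ℝ) * s = t ^ 2 := by
        rw [hs, Real.sqrt_eq_rpow, ← Real.rpow_add htpos, ← Real.rpow_natCast]
        norm_num
      -- The exponent 8 + δ = m + 1 + (m - 1) pays m for the Peetre factor and 1 for |y|; the rest,
      -- m - 1 = 3 + δ/2, is still integrable in dimension three.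
      have h4 : ‖y‖ * (1 + ‖y‖) ^ m * (1 / (1 + ‖y‖) ^ (8 + δ)) ≤ 1 / (1 + ‖y‖) ^ (m - 1) := by
        have e : (8 + δ) = m + 1 + (m - 1) := by rw [hm]; ring
        rw [e, Real.rpow_add (by positivity), Real.rpow_add_one (by positivity)]
        have hpos1 : 0 < (1 + ‖y‖) ^ m := by positivity
        have hpos2 : 0 < (1 + ‖y‖) ^ (m - 1) := by positivity
        rw [mul_one_div, div_le_div_iff₀ (by positivity) (by positivity)]
        have : 0 ≤ (1 + ‖y‖) ^ m * (1 + ‖y‖) ^ (m - 1) := by positivity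
        nlinarith
      calc ‖gauss (s⁻¹ • x - s⁻¹ • y) - gauss (s⁻¹ • x)‖ / t ^ (3 / 2 : ℝ) * ‖ρ y‖
          ≤ (C₂ * (s⁻¹ * ‖y‖ * (1 + ‖y‖) ^ m) * (1 / (1 + s⁻¹ * ‖x‖) ^ m)) / t ^ (3 / 2 : ℝ) *
            (M * (1 / (1 + ‖y‖) ^ (8 + δ))) := by
            gcongr
            · exact h1.trans (by gcongr)
            · exact hb y
        _ = C₂ * M * (1 / (t ^ (3 / 2 : ℝ) * s)) * (1 / (1 + ‖x‖ / s) ^ m) *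
            (‖y‖ * (1 + ‖y‖) ^ m * (1 / (1 + ‖y‖) ^ (8 + δ))) := by
            rw [inv_mul_eq_div s ‖x‖]
            field_simp
        _ ≤ _ := by
            rw [h3]
            gcongr
    have hle : |heat t ρ x| ≤ (C₂ * M * (1 / t ^ 2) * (1 / (1 + ‖x‖ / s) ^ m)) * I := by
      rw [hrepr, ← Real.norm_eq_abs, hI, ← integral_const_mul]
      exact norm_integral_le_of_norm_le (hint.const_mul _) (Eventually.of_forall hpt)
    have hw : weight δ x t ≤ (1 + ‖x‖ / s) ^ m * (4 * t ^ 2) := by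
      unfold weight
      rw [← hm]
      have h1 : s ≤ Real.sqrt (t + 1) := Real.sqrt_le_sqrt (by linarith)
      have h2 : (t + 1) ^ 2 ≤ 4 * t ^ 2 := by nlinarith
      gcongr
    calc weight δ x t * |heat t ρ x|
        ≤ ((1 + ‖x‖ / s) ^ m * (4 * t ^ 2)) *
          ((C₂ * M * (1 / t ^ 2) * (1 / (1 + ‖x‖ / s) ^ m)) * I) := by
          gcongr
      _ = 4 * C₂ * I * M := by
          have : (1 + ‖x‖ / s) ^ m ≠ 0 := by positivity
          field_simp
      _ ≤ _ := by
          have : 0 ≤ 4 * C₁ * Real.exp 1 * M := by positivity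
          linarith

/-! ### Exponential symbols depending smoothly on parameters, in the algebra of bounded continuous
functions. -/

lemma mul_mul_sub_le_neg_half {C s r : ℝ} (hs : 0 ≤ s) (hC : 0 < C) (hr : r ≤ 1 / (2 * C)) :
    C * s * r - s ≤ -(1 / 2) * s := by
  have h2 : C * r ≤ 1 / 2 := by
    calc C * r ≤ C * (1 / (2 * C)) := by gcongr
      _ = 1 / 2 := by field_simp
  nlinarith

/-- Bounded continuous real functions. The Banach algebra structure is the only one declared, so
that all the linear structures on it are derived along a single path. -/
def BF (Ω : Type*) [TopologicalSpace Ω] : Type _ := BoundedContinuousFunction Ω ℝ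

namespace BF

variable {Ω : Type*} [TopologicalSpace Ω]

instance : NormedCommRing (BF Ω) :=
  inferInstanceAs (NormedCommRing (BoundedContinuousFunction Ω ℝ))

instance : NormedAlgebra ℝ (BF Ω) :=
  inferInstanceAs (NormedAlgebra ℝ (BoundedContinuousFunction Ω ℝ))

instance : CompleteSpace (BF Ω) :=
  inferInstanceAs (CompleteSpace (BoundedContinuousFunction Ω ℝ))

instance : FunLike (BF Ω) Ω ℝ :=
  inferInstanceAs (FunLike (BoundedContinuousFunction Ω ℝ) Ω ℝ)

@[ext] lemma ext {f g : BF Ω} (h : ∀ y, f y = g y) : f = g :=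
  BoundedContinuousFunction.ext (α := Ω) (β := ℝ) h

/-- A bounded continuous function from a function and a bound. -/
def ofBound (g : Ω → ℝ) (hg : Continuous g) (C : ℝ) (hC : ∀ y, ‖g y‖ ≤ C) : BF Ω :=
  BoundedContinuousFunction.ofNormedAddCommGroup g hg C hC

lemma add_apply (f g : BF Ω) (y : Ω) : (f + g) y = f y + g y := rfl

lemma sub_apply (f g : BF Ω) (y : Ω) : (f - g) y = f y - g y := rfl

lemma smul_apply (r : ℝ) (f : BF Ω) (y : Ω) : (r • f) y = r * f y := rfl

protected lemma continuous (f : BF Ω) : Continuous f :=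
  BoundedContinuousFunction.continuous (α := Ω) (β := ℝ) f

lemma norm_coe_le_norm (f : BF Ω) (y : Ω) : ‖f y‖ ≤ ‖f‖ :=
  BoundedContinuousFunction.norm_coe_le_norm (α := Ω) (β := ℝ) f y

lemma norm_le {f : BF Ω} {C : ℝ} (hC : 0 ≤ C) : ‖f‖ ≤ C ↔ ∀ y, ‖f y‖ ≤ C :=
  BoundedContinuousFunction.norm_le (α := Ω) (β := ℝ) (f := f) hC

/-- Evaluation at a point. -/
def eval (y : Ω) : BF Ω →L[ℝ] ℝ :=
  LinearMap.mkContinuous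
    { toFun := fun f => f y
      map_add' := fun _ _ => rfl
      map_smul' := fun _ _ => rfl } 1 fun f => by
    rw [one_mul]; exact norm_coe_le_norm f y

lemma eval_apply (f : BF Ω) (y : Ω) : eval y f = f y := rfl

end BF

section ExpSymbol

variable {Ω E : Type*} [TopologicalSpace Ω] [NormedAddCommGroup E] [NormedSpace ℝ E]

open Classical in
/-- A function as a bounded continuous function, zero if it is not one. -/
def toBCF (g : Ω → ℝ) : BF Ω :=
  if h : Continuous g ∧ ∃ C : ℝ, ∀ y, ‖g y‖ ≤ C then
    BF.ofBound g h.1 h.2.choose h.2.choose_spec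
  else 0

lemma toBCF_apply {g : Ω → ℝ} (hg : Continuous g) {C : ℝ} (hC : ∀ y, ‖g y‖ ≤ C) (y : Ω) :
    toBCF g y = g y := by
  rw [toBCF, dif_pos ⟨hg, C, hC⟩]; rfl

/-- Continuous functions of polynomial growth in `ρ`. -/
def PolyGrowth (ρ q : Ω → ℝ) : Prop :=
  Continuous q ∧ ∃ C p : ℝ, 0 ≤ C ∧ 0 < p ∧ ∀ y, |q y| ≤ C * (1 + ρ y) ^ p

lemma PolyGrowth.mul_clm {ρ q : Ω → ℝ} (hq : PolyGrowth ρ q) (hρ0 : ∀ y, 0 ≤ ρ y)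
    {l : Ω → E →L[ℝ] ℝ} (hl : Continuous l) {C₀ : ℝ} (hC₀ : 0 ≤ C₀)
    (hlρ : ∀ y, ‖l y‖ ≤ C₀ * ρ y) (δ : E) : PolyGrowth ρ fun y => q y * l y δ := by
  obtain ⟨hqc, C, p, hC, hp, hb⟩ := hq
  refine ⟨by fun_prop, C * (C₀ * ‖δ‖), p + 1, by positivity, by positivity, fun y => ?_⟩
  have h0 := hρ0 y
  rw [abs_mul, Real.rpow_add_one (by positivity)]
  have h1 : |l y δ| ≤ C₀ * ‖δ‖ * (1 + ρ y) := by
    calc |l y δ| ≤ ‖l y‖ * ‖δ‖ := (l y).le_opNorm δ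
      _ ≤ (C₀ * ρ y) * ‖δ‖ := by gcongr; exact hlρ y
      _ ≤ (C₀ * (1 + ρ y)) * ‖δ‖ := by gcongr; linarith
      _ = _ := by ring
  calc |q y| * |l y δ| ≤ (C * (1 + ρ y) ^ p) * (C₀ * ‖δ‖ * (1 + ρ y)) := by
        gcongr; exact hb y
    _ = _ := by ring

/-- The symbol `q exp (l e - ρ)` as a bounded continuous function. -/
def expSymbol (ρ : Ω → ℝ) (l : Ω → E →L[ℝ] ℝ) (q : Ω → ℝ) (e : E) : BF Ω :=
  toBCF fun y => q y * Real.exp (l y e - ρ y)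

variable {ρ : Ω → ℝ} {l : Ω → E →L[ℝ] ℝ} {C₀ : ℝ}

lemma PolyGrowth.exists_exp_le {q : Ω → ℝ} (hq : PolyGrowth ρ q) (hρ0 : ∀ y, 0 ≤ ρ y) :
    ∃ K : ℝ, 0 ≤ K ∧ ∀ y, |q y| * Real.exp (-(1 / 2) * ρ y) ≤ K := by
  obtain ⟨hqc, C, p, hC, hp, hb⟩ := hq
  obtain ⟨K, hK, h⟩ := exists_rpow_le_exp hp (show (0 : ℝ) < 1 / 2 by norm_num)
  refine ⟨C * K, by positivity, fun y => ?_⟩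
  have h1 := h (ρ y) (hρ0 y)
  have h2 : Real.exp (1 / 2 * ρ y) * Real.exp (-(1 / 2) * ρ y) = 1 := by
    rw [← Real.exp_add]; simp
  calc |q y| * Real.exp (-(1 / 2) * ρ y)
      ≤ (C * (K * Real.exp (1 / 2 * ρ y))) * Real.exp (-(1 / 2) * ρ y) := by
        gcongr
        exact (hb y).trans (by gcongr)
    _ = C * K * (Real.exp (1 / 2 * ρ y) * Real.exp (-(1 / 2) * ρ y)) := by ring
    _ = _ := by rw [h2, mul_one]

/-- Within the radius 1/(2C₀) the linear exponent uses up at most half of the damping, and the other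
half beats polynomial growth. So the symbol is bounded and the default value 0 of `toBCF` is not
taken. -/
lemma expSymbol_apply (hρ : Continuous ρ) (hρ0 : ∀ y, 0 ≤ ρ y) (hl : Continuous l)
    (hC₀ : 0 < C₀) (hlρ : ∀ y, ‖l y‖ ≤ C₀ * ρ y) {q : Ω → ℝ} (hq : PolyGrowth ρ q) {e : E}
    (he : ‖e‖ ≤ 1 / (2 * C₀)) (y : Ω) :
    expSymbol ρ l q e y = q y * Real.exp (l y e - ρ y) := by
  obtain ⟨K, hK0, hK⟩ := hq.exists_exp_le hρ0
  refine toBCF_apply (g := fun y => q y * Real.exp (l y e - ρ y)) (C := K)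
    (hq.1.mul (by fun_prop)) (fun y => ?_) y
  rw [norm_mul, Real.norm_eq_abs, Real.norm_of_nonneg (Real.exp_pos _).le]
  refine le_trans ?_ (hK y)
  gcongr
  have h1 := mul_mul_sub_le_neg_half (hρ0 y) hC₀ he
  have h2 : l y e ≤ ‖l y‖ * ‖e‖ := (le_abs_self _).trans ((l y).le_opNorm e)
  have h3 : ‖l y‖ * ‖e‖ ≤ C₀ * ρ y * ‖e‖ := by gcongr; exact hlρ y
  linarith

lemma abs_exp_sub_one_sub_le (s : ℝ) : |Real.exp s - 1 - s| ≤ s ^ 2 * Real.exp |s| := by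
  have h1 := Real.add_one_le_exp s
  have h2 := Real.add_one_le_exp (-s)
  have h3 : Real.exp (-s) * Real.exp s = 1 := by rw [← Real.exp_add]; simp
  have h4 := Real.exp_pos s
  have h5 : Real.exp s - 1 ≤ s * Real.exp s := by nlinarith
  rw [abs_of_nonneg (by linarith)]
  have h6 : 1 ≤ Real.exp |s| := Real.one_le_exp (abs_nonneg s)
  rcases le_total 0 s with h | h
  · rw [abs_of_nonneg h]; nlinarith
  · nlinarith [sq_nonneg s]

/-- Differentiation only brings down the factor l, which grows at most like ρ, so the derivative is
a symbol of the same class. The pointwise remainder is e^s - 1 - s with s linear in the increment,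
hence quadratic, and the point is to have this uniformly in y. -/
lemma hasFDerivAt_expSymbol [FiniteDimensional ℝ E] (hρ : Continuous ρ) (hρ0 : ∀ y, 0 ≤ ρ y)
    (hl : Continuous l) (hC₀ : 0 < C₀) (hlρ : ∀ y, ‖l y‖ ≤ C₀ * ρ y) {q : Ω → ℝ}
    (hq : PolyGrowth ρ q) {e : E} (he : ‖e‖ < 1 / (2 * C₀)) :
    ∃ D : E →L[ℝ] (BF Ω), HasFDerivAt (expSymbol ρ l q) D e ∧
      ∀ δ, D δ = expSymbol ρ l (fun y => q y * l y δ) e := by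
  have hq' : ∀ δ, PolyGrowth ρ fun y => q y * l y δ := hq.mul_clm hρ0 hl hC₀.le hlρ
  have happ := fun δ => expSymbol_apply hρ hρ0 hl hC₀ hlρ (hq' δ) he.le
  let D₀ : E →ₗ[ℝ] (BF Ω) :=
    { toFun := fun δ => expSymbol ρ l (fun y => q y * l y δ) e
      map_add' := fun δ δ' => by
        ext y
        rw [BF.add_apply, happ, happ, happ, map_add]; ring
      map_smul' := fun r δ => by
        ext y
        rw [RingHom.id_apply, BF.smul_apply, happ, happ, map_smul,
          smul_eq_mul]; ring }
  refine ⟨LinearMap.toContinuousLinearMap D₀, ?_, fun δ => rfl⟩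
  have hq2 : PolyGrowth ρ fun y => q y * (1 + ρ y) ^ 2 := by
    obtain ⟨hqc, C, p, hC, hp, hb⟩ := hq
    refine ⟨by fun_prop, C, p + 2, hC, by positivity, fun y => ?_⟩
    have h0 := hρ0 y
    rw [abs_mul, abs_of_nonneg (by positivity : 0 ≤ (1 + ρ y) ^ 2), Real.rpow_add (by positivity),
      ← mul_assoc, Real.rpow_two]
    gcongr
    exact hb y
  obtain ⟨K, hK0, hK⟩ := hq2.exists_exp_le hρ0
  refine HasFDerivAt.of_isLittleO ?_
  refine Asymptotics.IsBigO.trans_isLittleO (g := fun e' => ‖e' - e‖ ^ 2) ?_ ?_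
  · refine Asymptotics.IsBigO.of_bound (K * C₀ ^ 2) ?_
    filter_upwards [Metric.ball_mem_nhds e (sub_pos.2 he)] with e' he'
    set h := e' - e with hh
    have hnh : ‖e‖ + ‖h‖ ≤ 1 / (2 * C₀) := by
      rw [Metric.mem_ball, dist_eq_norm] at he'
      linarith
    have he'' : ‖e'‖ ≤ 1 / (2 * C₀) := by
      have : ‖e'‖ ≤ ‖e‖ + ‖h‖ := by
        have := norm_add_le e h
        simpa [hh] using this
      linarith
    rw [norm_pow, norm_norm, BF.norm_le (by positivity)]
    intro y
    have h0 := hρ0 y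
    change ‖expSymbol ρ l q e' y - expSymbol ρ l q e y
      - expSymbol ρ l (fun y => q y * l y h) e y‖ ≤ _
    rw [expSymbol_apply hρ hρ0 hl hC₀ hlρ hq he'', expSymbol_apply hρ hρ0 hl hC₀ hlρ hq he.le,
      happ]
    have h1 : q y * Real.exp (l y e' - ρ y) - q y * Real.exp (l y e - ρ y)
        - q y * l y h * Real.exp (l y e - ρ y)
        = q y * Real.exp (l y e - ρ y) * (Real.exp (l y h) - 1 - l y h) := by
      have : l y e' - ρ y = (l y e - ρ y) + l y h := by rw [hh, map_sub]; ring
      rw [this, Real.exp_add]; ring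
    rw [h1, norm_mul, norm_mul, Real.norm_of_nonneg (Real.exp_pos _).le, Real.norm_eq_abs,
      Real.norm_eq_abs]
    have hb1 : ∀ v : E, |l y v| ≤ C₀ * ρ y * ‖v‖ := fun v =>
      ((l y).le_opNorm v).trans (by gcongr; exact hlρ y)
    -- Since |e| + |h| is still within the radius, half of the damping survives both exponentials
    -- and absorbs the prefactor (1 + ρ)².
    have h2 : Real.exp (l y e - ρ y) * Real.exp |l y h| ≤ Real.exp (-(1 / 2) * ρ y) := by
      rw [← Real.exp_add]
      apply Real.exp_le_exp.2
      have := mul_mul_sub_le_neg_half h0 hC₀ hnh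
      have := (le_abs_self _).trans (hb1 e)
      have := hb1 h
      linarith
    have h3 : (l y h) ^ 2 ≤ C₀ ^ 2 * (1 + ρ y) ^ 2 * ‖h‖ ^ 2 := by
      rw [← sq_abs, ← mul_pow, ← mul_pow]
      have := hb1 h
      gcongr
      exact this.trans (by gcongr; linarith)
    calc |q y| * Real.exp (l y e - ρ y) * |Real.exp (l y h) - 1 - l y h|
        ≤ |q y| * Real.exp (l y e - ρ y) * ((l y h) ^ 2 * Real.exp |l y h|) := by
          gcongr; exact abs_exp_sub_one_sub_le _
      _ = |q y| * (l y h) ^ 2 * (Real.exp (l y e - ρ y) * Real.exp |l y h|) := by ring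
      _ ≤ |q y| * (C₀ ^ 2 * (1 + ρ y) ^ 2 * ‖h‖ ^ 2) * Real.exp (-(1 / 2) * ρ y) := by gcongr
      _ = C₀ ^ 2 * ‖h‖ ^ 2 * (|q y * (1 + ρ y) ^ 2| * Real.exp (-(1 / 2) * ρ y)) := by
          rw [abs_mul, abs_of_nonneg (by positivity : 0 ≤ (1 + ρ y) ^ 2)]; ring
      _ ≤ C₀ ^ 2 * ‖h‖ ^ 2 * K := by gcongr; exact hK y
      _ = _ := by ring
  · have := (Asymptotics.isLittleO_norm_pow_id (one_lt_two)).comp_tendsto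
      (show Tendsto (fun e' : E => e' - e) (𝓝 e) (𝓝 0) by
        have : Continuous fun e' : E => e' - e := by fun_prop
        simpa using this.tendsto e)
    exact this

/-- Induction on the order with `q` generalised: each derivative is again a symbol, with a new
prefactor of polynomial growth. -/
lemma contDiffOn_expSymbol [FiniteDimensional ℝ E] (hρ : Continuous ρ) (hρ0 : ∀ y, 0 ≤ ρ y)
    (hl : Continuous l) (hC₀ : 0 < C₀) (hlρ : ∀ y, ‖l y‖ ≤ C₀ * ρ y) {q : Ω → ℝ}
    (hq : PolyGrowth ρ q) :
    ContDiffOn ℝ ∞ (expSymbol ρ l q) (Metric.ball (0 : E) (1 / (2 * C₀))) := by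
  rw [contDiffOn_infty]
  intro n
  induction n generalizing q with
  | zero =>
    rw [Nat.cast_zero, contDiffOn_zero]
    intro e he
    obtain ⟨D, hD, -⟩ := hasFDerivAt_expSymbol hρ hρ0 hl hC₀ hlρ hq (e := e) (by simpa using he)
    exact hD.continuousAt.continuousWithinAt
  | succ n ih =>
    rw [Nat.cast_add, Nat.cast_one, contDiffOn_succ_iff_fderiv_of_isOpen Metric.isOpen_ball]
    refine ⟨fun e he => ?_, fun h => ?_, ?_⟩
    · obtain ⟨D, hD, -⟩ := hasFDerivAt_expSymbol hρ hρ0 hl hC₀ hlρ hq (e := e) (by simpa using he)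
      exact hD.differentiableAt.differentiableWithinAt
    · exact absurd h (by simp)
    · rw [contDiffOn_clm_apply]
      intro δ
      refine (ih (hq.mul_clm hρ0 hl hC₀.le hlρ δ)).congr fun e he => ?_
      obtain ⟨D, hD, hDδ⟩ :=
        hasFDerivAt_expSymbol hρ hρ0 hl hC₀ hlρ hq (e := e) (by simpa using he)
      rw [hD.fderiv, hDδ]

end ExpSymbol

/-! ### Kernel operators on space-time fields. -/

/-- Bounded continuous scalar fields on space-time. -/
abbrev ScalarField : Type := BF (Space × ℝ)

/-- An average over past times: at time `t` the measure `ν` of fractions `s ∈ [0, 1]` is weighted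
by `m t`, and the result is bounded after damping by `exp (-(a / 8) t s)`. -/
structure TimeAverage (a : ℝ) where
  ν : Measure ℝ
  finite : IsFiniteMeasure ν
  supp : ∀ᵐ s ∂ν, s ∈ Icc (0 : ℝ) 1
  m : ℝ → ℝ
  continuous_m : Continuous m
  m_nonneg : ∀ t, 0 ≤ t → 0 ≤ m t
  C : ℝ
  bound : ∀ t, 0 ≤ t → m t * ∫ s, Real.exp (-(a / 8) * (t * s)) ∂ν ≤ C

attribute [instance] TimeAverage.finite

/-- A wide Gaussian measure, against which symbols are integrated. -/
def wideGauss : Measure Space :=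
  volume.withDensity fun z => ENNReal.ofReal
    (Real.exp (-(1 / 8) * ‖z‖ ^ 2) / (4 * Real.pi) ^ (3 / 2 : ℝ))

instance : IsFiniteMeasure wideGauss := by
  refine isFiniteMeasure_withDensity_ofReal ?_
  exact ((integrable_exp_neg_mul_sq_norm (by norm_num)).div_const _).2

lemma integral_wideGauss (f : Space → ℝ) : ∫ z, f z ∂wideGauss =
    ∫ z, Real.exp (-(1 / 8) * ‖z‖ ^ 2) / (4 * Real.pi) ^ (3 / 2 : ℝ) * f z := by
  unfold wideGauss
  rw [integral_withDensity_eq_integral_toReal_smul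
    (Measurable.ennreal_ofReal (by fun_prop)) (by simp)]
  refine integral_congr_ae (Eventually.of_forall fun z => ?_)
  simp only
  rw [ENNReal.toReal_ofReal (by positivity), smul_eq_mul]

section KernelOperator

variable {a : ℝ} (W : TimeAverage a) (ha : 0 ≤ a)

/-- The integrand of the kernel operator with symbol `φ`. -/
def kernelIntegrand (a : ℝ) (φ : BF (ℝ × Space)) (f : ScalarField) (x : Space) (t : ℝ)
    (q : ℝ × Space) : ℝ :=
  Real.exp (-(a / 2) * (t * q.1)) *
    (φ (t * q.1, q.2) * f (x - Real.sqrt (t * q.1) • q.2, t - t * q.1))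

/-- The function underlying the kernel operator with symbol `φ`. -/
def kernelFun (φ : BF (ℝ × Space)) (f : ScalarField) (p : Space × ℝ) : ℝ :=
  -- Negative times are frozen at time zero, so that fields live on the whole of `Space × ℝ`.
  W.m (max p.2 0) *
    ∫ q, kernelIntegrand a φ f p.1 (max p.2 0) q ∂(W.ν.prod wideGauss)

lemma TimeAverage.ae_fst_mem : ∀ᵐ q ∂(W.ν.prod wideGauss), q.1 ∈ Icc (0 : ℝ) 1 :=
  Measure.quasiMeasurePreserving_fst.ae W.supp

lemma continuous_kernelIntegrand (φ : BF (ℝ × Space)) (f : ScalarField) :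
    Continuous fun r : (Space × ℝ) × (ℝ × Space) =>
      kernelIntegrand a φ f r.1.1 (max r.1.2 0) r.2 := by
  unfold kernelIntegrand
  have := φ.continuous
  have := f.continuous
  fun_prop

lemma abs_symbol_mul_field_le (φ : BF (ℝ × Space)) (f : ScalarField) (u : ℝ × Space)
    (v : Space × ℝ) : |φ u * f v| ≤ ‖φ‖ * ‖f‖ := by
  rw [abs_mul]
  have h1 := φ.norm_coe_le_norm u
  have h2 := f.norm_coe_le_norm v
  rw [Real.norm_eq_abs] at h1 h2
  gcongr

include ha in
lemma norm_kernelIntegrand_le (φ : BF (ℝ × Space)) (f : ScalarField) (x : Space) {t : ℝ}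
    (ht : 0 ≤ t) {q : ℝ × Space} (hq : q.1 ∈ Icc (0 : ℝ) 1) :
    ‖kernelIntegrand a φ f x t q‖ ≤ Real.exp (-(a / 8) * (t * q.1)) * (‖φ‖ * ‖f‖) := by
  unfold kernelIntegrand
  rw [norm_mul, Real.norm_of_nonneg (Real.exp_pos _).le]
  have h0 : 0 ≤ a * (t * q.1) := mul_nonneg ha (mul_nonneg ht hq.1)
  have h1 : Real.exp (-(a / 2) * (t * q.1)) ≤ Real.exp (-(a / 8) * (t * q.1)) := by
    apply Real.exp_le_exp.2; linarith
  have := abs_symbol_mul_field_le φ f (t * q.1, q.2)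
    (x - Real.sqrt (t * q.1) • q.2, t - t * q.1)
  gcongr
  exact this

include ha in
lemma integrable_kernelIntegrand (φ : BF (ℝ × Space)) (f : ScalarField) (x : Space) {t : ℝ}
    (ht : 0 ≤ t) : Integrable (kernelIntegrand a φ f x t) (W.ν.prod wideGauss) := by
  have hc : Continuous fun q : ℝ × Space => kernelIntegrand a φ f x t q := by
    have h := (continuous_kernelIntegrand (a := a) φ f).comp
      (show Continuous fun q : ℝ × Space => ((x, t), q) by fun_prop)
    simpa [Function.comp_def, max_eq_left ht] using h
  refine Integrable.of_bound hc.aestronglyMeasurable (‖φ‖ * ‖f‖) ?_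
  filter_upwards [W.ae_fst_mem] with q hq
  refine (norm_kernelIntegrand_le ha φ f x ht hq).trans ?_
  have : Real.exp (-(a / 8) * (t * q.1)) ≤ 1 := by
    rw [Real.exp_le_one_iff]
    have h0 : 0 ≤ a * (t * q.1) := mul_nonneg ha (mul_nonneg ht hq.1)
    linarith
  exact mul_le_of_le_one_left (by positivity) this

include ha in
lemma continuous_kernelFun (φ : BF (ℝ × Space)) (f : ScalarField) :
    Continuous (kernelFun W φ f) := by
  unfold kernelFun
  have hm := W.continuous_m
  refine (hm.comp (by fun_prop)).mul ?_
  have hc := continuous_kernelIntegrand (a := a) φ f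
  refine continuous_of_dominated (bound := fun _ => ‖φ‖ * ‖f‖) (fun p => ?_) (fun p => ?_)
    (integrable_const _) (Eventually.of_forall fun q => ?_)
  · exact (integrable_kernelIntegrand W ha φ f p.1 (le_max_right _ _)).aestronglyMeasurable
  · filter_upwards [W.ae_fst_mem] with q hq
    refine (norm_kernelIntegrand_le ha φ f p.1 (le_max_right _ _) hq).trans ?_
    have : Real.exp (-(a / 8) * (max p.2 0 * q.1)) ≤ 1 := by
      rw [Real.exp_le_one_iff]
      have h0 : 0 ≤ a * (max p.2 0 * q.1) := mul_nonneg ha (mul_nonneg (le_max_right _ _) hq.1)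
      linarith
    exact mul_le_of_le_one_left (by positivity) this
  · exact hc.comp (show Continuous fun p : Space × ℝ => (p, q) by fun_prop)

include ha in
-- The damping exp(-(a/2)ts) is weakened to exp(-(a/8)ts), which makes the time average bounded
-- uniformly in t; the wide Gaussian has finite mass.
lemma norm_kernelFun_le (φ : BF (ℝ × Space)) (f : ScalarField) (p : Space × ℝ) :
    ‖kernelFun W φ f p‖ ≤ (W.C * wideGauss.real univ) * ‖φ‖ * ‖f‖ := by
  unfold kernelFun
  set t := max p.2 0
  have ht : 0 ≤ t := le_max_right _ _
  have hm := W.m_nonneg t ht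
  have hi : Integrable (fun s : ℝ => Real.exp (-(a / 8) * (t * s))) W.ν := by
    refine Integrable.of_bound (Continuous.aestronglyMeasurable (by fun_prop)) 1 ?_
    filter_upwards [W.supp] with s hs
    rw [Real.norm_of_nonneg (Real.exp_pos _).le, Real.exp_le_one_iff]
    have h0 : 0 ≤ a * (t * s) := mul_nonneg ha (mul_nonneg ht hs.1)
    linarith
  have h1 : ‖∫ q, kernelIntegrand a φ f p.1 t q ∂(W.ν.prod wideGauss)‖ ≤
      ∫ q : ℝ × Space, Real.exp (-(a / 8) * (t * q.1)) * (‖φ‖ * ‖f‖) ∂(W.ν.prod wideGauss) := by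
    refine norm_integral_le_of_norm_le ?_ ?_
    · exact hi.mul_prod (integrable_const (‖φ‖ * ‖f‖))
    · filter_upwards [W.ae_fst_mem] with q hq
      exact norm_kernelIntegrand_le ha φ f p.1 ht hq
  rw [integral_prod_mul (μ := W.ν) (ν := wideGauss) (fun s => Real.exp (-(a / 8) * (t * s)))
    (fun _ => ‖φ‖ * ‖f‖), integral_const, smul_eq_mul] at h1
  rw [norm_mul, Real.norm_of_nonneg hm]
  calc W.m t * ‖∫ q, kernelIntegrand a φ f p.1 t q ∂(W.ν.prod wideGauss)‖
      ≤ W.m t * ((∫ s, Real.exp (-(a / 8) * (t * s)) ∂W.ν) *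
        (wideGauss.real univ * (‖φ‖ * ‖f‖))) := by gcongr
    _ = (W.m t * ∫ s, Real.exp (-(a / 8) * (t * s)) ∂W.ν) *
        (wideGauss.real univ * (‖φ‖ * ‖f‖)) := by ring
    _ ≤ W.C * (wideGauss.real univ * (‖φ‖ * ‖f‖)) := by
        gcongr; exact W.bound t ht
    _ = _ := by ring

/-- The kernel operator attached to a time average, as a bounded bilinear map in the symbol and
the field. -/
def kernelOp : BF (ℝ × Space) →L[ℝ] ScalarField →L[ℝ] ScalarField :=
  LinearMap.mkContinuous₂
    (LinearMap.mk₂ ℝ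
      (fun φ f => BF.ofBound (kernelFun W φ f)
        (continuous_kernelFun W ha φ f) _ (norm_kernelFun_le W ha φ f))
      (fun φ φ' f => by
        ext p
        change kernelFun W (φ + φ') f p = kernelFun W φ f p + kernelFun W φ' f p
        unfold kernelFun
        rw [← mul_add, ← integral_add (integrable_kernelIntegrand W ha φ f p.1 (le_max_right _ _))
          (integrable_kernelIntegrand W ha φ' f p.1 (le_max_right _ _))]
        congr 2; ext q; simp only [kernelIntegrand, BF.add_apply]; ring)
      (fun c φ f => by
        ext p
        change kernelFun W (c • φ) f p = c * kernelFun W φ f p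
        unfold kernelFun
        rw [mul_left_comm, ← integral_const_mul c]
        congr 2; ext q
        simp only [kernelIntegrand, BF.smul_apply]; ring)
      (fun φ f f' => by
        ext p
        change kernelFun W φ (f + f') p = kernelFun W φ f p + kernelFun W φ f' p
        unfold kernelFun
        rw [← mul_add, ← integral_add (integrable_kernelIntegrand W ha φ f p.1 (le_max_right _ _))
          (integrable_kernelIntegrand W ha φ f' p.1 (le_max_right _ _))]
        congr 2; ext q; simp only [kernelIntegrand, BF.add_apply]; ring)
      (fun c φ f => by
        ext p
        change kernelFun W φ (c • f) p = c * kernelFun W φ f p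
        unfold kernelFun
        rw [mul_left_comm, ← integral_const_mul c]
        congr 2; ext q
        simp only [kernelIntegrand, BF.smul_apply]; ring))
    (W.C * wideGauss.real univ) (fun φ f => by
      have hC : 0 ≤ W.C := le_trans (mul_nonneg (W.m_nonneg 0 le_rfl)
        (integral_nonneg fun s => (Real.exp_pos _).le)) (W.bound 0 le_rfl)
      rw [LinearMap.mk₂_apply]
      exact (BF.norm_le (by positivity)).2 (norm_kernelFun_le W ha φ f))

lemma kernelOp_apply (φ : BF (ℝ × Space)) (f : ScalarField) (p : Space × ℝ) :
    kernelOp W ha φ f p = kernelFun W φ f p := rfl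

end KernelOperator

/-! ### The symbol of the rescaled and sheared heat kernel. -/

section Symbol

/-- The parameters of the exponent. -/
abbrev ExpParam : Type := ℝ × Space × ℝ × ℝ

/-- The damping exponent that controls all symbols. -/
def symbolWeight (a : ℝ) (q : ℝ × Space) : ℝ := ‖q.2‖ ^ 2 / 8 + a / 2 * max q.1 0

/-- The exponent of the rescaled heat kernels, linear in the parameters. -/
def symbolForm (a : ℝ) (q : ℝ × Space) : ExpParam →L[ℝ] ℝ :=
  (-(‖q.2‖ ^ 2 / 4)) • ContinuousLinearMap.fst ℝ ℝ (Space × ℝ × ℝ)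
  + (-(Real.sqrt (max q.1 0) / 2)) • ((innerSL ℝ q.2).comp
      ((ContinuousLinearMap.fst ℝ Space (ℝ × ℝ)).comp
        (ContinuousLinearMap.snd ℝ ℝ (Space × ℝ × ℝ))))
  + (-(max q.1 0 / 4)) • ((ContinuousLinearMap.fst ℝ ℝ ℝ).comp
      ((ContinuousLinearMap.snd ℝ Space (ℝ × ℝ)).comp
        (ContinuousLinearMap.snd ℝ ℝ (Space × ℝ × ℝ))))
  + (-(a * max q.1 0)) • ((ContinuousLinearMap.snd ℝ ℝ ℝ).comp
      ((ContinuousLinearMap.snd ℝ Space (ℝ × ℝ)).comp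
        (ContinuousLinearMap.snd ℝ ℝ (Space × ℝ × ℝ))))

lemma symbolForm_apply (a : ℝ) (q : ℝ × Space) (e : ExpParam) :
    symbolForm a q e = -(‖q.2‖ ^ 2 / 4) * e.1 - Real.sqrt (max q.1 0) / 2 * inner ℝ q.2 e.2.1
      - max q.1 0 / 4 * e.2.2.1 - a * max q.1 0 * e.2.2.2 := by
  simp [symbolForm, innerSL_apply_apply ℝ]
  ring

lemma continuous_symbolForm (a : ℝ) : Continuous (symbolForm a) := by
  unfold symbolForm
  have h : Continuous fun q : ℝ × Space => (innerSL ℝ q.2).comp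
      ((ContinuousLinearMap.fst ℝ Space (ℝ × ℝ)).comp
        (ContinuousLinearMap.snd ℝ ℝ (Space × ℝ × ℝ))) :=
    ((innerSL ℝ (E := Space)).continuous.comp continuous_snd).clm_comp continuous_const
  fun_prop

lemma continuous_symbolWeight (a : ℝ) : Continuous (symbolWeight a) := by
  unfold symbolWeight; fun_prop

lemma symbolWeight_nonneg {a : ℝ} (ha : 0 < a) (q : ℝ × Space) : 0 ≤ symbolWeight a q := by
  unfold symbolWeight
  have : 0 ≤ max q.1 0 := le_max_right _ _
  positivity

/-- The constant comparing the exponent with its weight. -/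
def symbolConst (a : ℝ) : ℝ := 4 + (1 + 2 * a) / a

lemma symbolConst_pos {a : ℝ} (ha : 0 < a) : 0 < symbolConst a := by
  unfold symbolConst; positivity

lemma norm_symbolForm_le {a : ℝ} (ha : 0 < a) (q : ℝ × Space) :
    ‖symbolForm a q‖ ≤ symbolConst a * symbolWeight a q := by
  refine ContinuousLinearMap.opNorm_le_bound _
    (mul_nonneg (symbolConst_pos ha).le (symbolWeight_nonneg ha q)) fun e => ?_
  rw [symbolForm_apply, Real.norm_eq_abs]
  set τ := max q.1 0 with hτ
  have hτ0 : 0 ≤ τ := le_max_right _ _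
  set z := q.2
  have h1 : |e.1| ≤ ‖e‖ := norm_fst_le e
  have h2 : ‖e.2.1‖ ≤ ‖e‖ := (norm_fst_le e.2).trans (norm_snd_le e)
  have h3 : |e.2.2.1| ≤ ‖e‖ :=
    (norm_fst_le e.2.2).trans ((norm_snd_le e.2).trans (norm_snd_le e))
  have h4 : |e.2.2.2| ≤ ‖e‖ :=
    (norm_snd_le e.2.2).trans ((norm_snd_le e.2).trans (norm_snd_le e))
  have h5 : |inner ℝ z e.2.1| ≤ ‖z‖ * ‖e‖ :=
    (abs_real_inner_le_norm z e.2.1).trans (by gcongr)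
  have hs : Real.sqrt τ * ‖z‖ ≤ (τ + ‖z‖ ^ 2) / 2 := by
    nlinarith [sq_nonneg (Real.sqrt τ - ‖z‖), Real.sq_sqrt hτ0]
  have e1 : |-(‖z‖ ^ 2 / 4) * e.1| ≤ ‖z‖ ^ 2 / 4 * ‖e‖ := by
    rw [abs_mul, abs_neg, abs_of_nonneg (by positivity)]; gcongr
  have e2 : |Real.sqrt τ / 2 * inner ℝ z e.2.1| ≤ (τ + ‖z‖ ^ 2) / 4 * ‖e‖ := by
    rw [abs_mul, abs_of_nonneg (by positivity)]
    calc Real.sqrt τ / 2 * |inner ℝ z e.2.1| ≤ Real.sqrt τ / 2 * (‖z‖ * ‖e‖) := by gcongr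
      _ = (Real.sqrt τ * ‖z‖) / 2 * ‖e‖ := by ring
      _ ≤ ((τ + ‖z‖ ^ 2) / 2) / 2 * ‖e‖ := by gcongr
      _ = _ := by ring
  have e3 : |τ / 4 * e.2.2.1| ≤ τ / 4 * ‖e‖ := by
    rw [abs_mul, abs_of_nonneg (by positivity)]; gcongr
  have e4 : |a * τ * e.2.2.2| ≤ a * τ * ‖e‖ := by
    rw [abs_mul, abs_of_nonneg (by positivity)]; gcongr
  have hfin : (‖z‖ ^ 2 / 2 + (1 / 2 + a) * τ) ≤ symbolConst a * symbolWeight a q := by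
    have : symbolConst a * symbolWeight a q
        = ‖z‖ ^ 2 / 2 + (1 / 2 + a) * τ + (2 * a * τ + (1 + 2 * a) / a * (‖z‖ ^ 2 / 8)) := by
      unfold symbolConst symbolWeight
      rw [← hτ]
      change _ = ‖q.2‖ ^ 2 / 2 + (1 / 2 + a) * τ + (2 * a * τ + (1 + 2 * a) / a * (‖q.2‖ ^ 2 / 8))
      field_simp
      ring
    rw [this]
    have : 0 ≤ 2 * a * τ + (1 + 2 * a) / a * (‖z‖ ^ 2 / 8) := by positivity
    linarith
  have hmain : |-(‖z‖ ^ 2 / 4) * e.1 - Real.sqrt τ / 2 * inner ℝ z e.2.1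
      - τ / 4 * e.2.2.1 - a * τ * e.2.2.2| ≤ (‖z‖ ^ 2 / 2 + (1 / 2 + a) * τ) * ‖e‖ := by
    rw [abs_le] at e1 e2 e3 e4 ⊢
    constructor <;> nlinarith [e1.1, e1.2, e2.1, e2.2, e3.1, e3.2, e4.1, e4.2]
  exact hmain.trans (by gcongr)

/-- The exponent parameters of the kernel rescaled by `λ` in time and sheared by `μ` in space. -/
def paramMap (θ : ℝ × Space) : ExpParam :=
  (1 / θ.1 - 1, (1 / θ.1) • θ.2, ‖θ.2‖ ^ 2 / θ.1, θ.1 - 1)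

lemma paramMap_one_zero : paramMap (1, 0) = 0 := by simp [paramMap]

lemma contDiffAt_paramMap {θ : ℝ × Space} (hθ : 0 < θ.1) : ContDiffAt ℝ ∞ paramMap θ := by
  unfold paramMap
  have h1 : ContDiffAt ℝ ∞ (fun θ : ℝ × Space => 1 / θ.1) θ :=
    contDiffAt_const.div contDiffAt_fst hθ.ne'
  have h2 : ContDiffAt ℝ ∞ (fun θ : ℝ × Space => ‖θ.2‖ ^ 2 / θ.1) θ :=
    (contDiffAt_snd.norm_sq ℝ).div contDiffAt_fst hθ.ne'
  exact (h1.sub contDiffAt_const).prodMk ((h1.smul contDiffAt_snd).prodMk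
    (h2.prodMk (contDiffAt_fst.sub contDiffAt_const)))

/-- The admissible rescalings. -/
def admissible (a : ℝ) : Set (ℝ × Space) :=
  {θ | 0 < θ.1 ∧ ‖paramMap θ‖ < 1 / (2 * symbolConst a)}

lemma one_zero_mem_admissible {a : ℝ} (ha : 0 < a) : ((1, 0) : ℝ × Space) ∈ admissible a := by
  have := symbolConst_pos ha
  refine ⟨by simp, ?_⟩
  rw [paramMap_one_zero, norm_zero]; positivity

lemma admissible_mem_nhds {a : ℝ} (ha : 0 < a) : admissible a ∈ 𝓝 ((1, 0) : ℝ × Space) := by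
  have h1 : ∀ᶠ θ in 𝓝 ((1, 0) : ℝ × Space), 0 < θ.1 :=
    continuousAt_fst.eventually (lt_mem_nhds (by simp))
  have h2 : ContinuousAt (fun θ => ‖paramMap θ‖) ((1, 0) : ℝ × Space) :=
    (contDiffAt_paramMap (by simp)).continuousAt.norm
  have h3 := h2.eventually (gt_mem_nhds (one_zero_mem_admissible ha).2)
  filter_upwards [h1, h3] with θ hθ1 hθ2 using ⟨hθ1, hθ2⟩

/-- The symbol of the rescaled heat kernel. -/
def symbol (a : ℝ) (θ : ℝ × Space) : BF (ℝ × Space) :=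
  expSymbol (symbolWeight a) (symbolForm a) (fun _ => 1) (paramMap θ)

lemma polyGrowth_one {a : ℝ} (ha : 0 < a) : PolyGrowth (symbolWeight a) fun _ => 1 := by
  refine ⟨continuous_const, 1, 1, zero_le_one, zero_lt_one, fun q => ?_⟩
  have := symbolWeight_nonneg ha q
  simp only [abs_one, Real.rpow_one, one_mul]
  linarith

lemma contDiffAt_symbol {a : ℝ} (ha : 0 < a) : ContDiffAt ℝ ∞ (symbol a) (1, 0) := by
  have h := contDiffOn_expSymbol (continuous_symbolWeight a) (symbolWeight_nonneg ha)
    (continuous_symbolForm a) (symbolConst_pos ha) (norm_symbolForm_le ha) (polyGrowth_one ha)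
  have h0 : Metric.ball (0 : ExpParam) (1 / (2 * symbolConst a)) ∈ 𝓝 (paramMap (1, 0)) := by
    rw [paramMap_one_zero]
    have := symbolConst_pos ha
    exact Metric.ball_mem_nhds _ (by positivity)
  exact (h.contDiffAt h0).comp (1, 0) (contDiffAt_paramMap (by simp))

/-- The two prefactors restore the damping divided out in `kernelIntegrand` and `wideGauss`. The
four coordinates of `paramMap` are the coefficients that then complete the exponent to -aλτ - |z +
√τ μ|²/(4λ). -/
lemma symbol_apply {a : ℝ} (ha : 0 < a) {θ : ℝ × Space} (hθ : θ ∈ admissible a) {τ : ℝ}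
    (hτ : 0 ≤ τ) (z : Space) :
    Real.exp (-(1 / 8) * ‖z‖ ^ 2) * (Real.exp (-(a / 2) * τ) * symbol a θ (τ, z))
      = Real.exp (-(a * θ.1 * τ)) *
        Real.exp (-(1 / 4) * ‖(Real.sqrt θ.1)⁻¹ • (z + Real.sqrt τ • θ.2)‖ ^ 2) := by
  have hθ1 := hθ.1
  unfold symbol
  rw [expSymbol_apply (continuous_symbolWeight a) (symbolWeight_nonneg ha)
    (continuous_symbolForm a) (symbolConst_pos ha) (norm_symbolForm_le ha) (polyGrowth_one ha)
    hθ.2.le, one_mul, ← Real.exp_add, ← Real.exp_add, ← Real.exp_add]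
  congr 1
  rw [symbolForm_apply, norm_smul, mul_pow, norm_inv, Real.norm_of_nonneg (Real.sqrt_nonneg _),
    inv_pow, Real.sq_sqrt hθ1.le, norm_add_sq_real, norm_smul,
    Real.norm_of_nonneg (Real.sqrt_nonneg _), mul_pow, Real.sq_sqrt hτ, real_inner_smul_right]
  simp only [symbolWeight, paramMap, max_eq_left hτ, real_inner_smul_right]
  field_simp
  ring

/-- Substituting w = λ^{-1/2}(z + √τ μ), with Jacobian λ^{3/2}, turns the symbol into a genuine heat
average at a shifted point. On the left g is sampled at points independent of θ, so smoothness in θ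
asks nothing of g. -/
lemma integral_wideGauss_symbol {a : ℝ} (ha : 0 < a) {θ : ℝ × Space} (hθ : θ ∈ admissible a)
    {τ : ℝ} (hτ : 0 ≤ τ) (g : Space → ℝ) (x : Space) :
    ∫ z, Real.exp (-(a / 2) * τ) * (symbol a θ (τ, z) * g (x - Real.sqrt τ • z)) ∂wideGauss
      = θ.1 ^ (3 / 2 : ℝ) * (Real.exp (-(a * θ.1 * τ)) * heat (θ.1 * τ) g (x + τ • θ.2)) := by
  have hθ1 := hθ.1
  have hs : 0 < Real.sqrt θ.1 := Real.sqrt_pos.2 hθ1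
  rw [integral_wideGauss]
  set h : Space → ℝ := fun w => gauss w * g (x + τ • θ.2 - Real.sqrt (θ.1 * τ) • w) with hh
  have h1 : ∀ z : Space, Real.exp (-(1 / 8) * ‖z‖ ^ 2) / (4 * Real.pi) ^ (3 / 2 : ℝ) *
      (Real.exp (-(a / 2) * τ) * (symbol a θ (τ, z) * g (x - Real.sqrt τ • z)))
      = Real.exp (-(a * θ.1 * τ)) * h ((Real.sqrt θ.1)⁻¹ • (z + Real.sqrt τ • θ.2)) := by
    intro z
    have e1 : x + τ • θ.2 - Real.sqrt (θ.1 * τ) • ((Real.sqrt θ.1)⁻¹ • (z + Real.sqrt τ • θ.2))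
        = x - Real.sqrt τ • z := by
      rw [Real.sqrt_mul hθ1.le, smul_smul, mul_comm (Real.sqrt θ.1), mul_assoc,
        mul_inv_cancel₀ hs.ne', mul_one, smul_add, smul_smul, Real.mul_self_sqrt hτ]
      abel
    have e2 := symbol_apply ha hθ hτ z
    simp only [hh]
    rw [e1, gauss]
    calc _ = (Real.exp (-(1 / 8) * ‖z‖ ^ 2) * (Real.exp (-(a / 2) * τ) * symbol a θ (τ, z)))
          / (4 * Real.pi) ^ (3 / 2 : ℝ) * g (x - Real.sqrt τ • z) := by ring
      _ = _ := by rw [e2]; ring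
  simp_rw [h1]
  rw [integral_const_mul]
  have h2 : ∫ z, h ((Real.sqrt θ.1)⁻¹ • (z + Real.sqrt τ • θ.2))
      = θ.1 ^ (3 / 2 : ℝ) * ∫ w, h w := by
    rw [integral_add_right_eq_self (fun z => h ((Real.sqrt θ.1)⁻¹ • z)) (Real.sqrt τ • θ.2),
      Measure.integral_comp_smul]
    have : |(((Real.sqrt θ.1)⁻¹) ^ Module.finrank ℝ Space)⁻¹| = θ.1 ^ (3 / 2 : ℝ) := by
      have hfr : Module.finrank ℝ Space = 3 := by simp
      rw [hfr, inv_pow, inv_inv, abs_of_pos (by positivity), Real.sqrt_eq_rpow,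
        ← Real.rpow_natCast, ← Real.rpow_mul hθ1.le]
      norm_num
    rw [this, smul_eq_mul]
  rw [h2]
  unfold heat
  rw [integral_gaussMeasure]
  simp only [hh, smul_eq_mul]
  ring

/-- The kernel operator of the symbol, in terms of the heat semigroup. -/
lemma kernelOp_symbol {a : ℝ} (ha : 0 < a) (W : TimeAverage a) {θ : ℝ × Space}
    (hθ : θ ∈ admissible a) (f : ScalarField) (x : Space) {t : ℝ} (ht : 0 ≤ t) :
    kernelOp W ha.le (symbol a θ) f (x, t) = θ.1 ^ (3 / 2 : ℝ) * (W.m t *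
      ∫ s, Real.exp (-(a * θ.1 * (t * s))) *
        heat (θ.1 * (t * s)) (fun y => f (y, t - t * s)) (x + (t * s) • θ.2) ∂W.ν) := by
  rw [kernelOp_apply, kernelFun]
  simp only [max_eq_left ht]
  rw [integral_prod _ (integrable_kernelIntegrand W ha.le _ f x ht), mul_left_comm,
    ← integral_const_mul (θ.1 ^ (3 / 2 : ℝ))]
  congr 1
  refine integral_congr_ae ?_
  filter_upwards [W.supp] with s hs
  simp only [kernelIntegrand]
  exact integral_wideGauss_symbol ha hθ (mul_nonneg ht hs.1) (fun y => f (y, t - t * s)) x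

end Symbol

/-! ### The operators of the mild formulation and their dependence on the rescaling. -/

/-- Evaluation at the present time. -/
def dataAverage {a : ℝ} (ha : 0 < a) : TimeAverage a where
  -- The fraction s = 1 is a lag equal to the whole elapsed time, so the field is read at time zero.
  ν := Measure.dirac 1
  finite := inferInstance
  supp := by rw [ae_dirac_eq]; simp
  m := fun _ => 1
  continuous_m := continuous_const
  m_nonneg := fun _ _ => zero_le_one
  C := 1
  bound := fun t ht => by
    rw [integral_dirac, one_mul, mul_one, Real.exp_le_one_iff]
    have : 0 ≤ a * t := by positivity
    linarith

lemma mul_integral_exp_le {a : ℝ} (ha : 0 < a) (t : ℝ) :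
    t * ∫ s in Icc (0 : ℝ) 1, Real.exp (-(a / 8) * (t * s)) ≤ 8 / a := by
  rw [integral_Icc_eq_integral_Ioc, ← intervalIntegral.integral_of_le zero_le_one]
  have h : ∀ s ∈ uIcc (0 : ℝ) 1, HasDerivAt
      (fun s => -(8 / a) * Real.exp (-(a / 8) * (t * s))) (t * Real.exp (-(a / 8) * (t * s))) s := by
    intro s _
    have := (((hasDerivAt_id s).const_mul t).const_mul (-(a / 8))).exp.const_mul (-(8 / a))
    refine this.congr_deriv ?_
    simp only [id]
    field_simp
  rw [← intervalIntegral.integral_const_mul, intervalIntegral.integral_eq_sub_of_hasDerivAt h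
    (Continuous.intervalIntegrable (by fun_prop) _ _)]
  simp only [mul_one, mul_zero, Real.exp_zero]
  have := Real.exp_pos (-(a / 8) * t)
  have : 0 ≤ 8 / a * Real.exp (-(a / 8) * t) := by positivity
  linarith

/-- Uniform average over the past. -/
def duhamelAverage {a : ℝ} (ha : 0 < a) : TimeAverage a where
  ν := volume.restrict (Icc 0 1)
  finite := inferInstance
  supp := ae_restrict_mem measurableSet_Icc
  m := id
  continuous_m := continuous_id
  m_nonneg := fun _ h => h
  C := 8 / a
  bound := fun t _ => mul_integral_exp_le ha t

/-- The damped heat flow of the initial value, rescaled and sheared. -/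
def dataOp {a : ℝ} (ha : 0 < a) (θ : ℝ × Space) : ScalarField →L[ℝ] ScalarField :=
  θ.1 ^ (-(3 / 2) : ℝ) • kernelOp (dataAverage ha) ha.le (symbol a θ)

/-- The Duhamel integral of the damped heat flow, rescaled and sheared. -/
def duhamelOp {a : ℝ} (ha : 0 < a) (θ : ℝ × Space) : ScalarField →L[ℝ] ScalarField :=
  θ.1 ^ (-(1 / 2) : ℝ) • kernelOp (duhamelAverage ha) ha.le (symbol a θ)

section ParameterDomain

variable {a : ℝ} (ha : 0 < a)

lemma dataOp_apply {θ : ℝ × Space} (hθ : θ ∈ admissible a) (f : ScalarField) (x : Space) {t : ℝ}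
    (ht : 0 ≤ t) : dataOp ha θ f (x, t) = Real.exp (-(a * θ.1 * t)) *
      heat (θ.1 * t) (fun y => f (y, 0)) (x + t • θ.2) := by
  have hθ1 := hθ.1
  change θ.1 ^ (-(3 / 2) : ℝ) * kernelOp (dataAverage ha) ha.le (symbol a θ) f (x, t) = _
  rw [kernelOp_symbol ha _ hθ f x ht, ← mul_assoc, ← Real.rpow_add hθ1]
  simp [dataAverage]

/-- The normalising power -1/2 does not cancel the Jacobian λ^{3/2} completely: the remaining λ is
the change of time variable in the rescaled Duhamel integral. For `dataOp` the power -3/2 cancels it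
exactly. -/
lemma duhamelOp_apply {θ : ℝ × Space} (hθ : θ ∈ admissible a) (f : ScalarField) (x : Space) {t : ℝ}
    (ht : 0 ≤ t) : duhamelOp ha θ f (x, t) = θ.1 * (t * ∫ s in Icc (0 : ℝ) 1,
      Real.exp (-(a * θ.1 * (t * s))) *
        heat (θ.1 * (t * s)) (fun y => f (y, t - t * s)) (x + (t * s) • θ.2)) := by
  have hθ1 := hθ.1
  change θ.1 ^ (-(1 / 2) : ℝ) * kernelOp (duhamelAverage ha) ha.le (symbol a θ) f (x, t) = _
  rw [kernelOp_symbol ha _ hθ f x ht, ← mul_assoc, ← Real.rpow_add hθ1]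
  have h : θ.1 ^ (-(1 / 2) + 3 / 2 : ℝ) = θ.1 := by norm_num
  rw [h]
  rfl

lemma dataOp_max (θ : ℝ × Space) (f : ScalarField) (x : Space) (t : ℝ) :
    dataOp ha θ f (x, t) = dataOp ha θ f (x, max t 0) := by
  change _ * kernelFun _ _ _ _ = _ * kernelFun _ _ _ _
  simp [kernelFun]

lemma duhamelOp_max (θ : ℝ × Space) (f : ScalarField) (x : Space) (t : ℝ) :
    duhamelOp ha θ f (x, t) = duhamelOp ha θ f (x, max t 0) := by
  change _ * kernelFun _ _ _ _ = _ * kernelFun _ _ _ _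
  simp [kernelFun]

lemma contDiffAt_dataOp : ContDiffAt ℝ ∞ (dataOp ha) (1, 0) := by
  unfold dataOp
  have h1 : ContDiffAt ℝ ∞ (fun θ : ℝ × Space => θ.1 ^ (-(3 / 2) : ℝ)) (1, 0) :=
    contDiffAt_fst.rpow_const_of_ne (by simp)
  exact h1.smul ((kernelOp (dataAverage ha) ha.le).contDiff.contDiffAt.comp _
    (contDiffAt_symbol ha))

lemma contDiffAt_duhamelOp : ContDiffAt ℝ ∞ (duhamelOp ha) (1, 0) := by
  unfold duhamelOp
  have h1 : ContDiffAt ℝ ∞ (fun θ : ℝ × Space => θ.1 ^ (-(1 / 2) : ℝ)) (1, 0) :=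
    contDiffAt_fst.rpow_const_of_ne (by simp)
  exact h1.smul ((kernelOp (duhamelAverage ha) ha.le).contDiff.contDiffAt.comp _
    (contDiffAt_symbol ha))

end ParameterDomain

/-! ### Small, nonnegative, decaying mild solutions. -/

/-- The nonlinearity of the uniaxial equation, for the amplitude of `-diag(1, 1, -2)`. -/
def nonlin (b c : ℝ) (w : ScalarField) : ScalarField := b • w ^ 2 - (6 * c) • w ^ 3

lemma nonlin_apply (b c : ℝ) (w : ScalarField) (p : Space × ℝ) :
    nonlin b c w p = b * w p ^ 2 - 6 * c * w p ^ 3 := rfl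

lemma contDiff_nonlin (b c : ℝ) : ContDiff ℝ ∞ (nonlin b c) := by
  unfold nonlin
  fun_prop

lemma norm_nonlin_sub_le {b c : ℝ} (hb : 0 ≤ b) (hc : 0 ≤ c) {R : ℝ} {w w' : ScalarField}
    (hw : ‖w‖ ≤ R) (hw' : ‖w'‖ ≤ R) :
    ‖nonlin b c w - nonlin b c w'‖ ≤ (2 * b * R + 18 * c * R ^ 2) * ‖w - w'‖ := by
  have hR : 0 ≤ R := (norm_nonneg w).trans hw
  rw [BF.norm_le (by positivity)]
  intro p
  rw [BF.sub_apply, nonlin_apply, nonlin_apply]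
  have h1 := abs_le.1 ((w.norm_coe_le_norm p).trans hw)
  have h2 := abs_le.1 ((w'.norm_coe_le_norm p).trans hw')
  have h3 : |w p - w' p| ≤ ‖w - w'‖ := (w - w').norm_coe_le_norm p
  set u := w p
  set v := w' p
  have h4 : b * u ^ 2 - 6 * c * u ^ 3 - (b * v ^ 2 - 6 * c * v ^ 3)
      = (b * (u + v) - 6 * c * (u ^ 2 + u * v + v ^ 2)) * (u - v) := by ring
  rw [h4, norm_mul]
  have h5 : |b * (u + v) - 6 * c * (u ^ 2 + u * v + v ^ 2)| ≤ 2 * b * R + 18 * c * R ^ 2 := by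
    have e1 : |u + v| ≤ 2 * R := by rw [abs_le]; constructor <;> linarith [h1.1, h1.2, h2.1, h2.2]
    have hu : |u| ≤ R := abs_le.2 h1
    have hv : |v| ≤ R := abs_le.2 h2
    have e2 : |u ^ 2 + u * v + v ^ 2| ≤ 3 * R ^ 2 := by
      calc |u ^ 2 + u * v + v ^ 2| ≤ |u ^ 2| + |u * v| + |v ^ 2| := abs_add_three _ _ _
        _ = |u| ^ 2 + |u| * |v| + |v| ^ 2 := by rw [abs_mul, abs_pow, abs_pow]
        _ ≤ R ^ 2 + R * R + R ^ 2 := by gcongr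
        _ = _ := by ring
    calc _ ≤ |b * (u + v)| + |6 * c * (u ^ 2 + u * v + v ^ 2)| := abs_sub _ _
      _ = b * |u + v| + 6 * c * |u ^ 2 + u * v + v ^ 2| := by
          rw [abs_mul, abs_mul (6 * c), abs_of_nonneg hb, abs_of_nonneg (by positivity : 0 ≤ 6 * c)]
      _ ≤ b * (2 * R) + 6 * c * (3 * R ^ 2) := by gcongr
      _ = _ := by ring
  rw [Real.norm_eq_abs, Real.norm_eq_abs]
  gcongr

/-- The datum profile as a field constant in time. -/
def datumField (δ α : ℝ) : ScalarField :=
  toBCF fun p : Space × ℝ => α * (1 / (1 + ‖p.1‖) ^ (8 + δ))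

lemma datumField_apply {δ α : ℝ} (hδ : 0 < δ) (p : Space × ℝ) :
    datumField δ α p = α * (1 / (1 + ‖p.1‖) ^ (8 + δ)) := by
  refine toBCF_apply (g := fun p : Space × ℝ => α * (1 / (1 + ‖p.1‖) ^ (8 + δ)))
    (C := |α|) ?_ (fun p => ?_) p
  · have h : ∀ p : Space × ℝ, (1 + ‖p.1‖) ^ (8 + δ) ≠ 0 := fun p => by positivity
    have h' : Continuous fun p : Space × ℝ => (1 + ‖p.1‖) ^ (8 + δ) :=
      (by fun_prop : Continuous fun p : Space × ℝ => 1 + ‖p.1‖).rpow_const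
        fun p => Or.inl (by positivity)
    exact continuous_const.mul (continuous_const.div h' h)
  · rw [norm_mul, Real.norm_eq_abs, Real.norm_of_nonneg (by positivity)]
    refine mul_le_of_le_one_right (abs_nonneg α) ?_
    rw [div_le_one (by positivity)]
    exact Real.one_le_rpow (by linarith [norm_nonneg p.1]) (by linarith)

/-- The Lipschitz constant of the nonlinearity vanishes with R, and `duhamelOp` is continuous in θ.
Contraction is needed at all nearby θ, since the regularity argument compares solutions of the
rescaled equations. -/
lemma exists_contraction_radius {a : ℝ} (ha : 0 < a) {b c : ℝ} :
    ∃ R : ℝ, 0 < R ∧ ∀ᶠ θ in 𝓝 ((1, 0) : ℝ × Space),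
      ‖duhamelOp ha θ‖ * (2 * b * R + 18 * c * R ^ 2) ≤ 1 / 2 := by
  set Λ := ‖duhamelOp ha (1, 0)‖ + 1
  have hΛ : 0 < Λ := by positivity
  have hc : ContinuousAt (fun R : ℝ => Λ * |2 * b * R + 18 * c * R ^ 2|) 0 := by fun_prop
  have hev : ∀ᶠ R in 𝓝 (0 : ℝ), Λ * |2 * b * R + 18 * c * R ^ 2| < 1 / 2 :=
    hc.eventually (gt_mem_nhds (by simp))
  have hev' : ∀ᶠ R in 𝓝[>] (0 : ℝ), Λ * |2 * b * R + 18 * c * R ^ 2| < 1 / 2 ∧ 0 < R :=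
    (hev.filter_mono nhdsWithin_le_nhds).and self_mem_nhdsWithin
  obtain ⟨R, hR1, hR⟩ := hev'.exists
  refine ⟨R, hR, ?_⟩
  have h1 : ContinuousAt (fun θ => ‖duhamelOp ha θ‖) (1, 0) :=
    (contDiffAt_duhamelOp ha).continuousAt.norm
  filter_upwards [h1.eventually (gt_mem_nhds (show ‖duhamelOp ha (1, 0)‖ < Λ by simp [Λ]))]
    with θ hθ
  calc ‖duhamelOp ha θ‖ * (2 * b * R + 18 * c * R ^ 2)
      ≤ ‖duhamelOp ha θ‖ * |2 * b * R + 18 * c * R ^ 2| := by gcongr; exact le_abs_self _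
    _ ≤ Λ * |2 * b * R + 18 * c * R ^ 2| := by gcongr
    _ ≤ _ := hR1.le

/-- Decay of the uniaxial amplitude: `0 ≤ w ≤ K exp (-(3 / 4) a t) (1 + |x|)^(-8 - δ)`. -/
def DecayBound (a δ K : ℝ) (w : ScalarField) : Prop :=
  ∀ (x : Space) (t : ℝ), 0 ≤ w (x, t) ∧
    w (x, t) ≤ K * Real.exp (-(3 / 4 * a) * max t 0) * (1 / (1 + ‖x‖) ^ (8 + δ))

lemma heat_nonneg {f : Space → ℝ} (hf : ∀ y, 0 ≤ f y) (t : ℝ) (x : Space) : 0 ≤ heat t f x :=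
  integral_nonneg fun _ => hf _

lemma norm_le_of_decayBound {a δ K : ℝ} (ha : 0 < a) (hδ : 0 < δ) (hK : 0 ≤ K) {w : ScalarField}
    (hw : DecayBound a δ K w) : ‖w‖ ≤ K := by
  rw [BF.norm_le hK]
  rintro ⟨x, t⟩
  rw [Real.norm_of_nonneg (hw x t).1]
  refine (hw x t).2.trans ?_
  have h1 : Real.exp (-(3 / 4 * a) * max t 0) ≤ 1 := by
    rw [Real.exp_le_one_iff]
    have : 0 ≤ a * max t 0 := mul_nonneg ha.le (le_max_right _ _)
    linarith
  have h2 : 1 / (1 + ‖x‖) ^ (8 + δ) ≤ 1 := by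
    rw [div_le_one (by positivity)]
    exact Real.one_le_rpow (by linarith [norm_nonneg x]) (by linarith)
  calc K * Real.exp (-(3 / 4 * a) * max t 0) * (1 / (1 + ‖x‖) ^ (8 + δ)) ≤ K * 1 * 1 := by gcongr
    _ = K := by ring

lemma exists_dataOp_decay {a δ : ℝ} (ha : 0 < a) (hδ : 0 < δ) :
    ∃ C : ℝ, 0 < C ∧ ∀ α : ℝ, 0 ≤ α →
      DecayBound a δ (C * α) (dataOp ha (1, 0) (datumField δ α)) := by
  obtain ⟨C, hC, h⟩ := exists_heat_decay (p := 8 + δ) (η := a / 8) (by linarith) (by positivity)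
  refine ⟨C, hC, fun α hα x t => ?_⟩
  rw [dataOp_max]
  have ht : 0 ≤ max t 0 := le_max_right _ _
  generalize max t 0 = t at ht
  rw [dataOp_apply ha (one_zero_mem_admissible ha) _ _ ht]
  simp only [mul_one, one_mul, smul_zero, add_zero]
  have hnn : ∀ y : Space, 0 ≤ datumField δ α (y, 0) := fun y => by
    rw [datumField_apply hδ]; positivity
  refine ⟨mul_nonneg (Real.exp_pos _).le (heat_nonneg hnn _ _), ?_⟩
  have h1 := h α t (fun y => datumField δ α (y, 0)) hα ht (fun y => by
    rw [abs_of_nonneg (hnn y), datumField_apply hδ]) x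
  have h2 : Real.exp (-(a * t)) * Real.exp (a / 8 * t) ≤ Real.exp (-(3 / 4 * a) * t) := by
    rw [← Real.exp_add]
    apply Real.exp_le_exp.2
    have : 0 ≤ a * t := by positivity
    linarith
  calc Real.exp (-(a * t)) * heat t (fun y => datumField δ α (y, 0)) x
      ≤ Real.exp (-(a * t)) * (C * Real.exp (a / 8 * t) * α * (1 / (1 + ‖x‖) ^ (8 + δ))) := by
        gcongr; exact (le_abs_self _).trans h1
    _ = C * α * (Real.exp (-(a * t)) * Real.exp (a / 8 * t)) * (1 / (1 + ‖x‖) ^ (8 + δ)) := by ring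
    _ ≤ _ := by gcongr

/-- The flow over a lag r carries e^{-ar} e^{ar/8}, against e^{-3a(t-r)/4} in the source. The
product is e^{-3at/4} e^{-ar/8}, so the target rate factors out and the rest is integrable in r. -/
lemma exists_duhamelOp_decay {a δ : ℝ} (ha : 0 < a) (hδ : 0 < δ) :
    ∃ C : ℝ, 0 < C ∧ ∀ (M : ℝ) (f : ScalarField), 0 ≤ M → DecayBound a δ M f →
      DecayBound a δ (C * M) (duhamelOp ha (1, 0) f) := by
  obtain ⟨C, hC, h⟩ := exists_heat_decay (p := 8 + δ) (η := a / 8) (by linarith) (by positivity)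
  refine ⟨C * (8 / a), by positivity, fun M f hM hf x t => ?_⟩
  rw [duhamelOp_max]
  have ht : 0 ≤ max t 0 := le_max_right _ _
  generalize max t 0 = t at ht
  rw [duhamelOp_apply ha (one_zero_mem_admissible ha) _ _ ht]
  simp only [mul_one, one_mul, smul_zero, add_zero]
  refine ⟨mul_nonneg ht (integral_nonneg fun s => mul_nonneg (Real.exp_pos _).le
    (heat_nonneg (fun y => (hf y _).1) _ _)), ?_⟩
  set B := C * M * Real.exp (-(3 / 4 * a) * t) * (1 / (1 + ‖x‖) ^ (8 + δ)) with hB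
  have hB0 : 0 ≤ B := by positivity
  have hle : ∫ s in Icc (0 : ℝ) 1, Real.exp (-(a * (t * s))) *
        heat (t * s) (fun y => f (y, t - t * s)) x
      ≤ ∫ s in Icc (0 : ℝ) 1, B * Real.exp (-(a / 8) * (t * s)) := by
    refine integral_mono_of_nonneg (Eventually.of_forall fun s => mul_nonneg (Real.exp_pos _).le
      (heat_nonneg (fun y => (hf y _).1) _ _)) ?_ ?_
    · exact ((Continuous.integrableOn_Icc (by fun_prop)))
    · filter_upwards [ae_restrict_mem measurableSet_Icc] with s hs
      have hts : 0 ≤ t * s := mul_nonneg ht hs.1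
      have hts' : 0 ≤ t - t * s := by nlinarith [hs.2]
      have h1 := h (M * Real.exp (-(3 / 4 * a) * (t - t * s))) (t * s)
        (fun y => f (y, t - t * s)) (by positivity) hts (fun y => by
          have := hf y (t - t * s)
          rw [max_eq_left hts'] at this
          rw [abs_of_nonneg this.1]; exact this.2) x
      calc Real.exp (-(a * (t * s))) * heat (t * s) (fun y => f (y, t - t * s)) x
          ≤ Real.exp (-(a * (t * s))) * (C * Real.exp (a / 8 * (t * s)) *
            (M * Real.exp (-(3 / 4 * a) * (t - t * s))) * (1 / (1 + ‖x‖) ^ (8 + δ))) := by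
            gcongr; exact (le_abs_self _).trans h1
        _ = C * M * (1 / (1 + ‖x‖) ^ (8 + δ)) * (Real.exp (-(a * (t * s))) *
            Real.exp (a / 8 * (t * s)) * Real.exp (-(3 / 4 * a) * (t - t * s))) := by ring
        _ = C * M * (1 / (1 + ‖x‖) ^ (8 + δ)) * (Real.exp (-(3 / 4 * a) * t) *
            Real.exp (-(a / 8) * (t * s))) := by
            rw [← Real.exp_add, ← Real.exp_add, ← Real.exp_add]
            congr 2; ring
        _ = _ := by rw [hB]; ring
  rw [integral_const_mul] at hle
  calc t * ∫ s in Icc (0 : ℝ) 1, Real.exp (-(a * (t * s))) *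
        heat (t * s) (fun y => f (y, t - t * s)) x
      ≤ t * (B * ∫ s in Icc (0 : ℝ) 1, Real.exp (-(a / 8) * (t * s))) := by gcongr
    _ = B * (t * ∫ s in Icc (0 : ℝ) 1, Real.exp (-(a / 8) * (t * s))) := by ring
    _ ≤ B * (8 / a) := by gcongr; exact mul_integral_exp_le ha t
    _ = _ := by rw [hB]; ring

/-- Factor the source as w²(b - 6c w): smallness of w fixes the sign. Being quadratic, it doubles
the rate to 3a/2; exceeding a is what later makes e^{as} ∫ f integrable in time. -/
lemma decayBound_nonlin {a b c δ K : ℝ} (ha : 0 < a) (hb : 0 < b) (hc : 0 < c) (hδ : 0 < δ)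
    (hK : 0 ≤ K) (hKb : 6 * c * K ≤ b) {w : ScalarField} (hw : DecayBound a δ K w)
    (x : Space) (t : ℝ) :
    0 ≤ nonlin b c w (x, t) ∧ nonlin b c w (x, t) ≤ b * K ^ 2 *
      Real.exp (-(3 / 2 * a) * max t 0) * (1 / (1 + ‖x‖) ^ (8 + δ)) := by
  have h1 := hw x t
  have h2 := (w.norm_coe_le_norm (x, t)).trans (norm_le_of_decayBound ha hδ hK hw)
  rw [Real.norm_of_nonneg h1.1] at h2
  rw [nonlin_apply]
  set u := w (x, t)
  have e1 : b * u ^ 2 - 6 * c * u ^ 3 = u ^ 2 * (b - 6 * c * u) := by ring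
  have h3 : 6 * c * u ≤ 6 * c * K := by gcongr
  have h4 : 1 / (1 + ‖x‖) ^ (8 + δ) ≤ 1 := by
    rw [div_le_one (by positivity)]
    exact Real.one_le_rpow (by linarith [norm_nonneg x]) (by linarith)
  constructor
  · rw [e1]; exact mul_nonneg (sq_nonneg u) (by linarith)
  · calc b * u ^ 2 - 6 * c * u ^ 3 ≤ b * u ^ 2 := by
          have : 0 ≤ 6 * c * u ^ 3 := by have := h1.1; positivity
          linarith
      _ ≤ b * (K * Real.exp (-(3 / 4 * a) * max t 0) * (1 / (1 + ‖x‖) ^ (8 + δ))) ^ 2 := by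
          have := h1.1
          gcongr
          exact h1.2
      _ = b * K ^ 2 * (Real.exp (-(3 / 4 * a) * max t 0)) ^ 2 *
          ((1 / (1 + ‖x‖) ^ (8 + δ)) * (1 / (1 + ‖x‖) ^ (8 + δ))) := by ring
      _ ≤ b * K ^ 2 * (Real.exp (-(3 / 4 * a) * max t 0)) ^ 2 *
          ((1 / (1 + ‖x‖) ^ (8 + δ)) * 1) := by gcongr
      _ = _ := by
          rw [← Real.exp_nat_mul, mul_one]
          congr 3
          push_cast; ring

lemma isClosed_decayBound (a δ K : ℝ) : IsClosed {w : ScalarField | DecayBound a δ K w} := by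
  simp only [DecayBound, ofPred_forall, ofPred_and]
  refine isClosed_iInter fun x => isClosed_iInter fun t => ?_
  have hc : Continuous fun w : ScalarField => w (x, t) :=
    (BF.eval (x, t)).continuous
  exact (isClosed_le continuous_const hc).inter (isClosed_le hc continuous_const)

/-- Small data have a global mild solution that is nonnegative and decays. -/
lemma exists_mild_solution {a b c δ : ℝ} (ha : 0 < a) (hb : 0 < b) (hc : 0 < c) (hδ : 0 < δ)
    {R : ℝ} (hR : 0 < R) (hRa : ‖duhamelOp ha (1, 0)‖ * (2 * b * R + 18 * c * R ^ 2) ≤ 1 / 2) :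
    ∃ α₀ : ℝ, 0 < α₀ ∧ ∀ α, 0 < α → α < α₀ → ∃ (K : ℝ) (w : ScalarField), 0 < K ∧ K < R ∧
      6 * c * K ≤ b ∧ DecayBound a δ K w ∧
      w = dataOp ha (1, 0) (datumField δ α) + duhamelOp ha (1, 0) (nonlin b c w) := by
  obtain ⟨C₁, hC₁, h1⟩ := exists_dataOp_decay (δ := δ) ha hδ
  obtain ⟨C₂, hC₂, h2⟩ := exists_duhamelOp_decay (δ := δ) ha hδ
  -- The three caps on K = 2C₁α serve contraction, the sign of the nonlinearity, and a Duhamel term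
  -- of size at most K/2. The other half of K is the datum term C₁α.
  have hK₀ : 0 < min R (min (b / (6 * c)) (1 / (2 * b * C₂))) := by positivity
  refine ⟨min R (min (b / (6 * c)) (1 / (2 * b * C₂))) / (2 * C₁), by positivity,
    fun α hα hαlt => ?_⟩
  set K := 2 * C₁ * α with hK
  have hK0 : 0 < K := by positivity
  have hKlt : K < min R (min (b / (6 * c)) (1 / (2 * b * C₂))) := by
    rw [lt_div_iff₀ (by positivity)] at hαlt
    rw [hK]; linarith
  have hKR : K < R := hKlt.trans_le (min_le_left _ _)
  have hKb : 6 * c * K ≤ b := by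
    have := hKlt.le.trans ((min_le_right _ _).trans (min_le_left _ _))
    rw [le_div_iff₀ (by positivity)] at this
    linarith
  have hKC : C₂ * (b * K ^ 2) ≤ K / 2 := by
    have := hKlt.le.trans ((min_le_right _ _).trans (min_le_right _ _))
    rw [le_div_iff₀ (by positivity)] at this
    nlinarith
  set Φ : ScalarField → ScalarField := fun w =>
    dataOp ha (1, 0) (datumField δ α) + duhamelOp ha (1, 0) (nonlin b c w) with hΦ
  have hmaps : MapsTo Φ {w | DecayBound a δ K w} {w | DecayBound a δ K w} := by
    intro w hw x t
    have hN : DecayBound a δ (b * K ^ 2) (nonlin b c w) := by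
      intro x t
      have h3 := decayBound_nonlin ha hb hc hδ hK0.le hKb hw x t
      refine ⟨h3.1, h3.2.trans ?_⟩
      have : Real.exp (-(3 / 2 * a) * max t 0) ≤ Real.exp (-(3 / 4 * a) * max t 0) := by
        apply Real.exp_le_exp.2
        have : 0 ≤ a * max t 0 := mul_nonneg ha.le (le_max_right _ _)
        linarith
      gcongr
    have e1 := h1 α hα.le x t
    have e2 := h2 (b * K ^ 2) _ (by positivity) hN x t
    change 0 ≤ dataOp ha (1, 0) (datumField δ α) (x, t) +
      duhamelOp ha (1, 0) (nonlin b c w) (x, t) ∧ dataOp ha (1, 0) (datumField δ α) (x, t) +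
      duhamelOp ha (1, 0) (nonlin b c w) (x, t) ≤ _
    refine ⟨add_nonneg e1.1 e2.1, ?_⟩
    set E := Real.exp (-(3 / 4 * a) * max t 0)
    set P := 1 / (1 + ‖x‖) ^ (8 + δ)
    have hEP : 0 ≤ E * P := by positivity
    have : C₁ * α + C₂ * (b * K ^ 2) ≤ K := by rw [hK] at hKC ⊢; linarith
    nlinarith [e1.2, e2.2]
  have hcontr : ContractingWith (1 / 2)
      (hmaps.restrict Φ {w | DecayBound a δ K w} {w | DecayBound a δ K w}) := by
    refine ⟨by norm_num, LipschitzWith.of_dist_le_mul fun w w' => ?_⟩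
    rw [Subtype.dist_eq, Subtype.dist_eq, dist_eq_norm, dist_eq_norm]
    simp only [MapsTo.val_restrict_apply, hΦ]
    rw [add_sub_add_left_eq_sub, ← map_sub]
    have e1 := norm_nonlin_sub_le hb.le hc.le
      ((norm_le_of_decayBound ha hδ hK0.le w.2).trans hKR.le)
      ((norm_le_of_decayBound ha hδ hK0.le w'.2).trans hKR.le)
    calc ‖duhamelOp ha (1, 0) (nonlin b c w - nonlin b c w')‖
        ≤ ‖duhamelOp ha (1, 0)‖ * ‖nonlin b c w - nonlin b c w'‖ :=
          ContinuousLinearMap.le_opNorm _ _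
      _ ≤ ‖duhamelOp ha (1, 0)‖ * ((2 * b * R + 18 * c * R ^ 2) * ‖(w : ScalarField) - w'‖) := by gcongr
      _ = ‖duhamelOp ha (1, 0)‖ * (2 * b * R + 18 * c * R ^ 2) * ‖(w : ScalarField) - w'‖ := by ring
      _ ≤ (1 / 2) * ‖(w : ScalarField) - w'‖ := by gcongr
      _ = _ := by simp
  have h0 : (0 : ScalarField) ∈ {w | DecayBound a δ K w} := by
    intro x t
    refine ⟨le_rfl, ?_⟩
    change (0 : ℝ) ≤ _
    positivity
  obtain ⟨w, hw, hfix, -⟩ := hcontr.exists_fixedPoint' (isClosed_decayBound a δ K).isComplete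
    hmaps h0 (edist_ne_top _ _)
  exact ⟨K, w, hK0, hKR, hKb, hw, hfix.symm⟩

/-! ### Smoothness by scaling, shearing and the implicit function theorem. -/

lemma heat_comp_add (t : ℝ) (f : Space → ℝ) (v x : Space) :
    heat t (fun y => f (y + v)) x = heat t f (x + v) := by
  unfold heat
  refine integral_congr_ae (Eventually.of_forall fun z => ?_)
  simp only
  rw [sub_add_eq_add_sub]

/-- The field rescaled by `θ.1` in time and sheared by `θ.2` in space. -/
def shear (w : ScalarField) (θ : ℝ × Space) : ScalarField :=
  BF.ofBound (fun p : Space × ℝ => w (p.1 + max p.2 0 • θ.2, θ.1 * max p.2 0))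
    (w.continuous.comp (by fun_prop)) ‖w‖ fun _ => w.norm_coe_le_norm _

lemma shear_apply (w : ScalarField) (θ : ℝ × Space) (p : Space × ℝ) :
    shear w θ p = w (p.1 + max p.2 0 • θ.2, θ.1 * max p.2 0) := rfl

lemma norm_shear_le (w : ScalarField) (θ : ℝ × Space) : ‖shear w θ‖ ≤ ‖w‖ :=
  (BF.norm_le (norm_nonneg w)).2 fun _ => w.norm_coe_le_norm _

/-- At time zero the shear does nothing, so the datum is unchanged. In the Duhamel term the source
displacement (t - ts)μ and the operator displacement tsμ add up to tμ, while time is rescaled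
throughout by λ. -/
lemma shear_mild {a b c : ℝ} (ha : 0 < a) {δ α : ℝ} {w : ScalarField}
    (hw : w = dataOp ha (1, 0) (datumField δ α) + duhamelOp ha (1, 0) (nonlin b c w))
    {θ : ℝ × Space} (hθ : θ ∈ admissible a) :
    shear w θ = dataOp ha θ (datumField δ α) + duhamelOp ha θ (nonlin b c (shear w θ)) := by
  ext ⟨x, t⟩
  rw [BF.add_apply, dataOp_max, duhamelOp_max, shear_apply]
  simp only
  have ht : 0 ≤ max t 0 := le_max_right _ _
  generalize max t 0 = t at ht
  have hθ1 := hθ.1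
  have hlt : 0 ≤ θ.1 * t := by positivity
  conv_lhs => rw [hw]
  rw [BF.add_apply, dataOp_apply ha hθ _ _ ht, duhamelOp_apply ha hθ _ _ ht,
    dataOp_apply ha (one_zero_mem_admissible ha) _ _ hlt,
    duhamelOp_apply ha (one_zero_mem_admissible ha) _ _ hlt]
  simp only [mul_one, one_mul, smul_zero, add_zero, ← mul_assoc]
  congr 2
  refine setIntegral_congr_fun measurableSet_Icc fun s hs => ?_
  have hts : 0 ≤ t - t * s := by nlinarith [hs.2]
  congr 1
  have h1 : (fun y => nonlin b c (shear w θ) (y, t - t * s))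
      = fun y => nonlin b c w (y + (t - t * s) • θ.2, θ.1 * t - θ.1 * t * s) := by
    ext y
    rw [nonlin_apply, nonlin_apply, shear_apply]
    simp only [max_eq_left hts]
    rw [show θ.1 * (t - t * s) = θ.1 * t - θ.1 * t * s by ring]
  rw [h1, heat_comp_add (θ.1 * t * s) (fun y => nonlin b c w (y, θ.1 * t - θ.1 * t * s))]
  congr 1
  rw [add_assoc, ← add_smul]
  congr 2; ring

/-- Small mild solutions are smooth at positive times. -/
lemma contDiffAt_of_mild {a b c : ℝ} (ha : 0 < a) (hb : 0 < b) (hc : 0 < c) {δ α R : ℝ}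
    (hR : ∀ᶠ θ in 𝓝 ((1, 0) : ℝ × Space),
      ‖duhamelOp ha θ‖ * (2 * b * R + 18 * c * R ^ 2) ≤ 1 / 2)
    {w : ScalarField} (hwR : ‖w‖ < R)
    (hw : w = dataOp ha (1, 0) (datumField δ α) + duhamelOp ha (1, 0) (nonlin b c w))
    (x : Space) {t : ℝ} (ht : 0 < t) : ContDiffAt ℝ ∞ (fun p : Space × ℝ => w p) (x, t) := by
  set G := datumField δ α
  set Ψ : (ℝ × Space) × ScalarField → ScalarField := fun v =>
    v.2 - dataOp ha v.1 G - duhamelOp ha v.1 (nonlin b c v.2) with hΨ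
  have hR0 : 0 < R := (norm_nonneg w).trans_lt hwR
  have hcontr : ∀ θ : ℝ × Space, ‖duhamelOp ha θ‖ * (2 * b * R + 18 * c * R ^ 2) ≤ 1 / 2 →
      ∀ u v : ScalarField, ‖u‖ ≤ R → ‖v‖ ≤ R →
      ‖duhamelOp ha θ (nonlin b c u) - duhamelOp ha θ (nonlin b c v)‖ ≤ 1 / 2 * ‖u - v‖ := by
    intro θ hθ u v hu hv
    rw [← map_sub]
    calc ‖duhamelOp ha θ (nonlin b c u - nonlin b c v)‖
        ≤ ‖duhamelOp ha θ‖ * ‖nonlin b c u - nonlin b c v‖ := ContinuousLinearMap.le_opNorm _ _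
      _ ≤ ‖duhamelOp ha θ‖ * ((2 * b * R + 18 * c * R ^ 2) * ‖u - v‖) := by
          gcongr; exact norm_nonlin_sub_le hb.le hc.le hu hv
      _ = ‖duhamelOp ha θ‖ * (2 * b * R + 18 * c * R ^ 2) * ‖u - v‖ := by ring
      _ ≤ _ := by gcongr
  have hRone := hR.self_of_nhds
  have hcd : ContDiffAt ℝ ∞ Ψ ((1, 0), w) := by
    have h1 : ContDiffAt ℝ ∞ (fun v : (ℝ × Space) × ScalarField => dataOp ha v.1) ((1, 0), w) :=
      (contDiffAt_dataOp ha).comp ((1, 0), w) contDiffAt_fst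
    have h2 : ContDiffAt ℝ ∞ (fun v : (ℝ × Space) × ScalarField => duhamelOp ha v.1)
        ((1, 0), w) :=
      (contDiffAt_duhamelOp ha).comp ((1, 0), w) contDiffAt_fst
    have h3 : ContDiffAt ℝ ∞ (fun v : (ℝ × Space) × ScalarField => nonlin b c v.2) ((1, 0), w) :=
      (contDiff_nonlin b c).contDiffAt.comp ((1, 0), w) contDiffAt_snd
    exact (contDiffAt_snd.sub (h1.clm_apply contDiffAt_const)).sub (h2.clm_apply h3)
  set T : ScalarField →L[ℝ] ScalarField :=
    fderiv ℝ (fun u => duhamelOp ha (1, 0) (nonlin b c u)) w with hT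
  have hdiffN : DifferentiableAt ℝ (fun u => duhamelOp ha (1, 0) (nonlin b c u)) w :=
    (duhamelOp ha (1, 0)).differentiableAt.comp w
      (((contDiff_nonlin b c).differentiable (by simp)) w)
  -- The derivative inherits the local Lipschitz constant 1/2, so 1 - T is invertible by the Neumann
  -- series.
  have hTnorm : ‖T‖ ≤ 1 / 2 := by
    refine norm_fderiv_le_of_lip' ℝ (by norm_num) ?_
    filter_upwards [continuous_norm.continuousAt.eventually (gt_mem_nhds hwR)] with u hu
    exact hcontr _ hRone u w (le_of_lt hu) hwR.le
  have hpart : fderiv ℝ Ψ ((1, 0), w) ∘L .inr ℝ (ℝ × Space) ScalarField = 1 - T := by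
    have h1 : HasFDerivAt (fun u : ScalarField => (((1, 0) : ℝ × Space), u))
        (.inr ℝ (ℝ × Space) ScalarField) w := hasFDerivAt_prodMk_right _ _
    have h2 := (hcd.differentiableAt (by simp)).hasFDerivAt.comp w h1
    have h3 : HasFDerivAt (Ψ ∘ fun u : ScalarField => (((1, 0) : ℝ × Space), u))
        (ContinuousLinearMap.id ℝ ScalarField - T) w := by
      have := ((hasFDerivAt_id w).sub_const (dataOp ha (1, 0) G)).sub hdiffN.hasFDerivAt
      exact this
    exact h2.unique h3
  have hinv : (fderiv ℝ Ψ ((1, 0), w) ∘L .inr ℝ (ℝ × Space) ScalarField).IsInvertible := by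
    rw [hpart]
    have hu : ‖T‖ < 1 := by linarith
    exact ⟨ContinuousLinearEquiv.unitsEquiv ℝ ScalarField (Units.oneSub T hu), rfl⟩
  have hn : (∞ : ℕ∞ω) ≠ 0 := by simp
  set ψ := hcd.implicitFunction hn hinv with hψ
  have hψcd : ContDiffAt ℝ ∞ ψ (1, 0) := hcd.contDiffAt_implicitFunction hn hinv
  have hψ0 : ψ (1, 0) = w := hcd.implicitFunction_apply_self hn hinv
  have hΨ0 : Ψ ((1, 0), w) = 0 := by
    simp only [hΨ]
    nth_rewrite 1 [hw]
    abel
  have hev1 : ∀ᶠ θ in 𝓝 ((1, 0) : ℝ × Space), Ψ (θ, ψ θ) = Ψ ((1, 0), w) :=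
    hcd.eventually_apply_implicitFunction hn hinv
  have hev2 : ∀ᶠ θ in 𝓝 ((1, 0) : ℝ × Space), ‖ψ θ‖ < R :=
    hψcd.continuousAt.norm.eventually (gt_mem_nhds (by change ‖ψ (1, 0)‖ < R; rw [hψ0]; exact hwR))
  -- The implicit branch and the sheared solution both solve the θ-equation within the contraction
  -- radius, so they coincide. No prior continuity of the shear in θ is needed, only its norm bound.
  have hshear : ∀ᶠ θ in 𝓝 ((1, 0) : ℝ × Space), ψ θ = shear w θ := by
    filter_upwards [hev1, hev2, hR, admissible_mem_nhds ha] with θ h1 h2 h3 h4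
    have e1 : ψ θ = dataOp ha θ G + duhamelOp ha θ (nonlin b c (ψ θ)) := by
      rw [hΨ0] at h1
      simp only [hΨ] at h1
      rw [sub_sub, sub_eq_zero] at h1
      exact h1
    have e2 := shear_mild ha hw h4
    have e3 := hcontr θ h3 (ψ θ) (shear w θ) h2.le ((norm_shear_le w θ).trans hwR.le)
    have e4 : ψ θ - shear w θ = duhamelOp ha θ (nonlin b c (ψ θ))
        - duhamelOp ha θ (nonlin b c (shear w θ)) := by
      nth_rewrite 1 [e1]
      nth_rewrite 1 [e2]
      abel
    rw [← e4] at e3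
    have e5 : ‖ψ θ - shear w θ‖ = 0 := by
      have := norm_nonneg (ψ θ - shear w θ)
      linarith
    exact sub_eq_zero.1 (norm_eq_zero.1 e5)
  have hev : ContDiffAt ℝ ∞ (fun θ : ℝ × Space => w (x + t • θ.2, θ.1 * t)) (1, 0) := by
    have h1 : ContDiffAt ℝ ∞ (fun θ => BF.eval (x, t) (ψ θ)) (1, 0) :=
      (BF.eval (x, t)).contDiff.contDiffAt.comp _ hψcd
    refine h1.congr_of_eventuallyEq ?_
    filter_upwards [hshear] with θ hθ
    rw [hθ, BF.eval_apply, shear_apply]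
    simp only [max_eq_left ht.le]
  -- The rescaling (s/t, (y - x)/t) carries the evaluation point (x, t) to (y, s). The divisions by
  -- t are why this works only at positive times.
  have hsub : ContDiffAt ℝ ∞
      (fun p : Space × ℝ => ((p.2 / t, (1 / t) • (p.1 - x)) : ℝ × Space)) (x, t) :=
    (contDiffAt_snd.div_const t).prodMk
      ((contDiffAt_fst.sub contDiffAt_const).const_smul (1 / t))
  have h0 : ((t / t, (1 / t) • (x - x)) : ℝ × Space) = (1, 0) := by
    rw [div_self ht.ne', sub_self, smul_zero]
  have hcomp := ContDiffAt.comp (x, t) (g := fun θ : ℝ × Space => w (x + t • θ.2, θ.1 * t))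
    (by simpa only [h0] using hev) hsub
  refine hcomp.congr_of_eventuallyEq (Eventually.of_forall fun p => ?_)
  simp only [Function.comp]
  congr 1
  rw [smul_smul, mul_one_div, div_self ht.ne', one_smul, add_sub_cancel, div_mul_cancel₀ _ ht.ne']

/-! ### From mild to classical solutions. -/

/-- The contribution to the damped heat flow at time `t` of a source at time `t - r`. -/
def duhamelIntegrand (a : ℝ) (f : ScalarField) (x : Space) (t r : ℝ) : ℝ :=
  Real.exp (-(a * r)) * heat r (fun y => f (y, t - r)) x

lemma continuous_duhamelIntegrand (a : ℝ) (f : ScalarField) :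
    Continuous fun p : Space × ℝ × ℝ => duhamelIntegrand a f p.1 p.2.1 p.2.2 := by
  unfold duhamelIntegrand heat
  refine Continuous.mul (by fun_prop) ?_
  have hf := f.continuous
  refine continuous_of_dominated (bound := fun _ => ‖f‖) (fun p => ?_)
    (fun p => Eventually.of_forall fun z => f.norm_coe_le_norm _) (integrable_const _)
    (Eventually.of_forall fun z => ?_)
  · exact Continuous.aestronglyMeasurable (by fun_prop)
  · fun_prop

lemma abs_duhamelIntegrand_le {a : ℝ} (ha : 0 ≤ a) (f : ScalarField) (x : Space) (t : ℝ) {r : ℝ}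
    (hr : 0 ≤ r) : |duhamelIntegrand a f x t r| ≤ ‖f‖ := by
  unfold duhamelIntegrand
  have h1 : |heat r (fun y => f (y, t - r)) x| ≤ ‖f‖ :=
    abs_heat_le (fun y => f.norm_coe_le_norm _) r x
  have h2 : Real.exp (-(a * r)) ≤ 1 := by
    rw [Real.exp_le_one_iff]
    have : 0 ≤ a * r := mul_nonneg ha hr
    linarith
  rw [abs_mul, abs_of_pos (Real.exp_pos _)]
  calc Real.exp (-(a * r)) * |heat r (fun y => f (y, t - r)) x| ≤ 1 * ‖f‖ := by gcongr
    _ = _ := one_mul _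

lemma mul_integral_Icc_eq (g : ℝ → ℝ) (t : ℝ) :
    t * ∫ s in Icc (0 : ℝ) 1, g (t * s) = ∫ r in (0 : ℝ)..t, g r := by
  rw [integral_Icc_eq_integral_Ioc, ← intervalIntegral.integral_of_le zero_le_one,
    intervalIntegral.mul_integral_comp_mul_left]
  simp

lemma duhamelOp_eq_intervalIntegral {a : ℝ} (ha : 0 < a) (f : ScalarField) (x : Space) {t : ℝ}
    (ht : 0 ≤ t) :
    duhamelOp ha (1, 0) f (x, t) = ∫ r in (0 : ℝ)..t, duhamelIntegrand a f x t r := by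
  rw [duhamelOp_apply ha (one_zero_mem_admissible ha) f x ht, ← mul_integral_Icc_eq]
  simp [duhamelIntegrand]

lemma heat_intervalIntegral {a : ℝ} (ha : 0 ≤ a) (f : ScalarField) (x : Space) {t h : ℝ}
    (ht : 0 ≤ t) :
    heat h (fun y => ∫ r in (0 : ℝ)..t, duhamelIntegrand a f y t r) x
      = ∫ r in (0 : ℝ)..t, heat h (fun y => duhamelIntegrand a f y t r) x := by
  simp_rw [intervalIntegral.integral_of_le ht]
  unfold heat
  rw [integral_integral_swap]
  have hc := continuous_duhamelIntegrand a f
  refine Integrable.of_bound (C := ‖f‖) (Continuous.aestronglyMeasurable ?_) ?_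
  · exact hc.comp (show Continuous fun q : Space × ℝ => (x - Real.sqrt h • q.1, t, q.2) by fun_prop)
  · have : ∀ᵐ q ∂(gaussMeasure.prod (volume.restrict (Ioc 0 t))), q.2 ∈ Ioc (0 : ℝ) t :=
      Measure.quasiMeasurePreserving_snd.ae (ae_restrict_mem measurableSet_Ioc)
    filter_upwards [this] with q hq
    exact abs_duhamelIntegrand_le ha f _ t hq.1.le

lemma heat_const_mul (r t : ℝ) (f : Space → ℝ) (x : Space) :
    heat t (fun y => r * f y) x = r * heat t f x := integral_const_mul _ _

lemma heat_add {f g : Space → ℝ} (hf : Continuous f) (hg : Continuous g) {C D : ℝ}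
    (hC : ∀ y, |f y| ≤ C) (hD : ∀ y, |g y| ≤ D) (t : ℝ) (x : Space) :
    heat t (fun y => f y + g y) x = heat t f x + heat t g x :=
  integral_add (integrable_heat hf hC t x) (integrable_heat hg hD t x)

/-- Restarting the mild formulation at a positive time. -/
lemma mild_restart {a : ℝ} (ha : 0 < a) {w g f : ScalarField}
    (hw : w = dataOp ha (1, 0) g + duhamelOp ha (1, 0) f) (x : Space) {t h : ℝ} (ht : 0 ≤ t)
    (hh : 0 ≤ h) :
    w (x, t + h) = Real.exp (-(a * h)) * heat h (fun y => w (y, t)) x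
      + h * ∫ s in Icc (0 : ℝ) 1, duhamelIntegrand a f x (t + h) (h * s) := by
  have hform : ∀ y : Space, ∀ r : ℝ, 0 ≤ r → w (y, r) =
      Real.exp (-(a * r)) * heat r (fun y => g (y, 0)) y
        + ∫ q in (0 : ℝ)..r, duhamelIntegrand a f y r q := by
    intro y r hr
    conv_lhs => rw [hw]
    rw [BF.add_apply, dataOp_apply ha (one_zero_mem_admissible ha) _ _ hr,
      duhamelOp_eq_intervalIntegral ha _ _ hr]
    simp
  have hc := continuous_duhamelIntegrand a f
  have hcr : ∀ (y : Space) (r : ℝ), Continuous fun q => duhamelIntegrand a f y r q := fun y r =>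
    hc.comp (show Continuous fun q : ℝ => (y, r, q) by fun_prop)
  have hg0 : Continuous fun y : Space => g (y, 0) := g.continuous.comp (by fun_prop)
  have hgb : ∀ y : Space, |g (y, 0)| ≤ ‖g‖ := fun y => g.norm_coe_le_norm _
  have hcu : Continuous (Function.uncurry fun (y : Space) (q : ℝ) => duhamelIntegrand a f y t q) :=
    hc.comp (show Continuous fun q : Space × ℝ => (q.1, t, q.2) by fun_prop)
  have hc1 : Continuous fun y : Space => Real.exp (-(a * t)) * heat t (fun y => g (y, 0)) y := by
    have h1 : Continuous fun y : Space => w (y, t) - ∫ q in (0 : ℝ)..t,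
        duhamelIntegrand a f y t q := by
      refine (w.continuous.comp (by fun_prop)).sub ?_
      exact intervalIntegral.continuous_parametric_intervalIntegral_of_continuous' hcu _ _
    refine h1.congr fun y => ?_
    rw [hform y t ht]; ring
  have hc2 : Continuous fun y : Space => ∫ q in (0 : ℝ)..t, duhamelIntegrand a f y t q :=
    intervalIntegral.continuous_parametric_intervalIntegral_of_continuous' hcu _ _
  have hb1 : ∀ y : Space, |Real.exp (-(a * t)) * heat t (fun y => g (y, 0)) y|
      ≤ Real.exp (-(a * t)) * ‖g‖ := by
    intro y
    rw [abs_mul, abs_of_pos (Real.exp_pos _)]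
    gcongr
    exact abs_heat_le hgb t y
  have hb2 : ∀ y : Space, |∫ q in (0 : ℝ)..t, duhamelIntegrand a f y t q| ≤ ‖f‖ * |t - 0| := by
    intro y
    rw [← Real.norm_eq_abs]
    refine intervalIntegral.norm_integral_le_of_norm_le_const fun q hq => ?_
    rw [uIoc_of_le ht] at hq
    exact abs_duhamelIntegrand_le ha.le f y t hq.1.le
  have hwt : (fun y => w (y, t)) = fun y => Real.exp (-(a * t)) * heat t (fun y => g (y, 0)) y
      + ∫ q in (0 : ℝ)..t, duhamelIntegrand a f y t q := funext fun y => hform y t ht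
  rw [hwt, heat_add hc1 hc2 hb1 hb2, heat_const_mul, heat_heat hg0 hgb hh ht,
    heat_intervalIntegral ha.le f x ht, mul_integral_Icc_eq (duhamelIntegrand a f x (t + h)) h,
    hform x (t + h) (by linarith)]
  have h1 : ∫ q in (0 : ℝ)..(t + h), duhamelIntegrand a f x (t + h) q
      = (∫ q in (0 : ℝ)..h, duhamelIntegrand a f x (t + h) q)
        + ∫ q in h..(t + h), duhamelIntegrand a f x (t + h) q :=
    (intervalIntegral.integral_add_adjacent_intervals
      ((hcr _ _).intervalIntegrable _ _) ((hcr _ _).intervalIntegrable _ _)).symm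
  -- Lags longer than h concern sources before time t; a damped heat flow of length h factors out of
  -- them by the semigroup law.
  have h2 : ∫ q in h..(t + h), duhamelIntegrand a f x (t + h) q
      = Real.exp (-(a * h)) * ∫ r in (0 : ℝ)..t, heat h (fun y => duhamelIntegrand a f y t r) x := by
    have := intervalIntegral.integral_comp_add_right (a := 0) (b := t)
      (fun q => duhamelIntegrand a f x (t + h) q) h
    rw [zero_add] at this
    rw [← this, ← intervalIntegral.integral_const_mul]
    refine intervalIntegral.integral_congr fun r hr => ?_
    rw [uIcc_of_le ht] at hr
    simp only [duhamelIntegrand]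
    have hfc : Continuous fun y : Space => f (y, t - r) := f.continuous.comp (by fun_prop)
    rw [heat_const_mul, heat_heat hfc (fun y => f.norm_coe_le_norm (y, t - r)) hh hr.1,
      ← mul_assoc, ← Real.exp_add]
    rw [show t + h - (r + h) = t - r by ring, add_comm r h]
    congr 2; ring
  have h3 : Real.exp (-(a * (t + h))) = Real.exp (-(a * h)) * Real.exp (-(a * t)) := by
    rw [← Real.exp_add]; congr 1; ring
  rw [h1, h2, h3, add_comm h t]
  ring

/-- Mild solutions satisfy the damped heat equation with source wherever they are smooth. -/
lemma deriv_eq_of_mild {a : ℝ} (ha : 0 < a) {w g f : ScalarField}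
    (hw : w = dataOp ha (1, 0) g + duhamelOp ha (1, 0) f) {x : Space} {t : ℝ} (ht : 0 ≤ t)
    (hs : ContDiffAt ℝ ∞ (fun p : Space × ℝ => w p) (x, t)) :
    deriv (fun s => w (x, s)) t =
      Laplacian.laplacian (fun y => w (y, t)) x - a * w (x, t) + f (x, t) := by
  have hspace : ContDiffAt ℝ 2 (fun y : Space => w (y, t)) x := by
    have h1 : ContDiffAt ℝ ∞ (fun y : Space => ((y, t) : Space × ℝ)) x :=
      contDiffAt_id.prodMk contDiffAt_const
    exact (ContDiffAt.comp x (g := fun p : Space × ℝ => w p) hs h1).of_le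
      (mod_cast le_top : ((2 : ℕ∞) : WithTop ℕ∞) ≤ (⊤ : ℕ∞))
  have htime : DifferentiableAt ℝ (fun s => w (x, s)) t := by
    have h1 : ContDiffAt ℝ ∞ (fun s : ℝ => ((x, s) : Space × ℝ)) t :=
      contDiffAt_const.prodMk contDiffAt_id
    exact (ContDiffAt.comp t (g := fun p : Space × ℝ => w p) hs h1).differentiableAt (by simp)
  -- Differentiability in time is already known, so the right-hand difference quotient identifies
  -- the derivative.
  have hslope : Tendsto (fun h : ℝ => (w (x, t + h) - w (x, t)) / h) (𝓝[>] 0)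
      (𝓝 (deriv (fun s => w (x, s)) t)) := by
    have := (hasDerivAt_iff_tendsto_slope_zero.1 htime.hasDerivAt).mono_left
      (nhdsWithin_mono 0 (show Ioi (0 : ℝ) ⊆ {0}ᶜ from fun h hh => ne_of_gt hh))
    refine this.congr fun h => ?_
    rw [smul_eq_mul, inv_mul_eq_div]
  set u : Space → ℝ := fun y => w (y, t) with hu
  have h1 : Tendsto (fun h : ℝ => (heat h u x - u x) / h) (𝓝[>] 0)
      (𝓝 (Laplacian.laplacian u x)) :=
    tendsto_heat_quotient (w.continuous.comp (by fun_prop))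
      (fun y => w.norm_coe_le_norm (y, t)) hspace
  have h2 : Tendsto (fun h : ℝ => Real.exp (-(a * h))) (𝓝[>] 0) (𝓝 1) := by
    have : Continuous fun h : ℝ => Real.exp (-(a * h)) := by fun_prop
    simpa using (this.tendsto 0).mono_left nhdsWithin_le_nhds
  have h3 : Tendsto (fun h : ℝ => (Real.exp (-(a * h)) - 1) / h) (𝓝[>] 0) (𝓝 (-a)) := by
    have hd : HasDerivAt (fun h : ℝ => Real.exp (-(a * h))) (-a) 0 := by
      have := ((hasDerivAt_id (0 : ℝ)).const_mul a).neg.exp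
      refine this.congr_deriv ?_
      simp
    have := (hasDerivAt_iff_tendsto_slope_zero.1 hd).mono_left
      (nhdsWithin_mono 0 (show Ioi (0 : ℝ) ⊆ {0}ᶜ from fun h hh => ne_of_gt hh))
    refine this.congr fun h => ?_
    rw [smul_eq_mul, inv_mul_eq_div]
    simp
  have h4 : Tendsto (fun h : ℝ => ∫ s in Icc (0 : ℝ) 1, duhamelIntegrand a f x (t + h) (h * s))
      (𝓝[>] 0) (𝓝 (f (x, t))) := by
    have hc : Continuous fun p : ℝ × ℝ => duhamelIntegrand a f x (t + p.1) (p.1 * p.2) :=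
      (continuous_duhamelIntegrand a f).comp
        (show Continuous fun p : ℝ × ℝ => (x, t + p.1, p.1 * p.2) by fun_prop)
    have h5 : Continuous fun h : ℝ => ∫ s in (0 : ℝ)..1, duhamelIntegrand a f x (t + h) (h * s) :=
      intervalIntegral.continuous_parametric_intervalIntegral_of_continuous' hc _ _
    have h6 := (h5.tendsto 0).mono_left (nhdsWithin_le_nhds (s := Ioi 0))
    simp only [duhamelIntegrand, zero_mul, heat_zero, add_zero, sub_zero, mul_zero, neg_zero,
      Real.exp_zero, one_mul, intervalIntegral.integral_const, smul_eq_mul] at h6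
    refine h6.congr fun h => ?_
    rw [integral_Icc_eq_integral_Ioc, ← intervalIntegral.integral_of_le zero_le_one]
    rfl
  have hlim : Tendsto (fun h : ℝ => (w (x, t + h) - w (x, t)) / h) (𝓝[>] 0)
      (𝓝 (1 * Laplacian.laplacian u x + -a * u x + f (x, t))) := by
    refine (((h2.mul h1).add (h3.mul_const (u x))).add h4).congr' ?_
    filter_upwards [self_mem_nhdsWithin] with h hh
    have hh : 0 < h := hh
    rw [mild_restart ha hw x ht hh.le]
    change _ = (Real.exp (-(a * h)) * heat h u x + _ - u x) / h
    field_simp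
    ring
  rw [tendsto_nhds_unique hslope hlim]
  ring

/-! ### Leading-order asymptotics in the weighted space. -/

lemma exists_gauss_decay {p : ℝ} (hp : 0 < p) :
    ∃ C : ℝ, 0 < C ∧ ∀ y : Space, gauss y ≤ C * (1 / (1 + ‖y‖) ^ p) := by
  obtain ⟨C, hC, h⟩ := exists_rpow_sqrt_le_exp hp (show (0 : ℝ) < 1 / 4 by norm_num)
  have hP : (0 : ℝ) < (4 * Real.pi) ^ (3 / 2 : ℝ) := by positivity
  refine ⟨C * Real.exp (1 / 4) / (4 * Real.pi) ^ (3 / 2 : ℝ), by positivity, fun y => ?_⟩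
  have h1 := h 1 y zero_le_one
  rw [Real.sqrt_one, one_mul, mul_one] at h1
  have h2 : gauss y = Real.exp (-(1 / 4) * ‖y‖ ^ 2) / (4 * Real.pi) ^ (3 / 2 : ℝ) := rfl
  have h3 : Real.exp (-(1 / 4) * ‖y‖ ^ 2) * Real.exp (1 / 4 * ‖y‖ ^ 2) = 1 := by
    rw [← Real.exp_add]; simp
  rw [h2, mul_one_div, div_div, div_le_div_iff₀ hP (by positivity)]
  calc Real.exp (-(1 / 4) * ‖y‖ ^ 2) * ((4 * Real.pi) ^ (3 / 2 : ℝ) * (1 + ‖y‖) ^ p)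
      = Real.exp (-(1 / 4) * ‖y‖ ^ 2) * (4 * Real.pi) ^ (3 / 2 : ℝ) * (1 + ‖y‖) ^ p := by ring
    _ ≤ Real.exp (-(1 / 4) * ‖y‖ ^ 2) * (4 * Real.pi) ^ (3 / 2 : ℝ) *
        (C * (Real.exp (1 / 4) * Real.exp (1 / 4 * ‖y‖ ^ 2))) := by gcongr
    _ = C * Real.exp (1 / 4) * (4 * Real.pi) ^ (3 / 2 : ℝ) *
        (Real.exp (-(1 / 4) * ‖y‖ ^ 2) * Real.exp (1 / 4 * ‖y‖ ^ 2)) := by ring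
    _ = _ := by rw [h3, mul_one]

lemma heatKernel_one (y : Space) : heatKernel y 1 = gauss y := by
  rw [heatKernel_eq_gauss one_pos]; simp

lemma heatKernel_nonneg (y : Space) {r : ℝ} (hr : 0 ≤ r) : 0 ≤ heatKernel y r := by
  unfold heatKernel; positivity

lemma integral_heatKernel {r : ℝ} (hr : 0 < r) : ∫ y, heatKernel y r = 1 := by
  have h := heat_eq_convolution (fun _ : Space => (1 : ℝ)) hr 0
  have h1 : heat r (fun _ : Space => (1 : ℝ)) 0 = 1 := by simp [heat]
  rw [h1] at h
  rw [h]
  simp [heatKernel]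

/-- The kernel at time s + 1 is the heat flow over time s of a Gaussian, so the general decay
estimate applies. -/
lemma exists_heatKernel_decay {p η : ℝ} (hp : 0 < p) (hη : 0 < η) :
    ∃ C : ℝ, 0 < C ∧ ∀ (s : ℝ) (y : Space), 0 ≤ s →
      heatKernel y (s + 1) ≤ C * Real.exp (η * s) * (1 / (1 + ‖y‖) ^ p) := by
  obtain ⟨C₁, hC₁, h₁⟩ := exists_gauss_decay hp
  obtain ⟨C₂, hC₂, h₂⟩ := exists_heat_decay hp hη
  refine ⟨C₂ * C₁, by positivity, fun s y hs => ?_⟩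
  have h := h₂ C₁ s (fun y => heatKernel y 1) hC₁.le hs (fun y => by
    rw [heatKernel_one, abs_of_pos (gauss_pos y)]; exact h₁ y) y
  rw [heat_heatKernel hs one_pos] at h
  calc heatKernel y (s + 1) ≤ _ := (le_abs_self _).trans h
    _ = _ := by ring

lemma exists_weight_heatKernel_le {δ η : ℝ} (hδ : 0 < δ) (hη : 0 < η) :
    ∃ C : ℝ, 0 < C ∧ ∀ (x : Space) (t : ℝ), 0 ≤ t →
      weight δ x t * heatKernel x (t + 1) ≤ C * Real.exp (η * t) := by
  obtain ⟨C₁, hC₁, h₁⟩ := exists_gauss_decay (p := 4 + δ / 2) (by positivity)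
  obtain ⟨C₂, hC₂, h₂⟩ := exists_rpow_le_exp (p := 2) two_pos hη
  refine ⟨C₁ * C₂, by positivity, fun x t ht => ?_⟩
  have h3 : 1 ≤ (t + 1) ^ (3 / 2 : ℝ) := Real.one_le_rpow (by linarith) (by norm_num)
  have h4 := h₁ ((Real.sqrt (t + 1))⁻¹ • x)
  rw [norm_smul, norm_inv, Real.norm_of_nonneg (Real.sqrt_nonneg _), inv_mul_eq_div] at h4
  have h5 : heatKernel x (t + 1) ≤ C₁ * (1 / (1 + ‖x‖ / Real.sqrt (t + 1)) ^ (4 + δ / 2)) := by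
    rw [heatKernel_eq_gauss (by linarith)]
    exact (div_le_self (gauss_pos _).le h3).trans h4
  have h6 := h₂ t ht
  have hpos : (1 + ‖x‖ / Real.sqrt (t + 1)) ^ (4 + δ / 2) ≠ 0 := by positivity
  calc weight δ x t * heatKernel x (t + 1)
      ≤ weight δ x t * (C₁ * (1 / (1 + ‖x‖ / Real.sqrt (t + 1)) ^ (4 + δ / 2))) :=
        mul_le_mul_of_nonneg_left h5 (weight_nonneg δ x)
    _ = C₁ * (1 + t) ^ (2 : ℝ) := by
        unfold weight
        rw [Real.rpow_two]
        field_simp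
        ring
    _ ≤ C₁ * (C₂ * Real.exp (η * t)) := by gcongr
    _ = _ := by ring

/-- Follows from t + 1 ≤ (1 + s)(t - s + 1). It compares the weight at time t with that at the age t
- s of mass injected at time s; the loss (1 + s)² is absorbed by the exponential decay of the
source. -/
lemma weight_le_mul {δ : ℝ} (hδ : 0 < δ) (x : Space) {s t : ℝ} (hs : 0 ≤ s) (hst : s ≤ t) :
    weight δ x t ≤ (1 + s) ^ 2 * weight δ x (t - s) := by
  unfold weight
  have h1 : Real.sqrt (t - s + 1) ≤ Real.sqrt (t + 1) := Real.sqrt_le_sqrt (by linarith)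
  have h0 : 0 < Real.sqrt (t - s + 1) := Real.sqrt_pos.2 (by linarith)
  have h2 : t + 1 ≤ (1 + s) * (t - s + 1) := by nlinarith
  have h3 : (t + 1) ^ 2 ≤ ((1 + s) * (t - s + 1)) ^ 2 := by
    have : 0 ≤ t + 1 := by linarith
    gcongr
  calc (1 + ‖x‖ / Real.sqrt (t + 1)) ^ (4 + δ / 2) * (t + 1) ^ 2
      ≤ (1 + ‖x‖ / Real.sqrt (t - s + 1)) ^ (4 + δ / 2) * ((1 + s) * (t - s + 1)) ^ 2 := by gcongr
    _ = _ := by ring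

lemma intervalIntegral_exp_neg_le {k t : ℝ} (hk : 0 < k) (ht : 0 ≤ t) :
    ∫ s in (0 : ℝ)..t, Real.exp (-k * s) ≤ 1 / k := by
  rw [intervalIntegral.integral_of_le ht]
  have h := integrableOn_exp_mul_Ioi (neg_lt_zero.2 hk) 0
  calc ∫ s in Ioc 0 t, Real.exp (-k * s) ≤ ∫ s in Ioi 0, Real.exp (-k * s) :=
        setIntegral_mono_set h (Eventually.of_forall fun s => (Real.exp_pos _).le)
          (Eventually.of_forall Ioc_subset_Ioi_self)
    _ = 1 / k := by
        rw [integral_exp_mul_Ioi (neg_lt_zero.2 hk)]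
        simp [neg_div_neg_eq]

lemma heat_sub_const_mul {f g : Space → ℝ} (hf : Continuous f) (hg : Continuous g) {C D : ℝ}
    (hC : ∀ y, |f y| ≤ C) (hD : ∀ y, |g y| ≤ D) (k t : ℝ) (x : Space) :
    heat t (fun y => f y - k * g y) x = heat t f x - k * heat t g x := by
  unfold heat
  rw [integral_sub (integrable_heat hf hC t x) ((integrable_heat hg hD t x).const_mul k),
    integral_const_mul]

lemma continuous_heatKernel_left (r : ℝ) : Continuous fun y : Space => heatKernel y r := by
  unfold heatKernel; fun_prop

/-- Leading order asymptotics of mild solutions with a rapidly decaying source. -/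
lemma exists_weight_remainder_le {a δ : ℝ} (ha : 0 < a) (hδ : 0 < δ) {w g f : ScalarField}
    (hw : w = dataOp ha (1, 0) g + duhamelOp ha (1, 0) f) {α B : ℝ} (hα : 0 ≤ α) (hB : 0 ≤ B)
    (hg : ∀ y : Space, |g (y, 0)| ≤ α * (1 / (1 + ‖y‖) ^ (8 + δ)))
    (hf : ∀ (y : Space) (s : ℝ),
      |f (y, s)| ≤ B * Real.exp (-(3 / 2 * a) * max s 0) * (1 / (1 + ‖y‖) ^ (8 + δ))) :
    ∃ M : ℝ, ∀ t : ℝ, 0 ≤ t → ∀ x : Space, weight δ x t * |Real.exp (a * t) * w (x, t)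
      - ((∫ y, g (y, 0)) + ∫ s in Ioi (0 : ℝ), Real.exp (a * s) * ∫ y, f (y, s))
        * heatKernel x (t + 1)| ≤ M := by
  obtain ⟨C₁, hC₁, hheat⟩ := exists_weight_heat_le hδ
  obtain ⟨C₂, hC₂, hker⟩ := exists_heatKernel_decay (p := 8 + δ) (η := a / 8) (by positivity)
    (by positivity)
  obtain ⟨C₃, hC₃, hwk⟩ := exists_weight_heatKernel_le (η := a / 2) hδ (by positivity)
  obtain ⟨C₄, hC₄, hpoly⟩ := exists_rpow_le_exp (p := 2) (η := a / 8) two_pos (by positivity)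
  set φ : Space → ℝ := fun y => 1 / (1 + ‖y‖) ^ (8 + δ) with hφ
  have hφint : Integrable φ := integrable_inv_one_add_norm_rpow (by linarith)
  have hφ0 : ∀ y, 0 ≤ φ y := fun y => by positivity
  have hφ1 : ∀ y, φ y ≤ 1 := fun y => by
    rw [hφ]
    simp only
    rw [div_le_one (by positivity)]
    exact Real.one_le_rpow (by linarith [norm_nonneg y]) (by linarith)
  set I := ∫ y, φ y with hI
  have hI0 : 0 ≤ I := integral_nonneg hφ0
  have hgc : Continuous fun y : Space => g (y, 0) := g.continuous.comp (by fun_prop)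
  have hfc : ∀ s : ℝ, Continuous fun y : Space => f (y, s) := fun s =>
    f.continuous.comp (by fun_prop)
  have hgint : Integrable fun y : Space => g (y, 0) :=
    (hφint.const_mul α).mono' hgc.aestronglyMeasurable (Eventually.of_forall hg)
  have hfint : ∀ s : ℝ, Integrable fun y : Space => f (y, s) := fun s =>
    (hφint.const_mul _).mono' (hfc s).aestronglyMeasurable (Eventually.of_forall fun y => hf y s)
  have hkint : ∀ s : ℝ, 0 ≤ s → Integrable fun y : Space => heatKernel y (s + 1) := fun s hs =>
    (hφint.const_mul _).mono' (continuous_heatKernel_left _).aestronglyMeasurable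
      (Eventually.of_forall fun y => by
        rw [Real.norm_of_nonneg (heatKernel_nonneg y (by linarith))]; exact hker s y hs)
  have hkb : ∀ s : ℝ, 0 ≤ s → ∀ y : Space,
      |heatKernel y (s + 1)| ≤ C₂ * Real.exp (a / 8 * s) := fun s hs y => by
    rw [abs_of_nonneg (heatKernel_nonneg y (by linarith))]
    exact (hker s y hs).trans (mul_le_of_le_one_right (by positivity) (hφ1 y))
  -- The rate of mass injection after the damping is removed; it is O(e^{-as/2}).
  set m : ℝ → ℝ := fun s => Real.exp (a * s) * ∫ y, f (y, s) with hm
  have hmc : Continuous m := by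
    refine Continuous.mul (by fun_prop) ?_
    refine continuous_of_dominated (bound := fun y => B * φ y)
      (fun s => (hfc s).aestronglyMeasurable) (fun s => Eventually.of_forall fun y => ?_)
      (hφint.const_mul B) (Eventually.of_forall fun y => f.continuous.comp (by fun_prop))
    refine (hf y s).trans ?_
    have : Real.exp (-(3 / 2 * a) * max s 0) ≤ 1 := by
      rw [Real.exp_le_one_iff]
      have := mul_nonneg ha.le (le_max_right s 0)
      nlinarith
    have h0 := hφ0 y
    calc B * Real.exp (-(3 / 2 * a) * max s 0) * φ y ≤ B * 1 * φ y := by gcongr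
      _ = _ := by ring
  have hexpf : ∀ (y : Space) (s : ℝ), 0 ≤ s →
      |Real.exp (a * s) * f (y, s)| ≤ B * Real.exp (-(a / 2) * s) * φ y := by
    intro y s hs
    rw [abs_mul, abs_of_pos (Real.exp_pos _)]
    have h := hf y s
    rw [max_eq_left hs] at h
    have e : Real.exp (-(a / 2) * s) = Real.exp (a * s) * Real.exp (-(3 / 2 * a) * s) := by
      rw [← Real.exp_add]; congr 1; ring
    calc Real.exp (a * s) * |f (y, s)| ≤ Real.exp (a * s) * _ :=
          mul_le_mul_of_nonneg_left h (Real.exp_pos _).le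
      _ = _ := by rw [e]; ring
  have hmb : ∀ s : ℝ, 0 ≤ s → |m s| ≤ B * I * Real.exp (-(a / 2) * s) := by
    intro s hs
    have : m s = ∫ y, Real.exp (a * s) * f (y, s) := (integral_const_mul _ _).symm
    rw [this, ← Real.norm_eq_abs]
    refine (norm_integral_le_of_norm_le (hφint.const_mul _)
      (Eventually.of_forall fun y => hexpf y s hs)).trans (le_of_eq ?_)
    rw [integral_const_mul]; ring
  have hdom : ∀ t : ℝ, IntegrableOn (fun s => B * I * Real.exp (-(a / 2) * s)) (Ioi t) := fun t =>
    (integrableOn_exp_mul_Ioi (by linarith) t).const_mul _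
  have hmint : ∀ t : ℝ, 0 ≤ t → IntegrableOn m (Ioi t) := fun t ht =>
    (hdom t).mono' hmc.aestronglyMeasurable
      ((ae_restrict_mem measurableSet_Ioi).mono fun s hs => hmb s (ht.trans (le_of_lt hs)))
  -- Mean-free part of the source. The kernel is taken at time s + 1 so that after the remaining
  -- time t - s it has become the kernel at t + 1, whatever s was.
  set ρ : ℝ → Space → ℝ := fun s y => Real.exp (a * s) * f (y, s) - m s * heatKernel y (s + 1)
    with hρ
  have hρb : ∀ s : ℝ, 0 ≤ s → ∀ y,
      |ρ s y| ≤ B * (1 + I * C₂) * Real.exp (-(3 / 8 * a) * s) * φ y := by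
    intro s hs y
    have h1 := hexpf y s hs
    have h2 := hmb s hs
    have h3 := hker s y hs
    have h0 := hφ0 y
    have e1 : Real.exp (-(a / 2) * s) ≤ Real.exp (-(3 / 8 * a) * s) := by
      gcongr; linarith
    have e2 : Real.exp (-(a / 2) * s) * Real.exp (a / 8 * s) = Real.exp (-(3 / 8 * a) * s) := by
      rw [← Real.exp_add]; congr 1; ring
    calc |ρ s y| ≤ |Real.exp (a * s) * f (y, s)| + |m s * heatKernel y (s + 1)| := abs_sub _ _
      _ ≤ B * Real.exp (-(a / 2) * s) * φ y
          + (B * I * Real.exp (-(a / 2) * s)) * (C₂ * Real.exp (a / 8 * s) * φ y) := by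
          rw [abs_mul (m s), abs_of_nonneg (heatKernel_nonneg y (by linarith : 0 ≤ s + 1))]
          have := heatKernel_nonneg y (by linarith : 0 ≤ s + 1)
          gcongr
      _ = B * Real.exp (-(a / 2) * s) * φ y + B * I * C₂ *
          (Real.exp (-(a / 2) * s) * Real.exp (a / 8 * s)) * φ y := by ring
      _ ≤ B * Real.exp (-(3 / 8 * a) * s) * φ y
          + B * I * C₂ * Real.exp (-(3 / 8 * a) * s) * φ y := by rw [e2]; gcongr
      _ = _ := by ring
  have hρc : ∀ s, Continuous (ρ s) := fun s =>
    ((hfc s).const_smul (Real.exp (a * s))).sub ((continuous_heatKernel_left _).const_smul (m s))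
  have hρ0 : ∀ s : ℝ, 0 ≤ s → ∫ y, ρ s y = 0 := by
    intro s hs
    simp only [hρ]
    rw [integral_sub ((hfint s).const_mul _) ((hkint s hs).const_mul _), integral_const_mul,
      integral_const_mul, integral_heatKernel (by linarith), hm]
    ring
  have hρheat : ∀ s t : ℝ, 0 ≤ s → s ≤ t → ∀ x, heat (t - s) (ρ s) x =
      Real.exp (a * s) * heat (t - s) (fun y => f (y, s)) x - m s * heatKernel x (t + 1) := by
    intro s t hs hst x
    have h1 : Continuous fun y : Space => Real.exp (a * s) * f (y, s) :=
      continuous_const.mul (hfc s)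
    have h2 : ∀ y : Space, |Real.exp (a * s) * f (y, s)| ≤ Real.exp (a * s) * ‖f‖ := fun y => by
      rw [abs_mul, abs_of_pos (Real.exp_pos _)]
      gcongr
      exact f.norm_coe_le_norm _
    rw [hρ]
    simp only
    rw [heat_sub_const_mul h1 (continuous_heatKernel_left _) h2 (hkb s hs), heat_const_mul,
      heat_heatKernel (by linarith) (by linarith), show t - s + (s + 1) = t + 1 by ring]
  set G := ∫ y, g (y, 0) with hG
  have hG_le : |G| ≤ α * I := by
    rw [hG, ← Real.norm_eq_abs]
    refine (norm_integral_le_of_norm_le (hφint.const_mul α)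
      (Eventually.of_forall hg)).trans (le_of_eq ?_)
    rw [integral_const_mul]
  set ρ₀ : Space → ℝ := fun y => g (y, 0) - G * heatKernel y (0 + 1) with hρ₀
  have hρ₀c : Continuous ρ₀ := hgc.sub ((continuous_heatKernel_left _).const_smul G)
  have hρ₀b : ∀ y, |ρ₀ y| ≤ α * (1 + I * C₂) * φ y := by
    intro y
    have h3 := hker 0 y le_rfl
    rw [mul_zero, Real.exp_zero, mul_one] at h3
    have h0 := hφ0 y
    calc |ρ₀ y| ≤ |g (y, 0)| + |G * heatKernel y (0 + 1)| := abs_sub _ _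
      _ ≤ α * φ y + (α * I) * (C₂ * φ y) := by
          rw [abs_mul G, abs_of_nonneg (heatKernel_nonneg y (by norm_num : (0 : ℝ) ≤ 0 + 1))]
          have := heatKernel_nonneg y (by norm_num : (0 : ℝ) ≤ 0 + 1)
          have := hg y
          gcongr
      _ = _ := by ring
  have hρ₀0 : ∫ y, ρ₀ y = 0 := by
    simp only [hρ₀]
    rw [integral_sub hgint ((hkint 0 le_rfl).const_mul _), integral_const_mul,
      integral_heatKernel (by norm_num), hG]
    ring
  refine ⟨C₁ * (α * (1 + I * C₂)) + C₁ * (B * (1 + I * C₂)) * C₄ * (1 / (a / 4))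
    + C₃ * (B * I * (2 / a)), fun t ht x => ?_⟩
  have hρ₀heat : heat t ρ₀ x = heat t (fun y => g (y, 0)) x - G * heatKernel x (t + 1) := by
    rw [hρ₀, heat_sub_const_mul hgc (continuous_heatKernel_left _)
      (fun y => g.norm_coe_le_norm (y, 0)) (hkb 0 le_rfl), heat_heatKernel ht (by norm_num),
      zero_add]
  have hcont : Continuous fun s => Real.exp (a * s) * heat (t - s) (fun y => f (y, s)) x := by
    have h1 : Continuous fun s => Real.exp (a * t) * duhamelIntegrand a f x t (t - s) :=
      continuous_const.mul ((continuous_duhamelIntegrand a f).comp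
        (show Continuous fun s : ℝ => (x, t, t - s) by fun_prop))
    refine h1.congr fun s => ?_
    simp only [duhamelIntegrand]
    rw [← mul_assoc, ← Real.exp_add, sub_sub_cancel]
    congr 2; ring
  have hwt : Real.exp (a * t) * w (x, t) = heat t (fun y => g (y, 0)) x
      + ∫ s in (0 : ℝ)..t, Real.exp (a * s) * heat (t - s) (fun y => f (y, s)) x := by
    conv_lhs => rw [hw]
    rw [BF.add_apply, dataOp_apply ha (one_zero_mem_admissible ha) _ _ ht,
      duhamelOp_eq_intervalIntegral ha _ _ ht, mul_add]
    congr 1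
    · simp only [mul_one, one_mul, smul_zero, add_zero]
      rw [← mul_assoc, ← Real.exp_add]
      simp
    · rw [← intervalIntegral.integral_const_mul]
      have := intervalIntegral.integral_comp_sub_left (a := 0) (b := t)
        (fun s => Real.exp (a * s) * heat (t - s) (fun y => f (y, s)) x) t
      rw [sub_self, sub_zero] at this
      rw [← this]
      refine intervalIntegral.integral_congr fun r _ => ?_
      simp only [duhamelIntegrand]
      rw [← mul_assoc, ← Real.exp_add, sub_sub_cancel]
      congr 2; ring
  have hsplit : ∫ s in Ioi (0 : ℝ), m s = (∫ s in (0 : ℝ)..t, m s) + ∫ s in Ioi t, m s := by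
    rw [intervalIntegral.integral_of_le ht, ← setIntegral_union (Ioc_disjoint_Ioi le_rfl)
      measurableSet_Ioi ((hmint 0 le_rfl).mono_set Ioc_subset_Ioi_self) (hmint t ht),
      Ioc_union_Ioi_eq_Ioi ht]
  -- The error has three parts: the flow of the mean-free datum, the flows of the mean-free sources,
  -- and the mass yet to be injected after time t, credited too early.
  have hrep : Real.exp (a * t) * w (x, t) - (G + ∫ s in Ioi (0 : ℝ), m s) * heatKernel x (t + 1)
      = heat t ρ₀ x + (∫ s in (0 : ℝ)..t, heat (t - s) (ρ s) x)
        - (∫ s in Ioi t, m s) * heatKernel x (t + 1) := by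
    have h1 : ∫ s in (0 : ℝ)..t, heat (t - s) (ρ s) x = (∫ s in (0 : ℝ)..t, Real.exp (a * s) *
        heat (t - s) (fun y => f (y, s)) x) - (∫ s in (0 : ℝ)..t, m s) * heatKernel x (t + 1) := by
      rw [← intervalIntegral.integral_mul_const, ← intervalIntegral.integral_sub
        (hcont.intervalIntegrable _ _) ((hmc.mul_const _).intervalIntegrable _ _)]
      refine intervalIntegral.integral_congr fun s hs => ?_
      rw [uIcc_of_le ht] at hs
      exact hρheat s t hs.1 hs.2 x
    rw [h1, hwt, hsplit, hρ₀heat]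
    ring
  rw [hrep]
  have hW := weight_nonneg δ x (t := t)
  have b1 : weight δ x t * |heat t ρ₀ x| ≤ C₁ * (α * (1 + I * C₂)) :=
    hheat _ t ρ₀ (by positivity) ht hρ₀c hρ₀b hρ₀0 x
  have b2 : weight δ x t * |∫ s in (0 : ℝ)..t, heat (t - s) (ρ s) x|
      ≤ C₁ * (B * (1 + I * C₂)) * C₄ * (1 / (a / 4)) := by
    have hpt : ∀ s ∈ Ioc (0 : ℝ) t, ‖weight δ x t * heat (t - s) (ρ s) x‖
        ≤ C₁ * (B * (1 + I * C₂)) * C₄ * Real.exp (-(a / 4) * s) := by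
      intro s hs
      have h1 := hheat _ (t - s) (ρ s) (by positivity) (by linarith [hs.2]) (hρc s)
        (hρb s hs.1.le) (hρ0 s hs.1.le) x
      have h2 := weight_le_mul hδ x hs.1.le hs.2
      have h3 := hpoly s hs.1.le
      rw [Real.rpow_two] at h3
      have e : Real.exp (a / 8 * s) * Real.exp (-(3 / 8 * a) * s) = Real.exp (-(a / 4) * s) := by
        rw [← Real.exp_add]; congr 1; ring
      rw [norm_mul, Real.norm_of_nonneg hW, Real.norm_eq_abs]
      calc weight δ x t * |heat (t - s) (ρ s) x|
          ≤ ((1 + s) ^ 2 * weight δ x (t - s)) * |heat (t - s) (ρ s) x| := by gcongr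
        _ = (1 + s) ^ 2 * (weight δ x (t - s) * |heat (t - s) (ρ s) x|) := by ring
        _ ≤ (C₄ * Real.exp (a / 8 * s)) *
            (C₁ * (B * (1 + I * C₂) * Real.exp (-(3 / 8 * a) * s))) := by
            gcongr
            exact mul_nonneg (weight_nonneg δ x) (abs_nonneg _)
        _ = C₁ * (B * (1 + I * C₂)) * C₄ *
            (Real.exp (a / 8 * s) * Real.exp (-(3 / 8 * a) * s)) := by ring
        _ = _ := by rw [e]
    have hint : IntervalIntegrable
        (fun s => C₁ * (B * (1 + I * C₂)) * C₄ * Real.exp (-(a / 4) * s)) volume 0 t :=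
      Continuous.intervalIntegrable (by fun_prop) _ _
    have hb := intervalIntegral.norm_integral_le_of_norm_le ht (ae_of_all _ hpt) hint
    rw [intervalIntegral.integral_const_mul, intervalIntegral.integral_const_mul, norm_mul,
      Real.norm_of_nonneg hW] at hb
    refine hb.trans ?_
    have := intervalIntegral_exp_neg_le (k := a / 4) (by positivity) ht
    gcongr
  have b3 : weight δ x t * |(∫ s in Ioi t, m s) * heatKernel x (t + 1)|
      ≤ C₃ * (B * I * (2 / a)) := by
    have h1 : |∫ s in Ioi t, m s| ≤ B * I * (2 / a) * Real.exp (-(a / 2) * t) := by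
      rw [← Real.norm_eq_abs]
      refine (norm_integral_le_of_norm_le (hdom t) ((ae_restrict_mem measurableSet_Ioi).mono
        fun s hs => hmb s (ht.trans (le_of_lt hs)))).trans (le_of_eq ?_)
      rw [integral_const_mul, integral_exp_mul_Ioi (by linarith)]
      field_simp
    have h2 := hwk x t ht
    have hk0 := heatKernel_nonneg x (by linarith : 0 ≤ t + 1)
    have e : Real.exp (a / 2 * t) * Real.exp (-(a / 2) * t) = 1 := by
      rw [← Real.exp_add, Real.exp_eq_one_iff]; ring
    rw [abs_mul, abs_of_nonneg hk0]
    calc weight δ x t * (|∫ s in Ioi t, m s| * heatKernel x (t + 1))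
        = (weight δ x t * heatKernel x (t + 1)) * |∫ s in Ioi t, m s| := by ring
      _ ≤ (C₃ * Real.exp (a / 2 * t)) * (B * I * (2 / a) * Real.exp (-(a / 2) * t)) := by gcongr
      _ = C₃ * (B * I * (2 / a)) * (Real.exp (a / 2 * t) * Real.exp (-(a / 2) * t)) := by ring
      _ = _ := by rw [e, mul_one]
  calc weight δ x t * |heat t ρ₀ x + (∫ s in (0 : ℝ)..t, heat (t - s) (ρ s) x)
        - (∫ s in Ioi t, m s) * heatKernel x (t + 1)|
      ≤ weight δ x t * (|heat t ρ₀ x| + |∫ s in (0 : ℝ)..t, heat (t - s) (ρ s) x|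
        + |(∫ s in Ioi t, m s) * heatKernel x (t + 1)|) := by
        gcongr
        exact (abs_sub _ _).trans (by gcongr; exact abs_add_le _ _)
    _ ≤ _ := by rw [mul_add, mul_add]; gcongr

/-! ### A maximum principle for systems. -/

/-- Heat averages never exceed the maximum, so the quotients converging to the Laplacian are
nonpositive. -/
lemma laplacian_nonpos_of_le {u : Space → ℝ} (hc : Continuous u) {C : ℝ} (hC : ∀ y, |u y| ≤ C)
    {x : Space} (hu : ContDiffAt ℝ 2 u x) (hmax : ∀ y, u y ≤ u x) :
    Laplacian.laplacian u x ≤ 0 := by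
  refine le_of_tendsto (tendsto_heat_quotient hc hC hu) ?_
  filter_upwards [self_mem_nhdsWithin] with h hh
  have hh : 0 < h := hh
  have h1 : heat h u x ≤ u x := by
    have := integral_mono (μ := gaussMeasure) (integrable_heat hc hC h x)
      (integrable_const (u x)) (fun z => hmax _)
    simpa [heat] using this
  exact div_nonpos_of_nonpos_of_nonneg (by linarith) hh.le

lemma deriv_nonneg_of_left_max {f : ℝ → ℝ} {f' t : ℝ} (ht : 0 < t) (hf : HasDerivAt f f' t)
    (hmax : ∀ s, 0 < s → s < t → f s ≤ f t) : 0 ≤ f' := by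
  have h1 := (hasDerivAt_iff_tendsto_slope.1 hf).mono_left
    (nhdsWithin_mono t (show Iio t ⊆ {t}ᶜ from fun h hh => ne_of_lt hh))
  refine ge_of_tendsto h1 ?_
  filter_upwards [Ioo_mem_nhdsLT ht] with s hs
  rw [slope_def_field]
  exact div_nonneg_of_nonpos (by linarith [hmax s hs.1 hs.2]) (by linarith [hs.2])

lemma laplacian_sum_const_mul {ι : Type*} (s : Finset ι) (k : ι → ℝ) (u : ι → Space → ℝ)
    {x : Space} (hu : ∀ i, ContDiffAt ℝ 2 (u i) x) :
    Laplacian.laplacian (fun y => ∑ i ∈ s, k i * u i y) x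
      = ∑ i ∈ s, k i * Laplacian.laplacian (u i) x := by
  classical
  induction s using Finset.induction_on with
  | empty =>
    have : (fun _ : Space => (0 : ℝ)) = (0 : ℝ) • (fun _ : Space => (0 : ℝ)) := by ext; simp
    simp only [Finset.sum_empty]
    rw [this, InnerProductSpace.laplacian_smul _ contDiffAt_const, zero_smul]
  | insert j s hj ih =>
    simp only [Finset.sum_insert hj]
    have h1 : ContDiffAt ℝ 2 (k j • u j) x := (hu j).const_smul (k j)
    have h2 : ContDiffAt ℝ 2 (fun y => ∑ i ∈ s, k i * u i y) x :=
      ContDiffAt.sum fun i _ => contDiffAt_const.mul (hu i)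
    have h3 := h1.laplacian_add h2
    rw [InnerProductSpace.laplacian_smul _ (hu j), ih] at h3
    exact h3

/-- An energy maximum principle for systems of parabolic inequalities on the whole space. -/
lemma eq_zero_of_energy_inequality {ι : Type*} [Fintype ι] {P : ι → ℝ → Space → ℝ} {T C M : ℝ}
    (hC : 0 ≤ C)
    (hcont : ∀ i, ContinuousOn (fun p : Space × ℝ => P i p.2 p.1) (univ ×ˢ Ici 0))
    (hdecay : ∀ t, 0 ≤ t → t ≤ T → ∀ x i, (1 + ‖x‖) * |P i t x| ≤ M)
    (hzero : ∀ x i, P i 0 x = 0)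
    (hspace : ∀ t, 0 < t → ∀ x i, ContDiffAt ℝ 2 (P i t) x)
    (htime : ∀ t, 0 < t → ∀ x i, DifferentiableAt ℝ (fun s => P i s x) t)
    (hineq : ∀ t, 0 < t → t ≤ T → ∀ x,
      ∑ i, P i t x * (deriv (fun s => P i s x) t - Laplacian.laplacian (P i t) x)
        ≤ C * ∑ i, P i t x ^ 2) :
    ∀ t, 0 ≤ t → t ≤ T → ∀ x i, P i t x = 0 := by
  intro t₀ ht₀ ht₀T x₀ i₀
  by_contra hne
  set e : ℝ → Space → ℝ := fun t x => ∑ i, P i t x ^ 2 with he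
  have he0 : ∀ t x, 0 ≤ e t x := fun t x => Finset.sum_nonneg fun i _ => sq_nonneg _
  have hepos : 0 < e t₀ x₀ :=
    lt_of_lt_of_le (by positivity)
      (Finset.single_le_sum (f := fun i => P i t₀ x₀ ^ 2) (fun i _ => sq_nonneg _)
        (Finset.mem_univ i₀))
  -- The damping e^{-kt} beats the growth rate 2C of the energy with 1 to spare, which makes the
  -- final contradiction strict.
  set k := 2 * C + 1 with hk
  set z : Space × ℝ → ℝ := fun p => Real.exp (-(k * p.2)) * e p.2 p.1 with hz
  set κ := z (x₀, t₀) with hκ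
  have hκpos : 0 < κ := mul_pos (Real.exp_pos _) hepos
  have hM : 0 ≤ M := (by positivity : 0 ≤ (1 + ‖x₀‖) * |P i₀ t₀ x₀|).trans
    (hdecay t₀ ht₀ ht₀T x₀ i₀)
  obtain ⟨n, hn⟩ : ∃ n : ℝ, n = (Fintype.card ι : ℝ) := ⟨_, rfl⟩
  have hebound : ∀ t, 0 ≤ t → t ≤ T → ∀ x, e t x * (1 + ‖x‖) ≤ n * M ^ 2 := by
    intro t ht htT x
    have h1 : ∀ i, P i t x ^ 2 * (1 + ‖x‖) ≤ M ^ 2 := by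
      intro i
      have h2 := hdecay t ht htT x i
      have h3 : 1 ≤ 1 + ‖x‖ := by linarith [norm_nonneg x]
      calc P i t x ^ 2 * (1 + ‖x‖) ≤ P i t x ^ 2 * (1 + ‖x‖) ^ 2 := by
            gcongr; nlinarith
        _ = ((1 + ‖x‖) * |P i t x|) ^ 2 := by rw [mul_pow, sq_abs]; ring
        _ ≤ M ^ 2 := by gcongr
    rw [he]
    simp only
    rw [Finset.sum_mul]
    refine (Finset.sum_le_sum fun i _ => h1 i).trans (le_of_eq ?_)
    simp [hn]
  -- Beyond this radius decay keeps the energy below κ, so the maximum over the compact cylinder is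
  -- global.
  set R := max ‖x₀‖ (2 * (n * M ^ 2) / κ) with hR
  have hzc : ContinuousOn z (univ ×ˢ Ici 0) := by
    refine ContinuousOn.mul (by fun_prop) ?_
    exact continuousOn_finsetSum _ fun i _ => (hcont i).pow 2
  obtain ⟨⟨x, t⟩, ⟨hx, ht⟩, hmax⟩ := ((isCompact_closedBall (0 : Space) R).prod
    (isCompact_Icc (a := (0 : ℝ)) (b := T))).exists_isMaxOn
    ⟨(x₀, t₀), by simp [hR], ht₀, ht₀T⟩
    (hzc.mono (prod_mono (subset_univ _) Icc_subset_Ici_self))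
  simp only at hx ht
  have hzκ : κ ≤ z (x, t) := hmax ⟨by simp [hR], ht₀, ht₀T⟩
  have hglobal : ∀ y s, 0 ≤ s → s ≤ T → z (y, s) ≤ z (x, t) := by
    intro y s hs hsT
    by_cases hy : ‖y‖ ≤ R
    · exact hmax ⟨by simpa using hy, hs, hsT⟩
    · push Not at hy
      have h1 := hebound s hs hsT y
      have h2 : 2 * (n * M ^ 2) / κ < ‖y‖ := (le_max_right _ _).trans_lt hy
      rw [div_lt_iff₀ hκpos] at h2
      have h3 : e s y ≤ κ := by
        by_contra h4
        push Not at h4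
        nlinarith [norm_nonneg y, he0 s y]
      have h4 : Real.exp (-(k * s)) ≤ 1 := by
        rw [Real.exp_le_one_iff]
        have : 0 ≤ k * s := by positivity
        linarith
      calc z (y, s) ≤ 1 * κ := by
            rw [hz]; simp only
            have := he0 s y
            gcongr
        _ ≤ _ := by rw [one_mul]; exact hzκ
  have hzpos : 0 < z (x, t) := hκpos.trans_le hzκ
  have htpos : 0 < t := by
    rcases ht.1.eq_or_lt with h | h
    · rw [← h] at hzpos
      simp [hz, he, hzero] at hzpos
    · exact h
  have hder : HasDerivAt (fun s => z (x, s)) (Real.exp (-(k * t)) *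
      (2 * ∑ i, P i t x * deriv (fun s => P i s x) t - k * e t x)) t := by
    have h1 : HasDerivAt (fun s => e s x) (2 * ∑ i, P i t x * deriv (fun s => P i s x) t) t := by
      rw [he, Finset.mul_sum]
      refine HasDerivAt.fun_sum fun i _ => ?_
      have := (htime t htpos x i).hasDerivAt.pow 2
      exact this.congr_deriv (by simp; ring)
    have h2 : HasDerivAt (fun s => Real.exp (-(k * s))) (Real.exp (-(k * t)) * -k) t := by
      have := ((hasDerivAt_id t).const_mul k).neg.exp
      exact this.congr_deriv (by simp)
    refine (h2.mul h1).congr_deriv ?_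
    ring
  have h1 : 0 ≤ 2 * ∑ i, P i t x * deriv (fun s => P i s x) t - k * e t x := by
    have := deriv_nonneg_of_left_max htpos hder
      (fun s hs hst => hglobal x s hs.le (hst.le.trans ht.2))
    exact nonneg_of_mul_nonneg_right this (Real.exp_pos _)
  -- With the coefficients frozen at the maximum point, y ↦ ∑ P_i(x) P_i(y) is at most the mean of
  -- the energies at x and y, so it too is maximal at y = x. No Laplacian of a square has to be
  -- computed.
  have h2 : ∑ i, P i t x * Laplacian.laplacian (P i t) x ≤ 0 := by
    rw [← laplacian_sum_const_mul _ (fun i => P i t x) (fun i => P i t)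
      (fun i => hspace t htpos x i)]
    have hemax : ∀ y, e t y ≤ e t x := fun y =>
      le_of_mul_le_mul_left (hglobal y t ht.1 ht.2) (Real.exp_pos _)
    have hPc : ∀ i, Continuous (P i t) := fun i =>
      continuous_iff_continuousAt.2 fun y => (hspace t htpos y i).continuousAt
    have hPb : ∀ i y, |P i t y| ≤ M := fun i y => by
      have := hdecay t ht.1 ht.2 y i
      nlinarith [norm_nonneg y, abs_nonneg (P i t y)]
    have hsum : Continuous fun y => ∑ i, P i t x * P i t y :=
      continuous_finsetSum _ fun i _ => continuous_const.mul (hPc i)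
    refine laplacian_nonpos_of_le (u := fun y => ∑ i, P i t x * P i t y)
      (C := ∑ i, |P i t x| * M) hsum (fun y => ?_)
      (ContDiffAt.sum fun i _ => contDiffAt_const.mul (hspace t htpos x i)) fun y => ?_
    · refine (Finset.abs_sum_le_sum_abs _ _).trans (Finset.sum_le_sum fun i _ => ?_)
      rw [abs_mul]
      exact mul_le_mul_of_nonneg_left (hPb i y) (abs_nonneg _)
    · have h3 : ∑ i, P i t x * P i t y ≤ ∑ i, (P i t x ^ 2 + P i t y ^ 2) / 2 :=
        Finset.sum_le_sum fun i _ => by nlinarith [sq_nonneg (P i t x - P i t y)]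
      rw [← Finset.sum_div, Finset.sum_add_distrib] at h3
      have h4 : ∑ i, P i t x * P i t x = e t x := Finset.sum_congr rfl fun i _ => by ring
      have h5 : e t y ≤ e t x := hemax y
      simp only [h4]
      change _ ≤ (e t x + e t y) / 2 at h3
      linarith
  have h3 := hineq t htpos ht.2 x
  simp only [mul_sub, Finset.sum_sub_distrib] at h3
  have h4 : 0 < e t x := pos_of_mul_pos_right hzpos (Real.exp_pos _).le
  change _ ≤ C * e t x at h3
  nlinarith

/-! ### Uniqueness of decomposed solutions and of their coefficient. -/

lemma trace_mul_self_eq_sum {A : Mat} (hA : A.IsSymm) :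
    (A * A).trace = ∑ i, ∑ j, A i j ^ 2 := by
  simp only [Matrix.trace, Matrix.diag_apply, Matrix.mul_apply]
  refine Finset.sum_congr rfl fun i _ => Finset.sum_congr rfl fun j _ => ?_
  rw [hA.apply i j, sq]

lemma abs_apply_le_frob {A : Mat} (hA : A.IsSymm) (i j : Fin 3) : |A i j| ≤ frob A := by
  unfold frob
  rw [trace_mul_self_eq_sum hA]
  apply Real.abs_le_sqrt
  exact (Finset.single_le_sum (f := fun j => A i j ^ 2) (fun j _ => sq_nonneg _)
    (Finset.mem_univ j)).trans (Finset.single_le_sum (f := fun i => ∑ j, A i j ^ 2)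
      (fun i _ => Finset.sum_nonneg fun j _ => sq_nonneg _) (Finset.mem_univ i))

lemma frob_nonneg (A : Mat) : 0 ≤ frob A := Real.sqrt_nonneg _

lemma continuous_frob : Continuous frob := by
  unfold frob
  exact Real.continuous_sqrt.comp ((continuous_id.matrix_mul continuous_id).matrix_trace)

lemma one_le_weight {δ : ℝ} (hδ : 0 < δ) (x : Space) {t : ℝ} (ht : 0 ≤ t) :
    1 + ‖x‖ ≤ Real.sqrt (t + 1) * weight δ x t := by
  unfold weight
  have hs : 1 ≤ Real.sqrt (t + 1) := by rw [Real.one_le_sqrt]; linarith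
  have h0 : 1 ≤ 1 + ‖x‖ / Real.sqrt (t + 1) := by
    have : 0 ≤ ‖x‖ / Real.sqrt (t + 1) := by positivity
    linarith
  have h1 : 1 + ‖x‖ / Real.sqrt (t + 1) ≤ (1 + ‖x‖ / Real.sqrt (t + 1)) ^ (4 + δ / 2) := by
    calc _ = (1 + ‖x‖ / Real.sqrt (t + 1)) ^ (1 : ℝ) := (Real.rpow_one _).symm
      _ ≤ _ := Real.rpow_le_rpow_of_exponent_le h0 (by linarith)
  have h2 : 1 ≤ (t + 1) ^ 2 := by nlinarith
  have h3 : 1 + ‖x‖ ≤ Real.sqrt (t + 1) * (1 + ‖x‖ / Real.sqrt (t + 1)) := by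
    rw [mul_add, mul_div_cancel₀ _ (by positivity)]
    linarith
  calc 1 + ‖x‖ ≤ Real.sqrt (t + 1) * (1 + ‖x‖ / Real.sqrt (t + 1)) := h3
    _ ≤ Real.sqrt (t + 1) * ((1 + ‖x‖ / Real.sqrt (t + 1)) ^ (4 + δ / 2) * 1) := by
        rw [mul_one]; gcongr
    _ ≤ _ := by gcongr

/-- The field `A e^{-at} Φ₁ + e^{-at} V`. -/
def decompositionField (a : ℝ) (A : Mat) (V : ℝ → Space → Mat) (t : ℝ) (x : Space) : Mat :=
  (Real.exp (-a * t) * heatKernel₁ x t) • A + Real.exp (-a * t) • V t x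

section Decomposition

variable {a δ : ℝ} {A : Mat} {V : ℝ → Space → Mat}

lemma isSymm_decompositionField (hA : A ∈ Sym0) (hV : MemX0 δ V) {t : ℝ} (ht : 0 ≤ t)
    (x : Space) : (decompositionField a A V t x).IsSymm :=
  (hA.1.smul _).add ((hV.mem_sym0 t ht x).1.smul _)

lemma continuousOn_heatKernel₁ :
    ContinuousOn (fun p : Space × ℝ => heatKernel₁ p.1 p.2) (univ ×ˢ Ici 0) := by
  intro p hp
  have hp2 : 0 ≤ p.2 := hp.2
  unfold heatKernel₁ heatKernel
  refine ContinuousAt.continuousWithinAt ?_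
  have h1 : 4 * (p.2 + 1) ≠ 0 := by positivity
  have h2 : 4 * Real.pi * (p.2 + 1) ≠ 0 := by positivity
  have h3 : (4 * Real.pi * (p.2 + 1)) ^ (3 / 2 : ℝ) ≠ 0 := by positivity
  exact ContinuousAt.div (ContinuousAt.rexp (ContinuousAt.div (by fun_prop) (by fun_prop) h1))
    (ContinuousAt.rpow (by fun_prop) continuousAt_const (Or.inl h2)) h3

lemma continuousOn_decompositionField (hV : MemX0 δ V) :
    ContinuousOn (fun p : Space × ℝ => decompositionField a A V p.2 p.1) (univ ×ˢ Ici 0) := by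
  have h : ContinuousOn (fun p : Space × ℝ => Real.exp (-a * p.2)) (univ ×ˢ Ici 0) := by fun_prop
  exact ((h.mul continuousOn_heatKernel₁).smul continuousOn_const).add (h.smul hV.continuousOn)

lemma exists_weight_decompositionField_le (ha : 0 < a) (hδ : 0 < δ) (hV : MemX0 δ V) :
    ∃ M, 0 ≤ M ∧ ∀ t, 0 ≤ t → ∀ x i j, weight δ x t * |decompositionField a A V t x i j| ≤ M := by
  obtain ⟨C, hC, hwk⟩ := exists_weight_heatKernel_le hδ ha
  obtain ⟨M, hM⟩ := hV.bounded
  have hM0 : 0 ≤ M := (mul_nonneg (weight_nonneg δ 0) (frob_nonneg _)).trans (hM 0 le_rfl 0)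
  refine ⟨C * (∑ i, ∑ j, |A i j|) + M, by positivity, fun t ht x i j => ?_⟩
  have hW := weight_nonneg δ x (t := t)
  have h1 : |A i j| ≤ ∑ i, ∑ j, |A i j| :=
    (Finset.single_le_sum (f := fun j => |A i j|) (fun j _ => abs_nonneg _)
      (Finset.mem_univ j)).trans (Finset.single_le_sum (f := fun i => ∑ j, |A i j|)
        (fun i _ => Finset.sum_nonneg fun j _ => abs_nonneg _) (Finset.mem_univ i))
  have h2 := (mul_le_mul_of_nonneg_left (abs_apply_le_frob (hV.mem_sym0 t ht x).1 i j) hW).trans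
    (hM t ht x)
  have h3 : Real.exp (-a * t) ≤ 1 := by
    rw [Real.exp_le_one_iff]; nlinarith
  have h4 : Real.exp (a * t) * Real.exp (-a * t) = 1 := by rw [← Real.exp_add]; simp
  have h5 : 0 ≤ heatKernel₁ x t := heatKernel_nonneg x (by linarith)
  have h6 : weight δ x t * heatKernel₁ x t ≤ C * Real.exp (a * t) := hwk x t ht
  have h7 : decompositionField a A V t x i j
      = Real.exp (-a * t) * heatKernel₁ x t * A i j + Real.exp (-a * t) * V t x i j := rfl
  rw [h7]
  calc weight δ x t * |Real.exp (-a * t) * heatKernel₁ x t * A i j + Real.exp (-a * t) * V t x i j|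
      ≤ weight δ x t * (Real.exp (-a * t) * heatKernel₁ x t * |A i j|
        + Real.exp (-a * t) * |V t x i j|) := by
        gcongr
        refine (abs_add_le _ _).trans (le_of_eq ?_)
        rw [abs_mul, abs_mul, abs_mul, abs_of_pos (Real.exp_pos _), abs_of_nonneg h5]
    _ = (weight δ x t * heatKernel₁ x t) * Real.exp (-a * t) * |A i j|
        + Real.exp (-a * t) * (weight δ x t * |V t x i j|) := by ring
    _ ≤ (C * Real.exp (a * t)) * Real.exp (-a * t) * (∑ i, ∑ j, |A i j|) + 1 * M := by
        gcongr
    _ = C * (Real.exp (a * t) * Real.exp (-a * t)) * (∑ i, ∑ j, |A i j|) + M := by ring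
    _ = _ := by rw [h4, mul_one]

/-- A decomposed solution is continuous up to time zero, where it equals its datum. -/
lemma decompositionField_zero {b c : ℝ} {Q₀ : Space → Mat} {Q : ℝ → Space → Mat}
    (hQ₀ : Continuous Q₀) (hsymm : ∀ x, (Q₀ x).IsSymm) (hQ : IsSmoothSolution a b c Q₀ Q)
    (hd : IsDecomposition a δ Q A V) (x : Space) : decompositionField a A V 0 x = Q₀ x := by
  set q := decompositionField a A V with hq
  have hqc : ContinuousOn (fun p : Space × ℝ => q p.2 p.1) (univ ×ˢ Ici 0) :=
    continuousOn_decompositionField hd.remainder_mem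
  have hqx : ∀ t, 0 ≤ t → Continuous (q t) := fun t ht => by
    rw [← continuousOn_univ]
    exact hqc.comp (f := fun y : Space => (y, t)) (by fun_prop) fun y _ => ⟨mem_univ _, ht⟩
  have hQq : ∀ t, 0 < t → Q t = q t := fun t ht => funext fun y => hd.eq t ht y
  set u : ℕ → ℝ := fun n => 1 / ((n : ℝ) + 1) with hu
  have hupos : ∀ n, 0 < u n := fun n => by positivity
  have hu0 : Tendsto u atTop (𝓝[>] 0) :=
    tendsto_nhdsWithin_iff.2 ⟨tendsto_one_div_add_atTop_nhds_zero_nat,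
      Eventually.of_forall hupos⟩
  have hlim : Tendsto (fun n => eLpNorm (fun y => frob (q (u n) y - Q₀ y)) 2 volume) atTop
      (𝓝 0) := by
    refine tendsto_of_tendsto_of_tendsto_of_le_of_le tendsto_const_nhds (hQ.initial_H.comp hu0)
      (fun _ => zero_le) fun n => ?_
    simp only [Function.comp]
    rw [hQq _ (hupos n)]
    exact le_max_left _ _
  -- A subsequence of times tends to the datum almost everywhere, while continuity up to t = 0
  -- identifies the limit as the field at time zero. Two continuous functions equal almost
  -- everywhere are equal.
  have hmeas := tendstoInMeasure_of_tendsto_eLpNorm (μ := (volume : Measure Space)) (p := 2)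
    (f := fun n y => frob (q (u n) y - Q₀ y)) (g := fun _ => (0 : ℝ)) (l := atTop) two_ne_zero
    (fun n => (continuous_frob.comp ((hqx _ (hupos n).le).sub hQ₀)).aestronglyMeasurable)
    aestronglyMeasurable_const (by simpa [Pi.sub_def] using hlim)
  obtain ⟨ns, hns, hae⟩ := hmeas.exists_seq_tendsto_ae
  have hzero : (fun y => frob (q 0 y - Q₀ y)) =ᵐ[volume] fun _ => 0 := by
    filter_upwards [hae] with y hy
    refine tendsto_nhds_unique ?_ hy
    have h1 : ContinuousOn (fun t => q t y) (Ici 0) :=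
      hqc.comp (f := fun t : ℝ => (y, t)) (by fun_prop) fun t ht => ⟨mem_univ _, ht⟩
    have h2 : Tendsto (fun n => u (ns n)) atTop (𝓝[Ici 0] 0) :=
      ((hu0.comp hns.tendsto_atTop)).mono_right (nhdsWithin_mono _ Ioi_subset_Ici_self)
    have h3 := (h1 0 self_mem_Ici).tendsto.comp h2
    exact (continuous_frob.tendsto _).comp (h3.sub_const (Q₀ y))
  have h4 := (Continuous.ae_eq_iff_eq volume
    (continuous_frob.comp ((hqx 0 le_rfl).sub hQ₀)) continuous_const).1 hzero
  have h5 : frob (q 0 x - Q₀ x) = 0 := congrFun h4 x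
  ext i j
  have h6 := abs_apply_le_frob
    ((isSymm_decompositionField (a := a) hd.coeff_mem hd.remainder_mem le_rfl x).sub (hsymm x)) i j
  rw [← hq, h5, abs_nonpos_iff, Matrix.sub_apply, sub_eq_zero] at h6
  exact h6

end Decomposition

/-- The reaction term on matrix entries. -/
def reactionEntries (a b c : ℝ) (q : Fin 3 × Fin 3 → ℝ) : Fin 3 × Fin 3 → ℝ := fun k =>
  reaction a b c (Matrix.of fun i j => q (i, j)) k.1 k.2

lemma contDiff_reactionEntries (a b c : ℝ) : ContDiff ℝ 1 (reactionEntries a b c) := by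
  rw [contDiff_pi]
  intro k
  simp only [reactionEntries, reaction, Matrix.add_apply, Matrix.sub_apply, Matrix.neg_apply,
    Matrix.smul_apply, Matrix.mul_apply, Matrix.trace, Matrix.diag_apply, Matrix.of_apply,
    smul_eq_mul]
  fun_prop

lemma exists_reactionEntries_sub_le (a b c K : ℝ) : ∃ L, 0 ≤ L ∧ ∀ p q : Fin 3 × Fin 3 → ℝ,
    ‖p‖ ≤ K → ‖q‖ ≤ K → ‖reactionEntries a b c p - reactionEntries a b c q‖ ≤ L * ‖p - q‖ := by
  have h := contDiff_reactionEntries a b c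
  obtain ⟨L, hL⟩ := (isCompact_closedBall (0 : Fin 3 × Fin 3 → ℝ) K).exists_bound_of_continuousOn
    (h.continuous_fderiv one_ne_zero).continuousOn
  refine ⟨max L 0, le_max_right _ _, fun p q hp hq => ?_⟩
  exact (convex_closedBall (0 : Fin 3 × Fin 3 → ℝ) K).norm_image_sub_le_of_norm_fderiv_le
    (fun x _ => (h.differentiable one_ne_zero) x) (fun x hx => (hL x hx).trans (le_max_left _ _))
    (by simpa using hq) (by simpa using hp)

/-- Decomposed smooth solutions are determined by their datum. -/
lemma decompositionField_unique {a b c δ : ℝ} (ha : 0 < a) (hδ : 0 < δ) {Q₀ : Space → Mat}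
    (hQ₀ : Continuous Q₀) (hsymm : ∀ x, (Q₀ x).IsSymm)
    {Q Q' : ℝ → Space → Mat} {A A' : Mat} {V V' : ℝ → Space → Mat}
    (hQ : IsSmoothSolution a b c Q₀ Q) (hd : IsDecomposition a δ Q A V)
    (hQ' : IsSmoothSolution a b c Q₀ Q') (hd' : IsDecomposition a δ Q' A' V')
    {t : ℝ} (ht : 0 ≤ t) (x : Space) :
    decompositionField a A V t x = decompositionField a A' V' t x := by
  set q := decompositionField a A V with hq
  set q' := decompositionField a A' V' with hq'
  obtain ⟨M, hM0, hM⟩ := exists_weight_decompositionField_le (A := A) ha hδ hd.remainder_mem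
  obtain ⟨M', hM0', hM'⟩ := exists_weight_decompositionField_le (A := A') ha hδ hd'.remainder_mem
  set S := Real.sqrt (t + 1) with hS
  have hbd : ∀ (N : ℝ) (r : ℝ → Space → Mat), 0 ≤ N → (∀ s, 0 ≤ s → ∀ y i j,
      weight δ y s * |r s y i j| ≤ N) → ∀ s, 0 ≤ s → s ≤ t → ∀ y i j,
      (1 + ‖y‖) * |r s y i j| ≤ S * N := by
    intro N r hN h s hs hst y i j
    have h1 := one_le_weight hδ y hs
    have h2 : Real.sqrt (s + 1) ≤ S := Real.sqrt_le_sqrt (by linarith)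
    calc (1 + ‖y‖) * |r s y i j| ≤ Real.sqrt (s + 1) * weight δ y s * |r s y i j| := by gcongr
      _ = Real.sqrt (s + 1) * (weight δ y s * |r s y i j|) := by ring
      _ ≤ S * N := by
          have := h s hs y i j
          have := mul_nonneg (weight_nonneg δ y (t := s)) (abs_nonneg (r s y i j))
          gcongr
  have hb := hbd M q hM0 hM
  have hb' := hbd M' q' hM0' hM'
  obtain ⟨L, hL0, hL⟩ := exists_reactionEntries_sub_le a b c (max (S * M) (S * M'))
  set P : Fin 3 × Fin 3 → ℝ → Space → ℝ := fun k s y => q s y k.1 k.2 - q' s y k.1 k.2 with hP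
  have hqQ : ∀ s, 0 < s → ∀ y, q s y = Q s y := fun s hs y => (hd.eq s hs y).symm
  have hqQ' : ∀ s, 0 < s → ∀ y, q' s y = Q' s y := fun s hs y => (hd'.eq s hs y).symm
  have hsm : ∀ (R : ℝ → Space → Mat), IsSmoothSolution a b c Q₀ R → ∀ s, 0 < s → ∀ y i j,
      ContDiffAt ℝ ∞ (fun p : Space × ℝ => R p.2 p.1 i j) (y, s) := fun R hR s hs y i j =>
    (hR.smooth i j).contDiffAt ((isOpen_univ.prod isOpen_Ioi).mem_nhds ⟨mem_univ _, hs⟩)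
  have hspace : ∀ (R : ℝ → Space → Mat), IsSmoothSolution a b c Q₀ R → ∀ s, 0 < s → ∀ y i j,
      ContDiffAt ℝ 2 (fun z => R s z i j) y := by
    intro R hR s hs y i j
    have h1 : ContDiffAt ℝ ∞ (fun z : Space => ((z, s) : Space × ℝ)) y :=
      contDiffAt_id.prodMk contDiffAt_const
    exact (ContDiffAt.comp y (g := fun p : Space × ℝ => R p.2 p.1 i j) (hsm R hR s hs y i j)
      h1).of_le (mod_cast le_top : ((2 : ℕ∞) : WithTop ℕ∞) ≤ (⊤ : ℕ∞))
  have htime : ∀ (R : ℝ → Space → Mat), IsSmoothSolution a b c Q₀ R → ∀ s, 0 < s → ∀ y i j,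
      DifferentiableAt ℝ (fun r => R r y i j) s := by
    intro R hR s hs y i j
    have h1 : ContDiffAt ℝ ∞ (fun r : ℝ => ((y, r) : Space × ℝ)) s :=
      contDiffAt_const.prodMk contDiffAt_id
    exact (ContDiffAt.comp s (g := fun p : Space × ℝ => R p.2 p.1 i j) (hsm R hR s hs y i j)
      h1).differentiableAt (by simp)
  have hPs : ∀ s, 0 < s → ∀ k, P k s = fun y => Q s y k.1 k.2 - Q' s y k.1 k.2 := by
    intro s hs k
    funext y
    simp only [hP]
    rw [hqQ s hs, hqQ' s hs]
  have hPt : ∀ s, 0 < s → ∀ k y,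
      (fun r => P k r y) =ᶠ[𝓝 s] fun r => Q r y k.1 k.2 - Q' r y k.1 k.2 := by
    intro s hs k y
    filter_upwards [Ioi_mem_nhds hs] with r hr
    rw [hPs r hr]
  -- Each of the nine entries contributes at most L times the squared sup norm of the difference,
  -- which is bounded by the sum of squares.
  have key := eq_zero_of_energy_inequality (P := P) (T := t) (C := 9 * L)
    (M := S * M + S * M') (by positivity) ?_ ?_ ?_ ?_ ?_ ?_
  · ext i j
    exact sub_eq_zero.1 (key t ht le_rfl x (i, j))
  · intro k
    have h1 := continuousOn_decompositionField (a := a) (A := A) hd.remainder_mem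
    have h2 := continuousOn_decompositionField (a := a) (A := A') hd'.remainder_mem
    have h3 : Continuous fun B : Mat => B k.1 k.2 := continuous_id.matrix_elem _ _
    exact (h3.comp_continuousOn h1).sub (h3.comp_continuousOn h2)
  · intro s hs hst y k
    calc (1 + ‖y‖) * |P k s y| ≤ (1 + ‖y‖) * (|q s y k.1 k.2| + |q' s y k.1 k.2|) := by
          gcongr; exact abs_sub _ _
      _ ≤ _ := by
          rw [mul_add]
          exact add_le_add (hb s hs hst y k.1 k.2) (hb' s hs hst y k.1 k.2)
  · intro y k
    simp only [hP]
    rw [hq, hq', decompositionField_zero hQ₀ hsymm hQ hd, decompositionField_zero hQ₀ hsymm hQ' hd',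
      sub_self]
  · intro s hs y k
    rw [hPs s hs]
    exact (hspace Q hQ s hs y _ _).sub (hspace Q' hQ' s hs y _ _)
  · intro s hs y k
    exact ((htime Q hQ s hs y _ _).sub (htime Q' hQ' s hs y _ _)).congr_of_eventuallyEq
      (hPt s hs k y)
  · intro s hs hst y
    set p : Fin 3 × Fin 3 → ℝ := fun k => Q s y k.1 k.2 with hp
    set p' : Fin 3 × Fin 3 → ℝ := fun k => Q' s y k.1 k.2 with hp'
    have hdiff : ∀ k, deriv (fun r => P k r y) s - Laplacian.laplacian (P k s) y
        = reactionEntries a b c p k - reactionEntries a b c p' k := by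
      intro k
      rw [(hPt s hs k y).deriv_eq, hPs s hs,
        deriv_fun_sub (htime Q hQ s hs y _ _) (htime Q' hQ' s hs y _ _)]
      have h1 := (hspace Q hQ s hs y k.1 k.2).laplacian_sub (hspace Q' hQ' s hs y k.1 k.2)
      have h2 : Laplacian.laplacian (fun y => Q s y k.1 k.2 - Q' s y k.1 k.2) y = _ := h1
      rw [h2, hQ.equation s hs, hQ'.equation s hs]
      have e1 : reactionEntries a b c p k = reaction a b c (Q s y) k.1 k.2 := rfl
      have e2 : reactionEntries a b c p' k = reaction a b c (Q' s y) k.1 k.2 := rfl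
      rw [e1, e2]
      ring
    have hle : ∀ (N : ℝ) (B : Mat), (∀ i j, (1 + ‖y‖) * |B i j| ≤ S * N) →
        0 ≤ S * N → ‖fun k : Fin 3 × Fin 3 => B k.1 k.2‖ ≤ S * N := by
      intro N B hB h0
      rw [pi_norm_le_iff_of_nonneg h0]
      intro k
      have := hB k.1 k.2
      rw [Real.norm_eq_abs]
      nlinarith [norm_nonneg y, abs_nonneg (B k.1 k.2)]
    have hS0 : 0 ≤ S := Real.sqrt_nonneg _
    have n1 : ‖p‖ ≤ max (S * M) (S * M') := (hle M (Q s y) (fun i j => by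
      rw [← hqQ s hs]; exact hb s hs.le hst y i j) (by positivity)).trans (le_max_left _ _)
    have n2 : ‖p'‖ ≤ max (S * M) (S * M') := (hle M' (Q' s y) (fun i j => by
      rw [← hqQ' s hs]; exact hb' s hs.le hst y i j) (by positivity)).trans (le_max_right _ _)
    have h3 := hL p p' n1 n2
    have hPk : ∀ k, P k s y = (p - p') k := fun k => by rw [hPs s hs]; rfl
    have h4 : ‖p - p'‖ ^ 2 ≤ ∑ k, P k s y ^ 2 := by
      obtain ⟨k, hk⟩ : ∃ k, ‖p - p'‖ = ‖(p - p') k‖ := by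
        obtain ⟨k, -, hk⟩ := Finset.exists_mem_eq_sup' (s := Finset.univ) Finset.univ_nonempty
          (fun k => ‖(p - p') k‖₊)
        refine ⟨k, ?_⟩
        rw [← coe_nnnorm, ← coe_nnnorm, Pi.nnnorm_def, ← hk, Finset.sup'_eq_sup]
      rw [hk, Real.norm_eq_abs, sq_abs, ← hPk]
      exact Finset.single_le_sum (f := fun k => P k s y ^ 2) (fun k _ => sq_nonneg _)
        (Finset.mem_univ k)
    have h5 : ∀ k, P k s y * (deriv (fun r => P k r y) s - Laplacian.laplacian (P k s) y)
        ≤ L * ‖p - p'‖ ^ 2 := by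
      intro k
      rw [hdiff, hPk]
      have h6 : |(p - p') k| ≤ ‖p - p'‖ := norm_le_pi_norm (p - p') k
      have h7 : |reactionEntries a b c p k - reactionEntries a b c p' k| ≤ L * ‖p - p'‖ :=
        (norm_le_pi_norm (reactionEntries a b c p - reactionEntries a b c p') k).trans h3
      calc _ ≤ |(p - p') k| * |reactionEntries a b c p k - reactionEntries a b c p' k| := by
            rw [← abs_mul]; exact le_abs_self _
        _ ≤ ‖p - p'‖ * (L * ‖p - p'‖) := by gcongr
        _ = _ := by ring
    calc _ ≤ ∑ _k : Fin 3 × Fin 3, L * ‖p - p'‖ ^ 2 := Finset.sum_le_sum fun k _ => h5 k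
      _ = 9 * L * ‖p - p'‖ ^ 2 := by simp; ring
      _ ≤ _ := by gcongr

/-- The leading coefficient is determined by the field. -/
lemma coeff_unique {a δ : ℝ} {A A' : Mat} {V V' : ℝ → Space → Mat}
    (hV : MemX0 δ V) (hV' : MemX0 δ V')
    (h : ∀ t, 0 ≤ t → decompositionField a A V t 0 = decompositionField a A' V' t 0) :
    A = A' := by
  obtain ⟨M, hM⟩ := hV.bounded
  obtain ⟨M', hM'⟩ := hV'.bounded
  have hbd : ∀ (N : ℝ) (U : ℝ → Space → Mat), MemX0 δ U →
      (∀ t, 0 ≤ t → ∀ x, weight δ x t * frob (U t x) ≤ N) → ∀ t, 0 ≤ t → ∀ i j,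
      (t + 1) ^ 2 * |U t 0 i j| ≤ N := by
    intro N U hU hN t ht i j
    have h1 := hN t ht 0
    have h2 : weight δ 0 t = (t + 1) ^ 2 := by simp [weight]
    rw [h2] at h1
    refine le_trans ?_ h1
    gcongr
    exact abs_apply_le_frob (hU.mem_sym0 t ht 0).1 i j
  ext i j
  by_contra hne
  set d := |A i j - A' i j| with hd
  have hd0 : 0 < d := abs_pos.2 (sub_ne_zero.2 hne)
  set P := (4 * Real.pi) ^ (3 / 2 : ℝ) with hP
  have hP0 : 0 < P := by positivity
  -- At the origin the kernel is of order (t + 1)^{-3/2} and the remainders O((t + 1)^{-2}). A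
  -- discrepancy d > 0 between the coefficients would therefore keep √(t + 1) bounded.
  have hkey : ∀ t, 0 ≤ t → (t + 1) ^ (1 / 2 : ℝ) ≤ (M + M') * P / d := by
    intro t ht
    have h1 := congrFun (congrFun (h t ht) i) j
    have h2 : Real.exp (-a * t) * heatKernel₁ 0 t * A i j + Real.exp (-a * t) * V t 0 i j
      = Real.exp (-a * t) * heatKernel₁ 0 t * A' i j + Real.exp (-a * t) * V' t 0 i j := h1
    have h3 : heatKernel₁ 0 t * (A i j - A' i j) = V' t 0 i j - V t 0 i j := by
      have := (Real.exp_pos (-a * t)).ne'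
      apply mul_left_cancel₀ this
      linarith
    have ht1 : 0 < t + 1 := by linarith
    have h4 : heatKernel₁ 0 t = 1 / (P * (t + 1) ^ (3 / 2 : ℝ)) := by
      unfold heatKernel₁ heatKernel
      rw [Real.mul_rpow (by positivity) ht1.le]
      simp [hP]
    have h5 : heatKernel₁ 0 t * d = |V' t 0 i j - V t 0 i j| := by
      rw [← h3, abs_mul, abs_of_pos (by rw [h4]; positivity)]
    have h6 : (t + 1) ^ 2 * (heatKernel₁ 0 t * d) ≤ M + M' := by
      rw [h5]
      have := hbd M V hV hM t ht i j
      have := hbd M' V' hV' hM' t ht i j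
      have h7 : |V' t 0 i j - V t 0 i j| ≤ |V' t 0 i j| + |V t 0 i j| := abs_sub _ _
      nlinarith [sq_nonneg (t + 1)]
    have h8 : (t + 1) ^ 2 = (t + 1) ^ (1 / 2 : ℝ) * (t + 1) ^ (3 / 2 : ℝ) := by
      rw [← Real.rpow_add ht1, ← Real.rpow_natCast]; norm_num
    rw [h4, h8] at h6
    rw [le_div_iff₀ hd0]
    have h9 : (t + 1) ^ (1 / 2 : ℝ) * (t + 1) ^ (3 / 2 : ℝ) *
        (1 / (P * (t + 1) ^ (3 / 2 : ℝ)) * d) = (t + 1) ^ (1 / 2 : ℝ) * d / P := by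
      have : (t + 1) ^ (3 / 2 : ℝ) ≠ 0 := by positivity
      field_simp
    rw [h9, div_le_iff₀ hP0] at h6
    exact h6
  set Z := (M + M') * P / d with hZ
  have h1 := hkey (Z ^ 2) (sq_nonneg _)
  rw [← Real.sqrt_eq_rpow] at h1
  have h2 : |Z| < Real.sqrt (Z ^ 2 + 1) := by
    rw [← Real.sqrt_sq_eq_abs]
    exact Real.sqrt_lt_sqrt (sq_nonneg _) (by linarith)
  linarith [le_abs_self Z]

/-! ### The invariant uniaxial direction. -/

/-- The axisymmetric direction `diag(1, 1, -2)`. -/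
def axial : Mat := Matrix.diagonal ![1, 1, -2]

lemma axial_mem : axial ∈ Sym0 := by
  refine ⟨Matrix.isSymm_diagonal _, ?_⟩
  simp [axial, Matrix.trace_diagonal, Fin.sum_univ_three]
  norm_num

/-- This identity makes the traceless part of `axial`² equal to -`axial`. The reaction thus
preserves the line, and the quadratic term points along -`axial`, the direction of the datum. -/
lemma axial_mul_self : axial * axial = (2 : ℝ) • (1 : Mat) - axial := by
  rw [axial, Matrix.diagonal_mul_diagonal]
  ext i j
  fin_cases i <;> fin_cases j <;> simp [Matrix.diagonal] <;> norm_num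

lemma trace_axial_mul_self : (axial * axial).trace = 6 := by
  rw [axial_mul_self, Matrix.trace_sub, axial_mem.2, Matrix.trace_smul, Matrix.trace_one]
  norm_num

lemma smul_axial_mem (r : ℝ) : r • axial ∈ Sym0 :=
  ⟨axial_mem.1.smul r, by rw [Matrix.trace_smul, axial_mem.2, smul_zero]⟩

lemma smul_axial_ne_zero {r : ℝ} (hr : r ≠ 0) : r • axial ≠ 0 := fun h => by
  have := congrFun (congrFun h 0) 0
  simp [axial, hr] at this

lemma frob_smul_axial (r : ℝ) : frob (r • axial) = Real.sqrt 6 * |r| := by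
  unfold frob
  rw [Matrix.smul_mul, Matrix.mul_smul, Matrix.trace_smul, Matrix.trace_smul,
    trace_axial_mul_self, smul_eq_mul, smul_eq_mul, ← mul_assoc, mul_comm (r * r),
    Real.sqrt_mul (by norm_num), Real.sqrt_mul_self_eq_abs]

lemma reaction_smul_axial (a b c r : ℝ) :
    reaction a b c (r • axial) = (-(a * r) - b * r ^ 2 - 6 * c * r ^ 3) • axial := by
  unfold reaction
  rw [Matrix.smul_mul, Matrix.mul_smul, Matrix.trace_smul, Matrix.trace_smul,
    trace_axial_mul_self, axial_mul_self]
  module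

lemma uniaxialDatum_eq (δ α : ℝ) (x : Space) :
    uniaxialDatum δ α x = (lam δ α x) • axial := by
  unfold uniaxialDatum axial
  rw [← Matrix.diagonal_smul]
  congr 1
  ext i
  fin_cases i <;> simp [mul_comm]

lemma continuous_lam {δ : ℝ} (hδ : 0 < δ) (α : ℝ) : Continuous (lam δ α) := by
  unfold lam
  have h : Continuous fun x : Space => (1 + ‖x‖) ^ (8 + δ) :=
    (by fun_prop : Continuous fun x : Space => 1 + ‖x‖).rpow_const
      fun p => Or.inr (by linarith)
  exact (continuous_const.div h fun x => by positivity).neg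

lemma continuous_uniaxialDatum {δ : ℝ} (hδ : 0 < δ) (α : ℝ) :
    Continuous (uniaxialDatum δ α) := by
  have : uniaxialDatum δ α = fun x => lam δ α x • axial := funext (uniaxialDatum_eq δ α)
  rw [this]
  exact (continuous_lam hδ α).smul continuous_const

/-- The weight cancels the profile exactly, so the weighted Frobenius norm equals √6 α at every
point. -/
lemma uniaxialDatum_mem_smallData {δ η α : ℝ} (hδ : 0 < δ) (hη : 0 < η) (hα : 0 < α)
    (h : Real.sqrt 6 * α < η) : uniaxialDatum δ α ∈ smallData δ η := by
  have he : uniaxialDatum δ α = fun x => lam δ α x • axial := funext (uniaxialDatum_eq δ α)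
  refine ⟨?_, Eventually.of_forall fun x => ?_, ?_⟩
  · rw [he]
    exact (continuous_lam hδ α).aestronglyMeasurable.smul_const axial
  · rw [he]; exact smul_axial_mem _
  · refine (essSup_le_of_ae_le (ENNReal.ofReal (Real.sqrt 6 * α))
      (Eventually.of_forall fun x => ?_)).trans_lt ((ENNReal.ofReal_lt_ofReal_iff hη).2 h)
    rw [he]
    apply ENNReal.ofReal_le_ofReal
    rw [frob_smul_axial, lam, abs_neg, abs_of_pos (by positivity)]
    have : (1 + ‖x‖) ^ (8 + δ) ≠ 0 := by positivity
    field_simp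
    exact le_rfl

/-! ### Assembling the tensor-valued solution and its decomposition. -/

lemma tendsto_eLpNorm_zero_of_dominated {p : ℝ≥0∞} (hp0 : p ≠ 0) (hpt : p ≠ ⊤)
    {F : ℝ → Space → ℝ} {G : Space → ℝ} {t : ℝ} (hG : MemLp G p volume)
    (hm : ∀ s, Continuous (F s)) (hb : ∀ s x, |F s x| ≤ |G x|)
    (hlim : ∀ x, Tendsto (fun s => F s x) (𝓝 t) (𝓝 0)) :
    Tendsto (fun s => eLpNorm (F s) p volume) (𝓝 t) (𝓝 0) := by
  have hpos : 0 < p.toReal := ENNReal.toReal_pos hp0 hpt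
  simp_rw [eLpNorm_eq_lintegral_rpow_enorm_toReal hp0 hpt]
  have h1 : Tendsto (fun s => ∫⁻ x, ‖F s x‖ₑ ^ p.toReal) (𝓝 t) (𝓝 (∫⁻ _ : Space, 0)) := by
    refine tendsto_lintegral_filter_of_dominated_convergence (fun x => ‖G x‖ₑ ^ p.toReal)
      (Eventually.of_forall fun s => (hm s).measurable.enorm.pow_const _)
      (Eventually.of_forall fun s => Eventually.of_forall fun x => ?_)
      (lintegral_rpow_enorm_lt_top_of_eLpNorm_lt_top hp0 hpt hG.2).ne
      (Eventually.of_forall fun x => ?_)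
    · refine ENNReal.rpow_le_rpow ?_ hpos.le
      rw [← ofReal_norm, ← ofReal_norm]
      exact ENNReal.ofReal_le_ofReal (hb s x)
    · have := ((hlim x).enorm).ennrpow_const p.toReal
      simpa [ENNReal.zero_rpow_of_pos hpos] using this
  rw [lintegral_zero] at h1
  have h2 := h1.ennrpow_const (1 / p.toReal)
  rwa [ENNReal.zero_rpow_of_pos (by positivity)] at h2

lemma memLp_inv_one_add_norm_rpow {q : ℝ} (hq : 3 < q) {p : ℝ≥0∞} (hp : 1 ≤ p) (hpt : p ≠ ⊤) :
    MemLp (fun y : Space => 1 / (1 + ‖y‖) ^ q) p volume := by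
  have hp0 : p ≠ 0 := (zero_lt_one.trans_le hp).ne'
  have hp1 : 1 ≤ p.toReal := by
    rw [← ENNReal.toReal_one]
    exact (ENNReal.toReal_le_toReal ENNReal.one_ne_top hpt).2 hp
  refine (integrable_norm_rpow_iff
    (integrable_inv_one_add_norm_rpow hq).aestronglyMeasurable hp0 hpt).1 ?_
  refine (integrable_inv_one_add_norm_rpow (p := q * p.toReal) (by nlinarith)).congr
    (Eventually.of_forall fun y => ?_)
  simp only
  rw [Real.norm_of_nonneg (by positivity), Real.div_rpow (by positivity) (by positivity),
    Real.one_rpow, ← Real.rpow_mul (by positivity)]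

section Solution

variable {a b c δ α K R : ℝ} {w : ScalarField}

lemma apply_zero_of_mild (ha : 0 < a) (hδ : 0 < δ)
    (hw : w = dataOp ha (1, 0) (datumField δ α) + duhamelOp ha (1, 0) (nonlin b c w)) (x : Space) :
    w (x, 0) = -lam δ α x := by
  rw [hw, BF.add_apply, dataOp_apply ha (one_zero_mem_admissible ha) _ _ le_rfl,
    duhamelOp_eq_intervalIntegral ha _ _ le_rfl, intervalIntegral.integral_same]
  simp [heat_zero, datumField_apply hδ, lam, div_eq_mul_inv]

lemma continuous_slice (w : ScalarField) (t : ℝ) : Continuous fun x : Space => w (x, t) :=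
  w.continuous.comp (by fun_prop)

lemma abs_apply_le_of_decayBound (ha : 0 < a) (hK : 0 ≤ K) (hdec : DecayBound a δ K w) (x : Space)
    (t : ℝ) : |w (x, t)| ≤ K * (1 / (1 + ‖x‖) ^ (8 + δ)) := by
  have h := hdec x t
  rw [abs_of_nonneg h.1]
  refine h.2.trans ?_
  have h1 : Real.exp (-(3 / 4 * a) * max t 0) ≤ 1 := by
    rw [Real.exp_le_one_iff]
    have := mul_nonneg ha.le (le_max_right t 0)
    linarith
  calc _ ≤ K * 1 * (1 / (1 + ‖x‖) ^ (8 + δ)) := by gcongr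
    _ = _ := by ring

lemma frob_neg_smul_sub (r s : ℝ) :
    frob ((-r) • axial - (-s) • axial) = Real.sqrt 6 * |r - s| := by
  rw [← sub_smul, frob_smul_axial]
  congr 1
  rw [show -r - -s = -(r - s) by ring, abs_neg]

lemma memLp_slice (ha : 0 < a) (hδ : 0 < δ) (hK : 0 ≤ K) (hdec : DecayBound a δ K w)
    {p : ℝ≥0∞} (hp : 1 ≤ p) (hpt : p ≠ ⊤) (t : ℝ) :
    MemLp (fun x : Space => frob ((-(w (x, t))) • axial)) p volume := by
  have hφ := (memLp_inv_one_add_norm_rpow (q := 8 + δ) (by linarith) hp hpt).const_mul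
    (Real.sqrt 6 * K)
  refine hφ.of_le (continuous_frob.comp
    ((continuous_slice w t).neg.smul continuous_const)).aestronglyMeasurable
    (Eventually.of_forall fun x => ?_)
  rw [frob_smul_axial, abs_neg, Real.norm_of_nonneg (by positivity),
    Real.norm_of_nonneg (by positivity), mul_assoc]
  gcongr
  exact abs_apply_le_of_decayBound ha hK hdec x t

lemma tendsto_eLpNorm_slice (ha : 0 < a) (hδ : 0 < δ) (hK : 0 ≤ K) (hdec : DecayBound a δ K w)
    {p : ℝ≥0∞} (hp : 1 ≤ p) (hpt : p ≠ ⊤) (t : ℝ) :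
    Tendsto (fun s => eLpNorm (fun x : Space =>
      frob ((-(w (x, s))) • axial - (-(w (x, t))) • axial)) p volume) (𝓝 t) (𝓝 0) := by
  have hφ := (memLp_inv_one_add_norm_rpow (q := 8 + δ) (by linarith) hp hpt).const_mul
    (Real.sqrt 6 * (2 * K))
  simp only [frob_neg_smul_sub]
  refine tendsto_eLpNorm_zero_of_dominated (zero_lt_one.trans_le hp).ne' hpt hφ
    (fun s => continuous_const.mul ((continuous_slice w s).sub (continuous_slice w t)).abs)
    (fun s x => ?_) (fun x => ?_)
  · change abs (Real.sqrt 6 * |w (x, s) - w (x, t)|)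
      ≤ |Real.sqrt 6 * (2 * K) * (1 / (1 + ‖x‖) ^ (8 + δ))|
    rw [abs_of_nonneg (by positivity : 0 ≤ Real.sqrt 6 * |w (x, s) - w (x, t)|),
      abs_of_nonneg (by positivity : 0 ≤ Real.sqrt 6 * (2 * K) * (1 / (1 + ‖x‖) ^ (8 + δ))),
      mul_assoc]
    have h1 := abs_apply_le_of_decayBound ha hK hdec x s
    have h2 := abs_apply_le_of_decayBound ha hK hdec x t
    have h3 : |w (x, s) - w (x, t)| ≤ |w (x, s)| + |w (x, t)| := abs_sub _ _
    gcongr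
    linarith
  · have hc : Continuous fun s : ℝ => Real.sqrt 6 * |w (x, s) - w (x, t)| :=
      continuous_const.mul ((w.continuous.comp (by fun_prop : Continuous fun s : ℝ =>
        ((x, s) : Space × ℝ))).sub continuous_const).abs
    have := hc.tendsto t
    simpa using this

lemma tendstoH_slice (ha : 0 < a) (hδ : 0 < δ) (hK : 0 ≤ K) (hdec : DecayBound a δ K w) (t : ℝ) :
    TendstoH (fun s x => (-(w (x, s))) • axial) (𝓝 t) (fun x => (-(w (x, t))) • axial) := by
  have h2 := tendsto_eLpNorm_slice ha hδ hK hdec (p := 2) (by norm_num) (by norm_num) t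
  have h6 := tendsto_eLpNorm_slice ha hδ hK hdec (p := 6) (by norm_num) (by norm_num) t
  have := h2.max h6
  rwa [max_self] at this

/-- The axisymmetric field built from a small mild solution is a smooth solution. -/
lemma isSmoothSolution_of_mild (ha : 0 < a) (hb : 0 < b) (hc : 0 < c) (hδ : 0 < δ) (hK : 0 ≤ K)
    (hR : ∀ᶠ θ in 𝓝 ((1, 0) : ℝ × Space),
      ‖duhamelOp ha θ‖ * (2 * b * R + 18 * c * R ^ 2) ≤ 1 / 2)
    (hKR : K < R) (hdec : DecayBound a δ K w)
    (hw : w = dataOp ha (1, 0) (datumField δ α) + duhamelOp ha (1, 0) (nonlin b c w)) :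
    IsSmoothSolution a b c (uniaxialDatum δ α) (fun t x => (-(w (x, t))) • axial) := by
  have hwR : ‖w‖ < R := (norm_le_of_decayBound ha hδ hK hdec).trans_lt hKR
  have hsm : ∀ (x : Space) {t : ℝ}, 0 < t → ContDiffAt ℝ ∞ (fun p : Space × ℝ => w p) (x, t) :=
    fun x t ht => contDiffAt_of_mild ha hb hc hR hwR hw x ht
  refine ⟨fun t _ x => smul_axial_mem _, fun i j => ?_, fun t ht x i j => ?_, fun t _ => ?_,
    fun t _ => ?_, fun t _ => tendstoH_slice ha hδ hK hdec t, ?_⟩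
  · rintro ⟨x, t⟩ ⟨-, ht⟩
    have h := ((hsm x ht).neg.mul (contDiffAt_const (c := axial i j))).contDiffWithinAt
      (s := univ ×ˢ Ioi (0 : ℝ))
    exact h
  · have hspace : ContDiffAt ℝ 2 (fun y : Space => w (y, t)) x := by
      have h1 : ContDiffAt ℝ ∞ (fun y : Space => ((y, t) : Space × ℝ)) x :=
        contDiffAt_id.prodMk contDiffAt_const
      exact (ContDiffAt.comp x (g := fun p : Space × ℝ => w p) (hsm x ht) h1).of_le
        (mod_cast le_top : ((2 : ℕ∞) : WithTop ℕ∞) ≤ (⊤ : ℕ∞))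
    have e1 : (fun s : ℝ => ((-(w (x, s))) • axial) i j) = fun s => -(axial i j) * w (x, s) := by
      funext s; rw [Matrix.smul_apply, smul_eq_mul]; ring
    have e2 : (fun y : Space => ((-(w (y, t))) • axial) i j)
        = (-(axial i j)) • fun y => w (y, t) := by
      funext y; rw [Matrix.smul_apply, smul_eq_mul, Pi.smul_apply, smul_eq_mul]; ring
    rw [e1, e2, deriv_const_mul_field, deriv_eq_of_mild ha hw ht.le (hsm x ht),
      InnerProductSpace.laplacian_smul _ hspace, reaction_smul_axial, nonlin_apply,
      Matrix.smul_apply, smul_eq_mul, smul_eq_mul]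
    ring
  · exact memLp_slice ha hδ hK hdec (by norm_num) (by norm_num) t
  · exact memLp_slice ha hδ hK hdec (by norm_num) (by norm_num) t
  -- The amplitude is continuous on the whole time line, so the limit at 0⁺ is part of a two-sided
  -- limit.
  · have h := tendstoH_slice ha hδ hK hdec 0
    have e : (fun x => (-(w (x, 0))) • axial) = uniaxialDatum δ α := by
      funext x
      rw [uniaxialDatum_eq, apply_zero_of_mild ha hδ hw, neg_neg]
    rw [e] at h
    exact h.mono_left nhdsWithin_le_nhds

/-- The coefficient is -L `axial`, with L the mass of the datum plus the undamped mass injected by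
the nonlinearity. The former is positive and the latter nonnegative because 6cK ≤ b; this sign
argument is why A cannot vanish. -/
lemma exists_decomposition_of_mild (ha : 0 < a) (hb : 0 < b) (hc : 0 < c) (hδ : 0 < δ) (hK : 0 ≤ K)
    (hKb : 6 * c * K ≤ b) (hα : 0 < α) (hdec : DecayBound a δ K w)
    (hw : w = dataOp ha (1, 0) (datumField δ α) + duhamelOp ha (1, 0) (nonlin b c w)) :
    ∃ A V, A ≠ 0 ∧ IsDecomposition a δ (fun t x => (-(w (x, t))) • axial) A V := by
  have hf := decayBound_nonlin ha hb hc hδ hK hKb hdec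
  obtain ⟨M, hM⟩ := exists_weight_remainder_le ha hδ hw hα.le (by positivity : 0 ≤ b * K ^ 2)
    (fun y => by rw [datumField_apply hδ, abs_of_nonneg (by positivity)])
    (fun y s => by rw [abs_of_nonneg (hf y s).1]; exact (hf y s).2)
  set L := (∫ y : Space, datumField δ α (y, 0))
    + ∫ s in Ioi (0 : ℝ), Real.exp (a * s) * ∫ y : Space, nonlin b c w (y, s) with hL
  have hLpos : 0 < L := by
    have h1 : 0 < ∫ y : Space, datumField δ α (y, 0) := by
      have hpos : ∀ y : Space, 0 < datumField δ α (y, 0) := fun y => by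
        rw [datumField_apply hδ]; positivity
      rw [integral_pos_iff_support_of_nonneg (fun y => (hpos y).le)]
      · have : Function.support (fun y : Space => datumField δ α (y, 0)) = univ :=
          eq_univ_of_forall fun y => (hpos y).ne'
        rw [this]
        exact isOpen_univ.measure_pos volume univ_nonempty
      · simp only [datumField_apply hδ]
        exact (integrable_inv_one_add_norm_rpow (by linarith)).const_mul α
    have h2 : 0 ≤ ∫ s in Ioi (0 : ℝ), Real.exp (a * s) * ∫ y : Space, nonlin b c w (y, s) :=
      integral_nonneg fun s => mul_nonneg (Real.exp_pos _).le
        (integral_nonneg fun y => (hf y s).1)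
    linarith
  refine ⟨(-L) • axial, fun t x => (-(Real.exp (a * t) * w (x, t) - L * heatKernel₁ x t)) • axial,
    smul_axial_ne_zero (neg_ne_zero.2 hLpos.ne'), smul_axial_mem _,
    ⟨fun t _ x => smul_axial_mem _, ?_, Real.sqrt 6 * M, fun t ht x => ?_⟩, fun t _ x => ?_⟩
  · have h1 : ContinuousOn (fun p : Space × ℝ => Real.exp (a * p.2) * w p) (univ ×ˢ Ici 0) :=
      (Continuous.mul (by fun_prop) w.continuous).continuousOn
    exact (h1.sub (continuousOn_const.mul continuousOn_heatKernel₁)).neg.smul continuousOn_const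
  · rw [frob_smul_axial, abs_neg]
    calc _ = Real.sqrt 6 * (weight δ x t * |Real.exp (a * t) * w (x, t)
          - L * heatKernel x (t + 1)|) := by rw [heatKernel₁]; ring
      _ ≤ _ := by gcongr; exact hM t ht x
  · have h : Real.exp (-a * t) * Real.exp (a * t) = 1 := by rw [← Real.exp_add]; simp
    rw [smul_smul, smul_smul, ← add_smul]
    congr 1
    calc -(w (x, t)) = -(Real.exp (-a * t) * Real.exp (a * t)) * w (x, t) := by rw [h]; ring
      _ = _ := by ring

end Solution

end QTensor

end

theorem proposition4p3 (δ : ℝ) (hδ : 0 < δ) (a b c : ℝ) (habc : (a, b, c) ∈ QTensor.bistable)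
    (η : ℝ) (hη : 0 < η) :
    ∃ α₀ : ℝ, 0 < α₀ ∧ ∀ α : ℝ, 0 < α → α < α₀ →
      QTensor.uniaxialDatum δ α ∈ QTensor.smallData δ η ∧
      (∃ (Q : ℝ → QTensor.Space → QTensor.Mat) (A : QTensor.Mat)
          (V : ℝ → QTensor.Space → QTensor.Mat),
        QTensor.IsSmoothSolution a b c (QTensor.uniaxialDatum δ α) Q ∧
          QTensor.IsDecomposition a δ Q A V) ∧
      (∀ (Q : ℝ → QTensor.Space → QTensor.Mat) (A : QTensor.Mat)
          (V : ℝ → QTensor.Space → QTensor.Mat),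
        QTensor.IsSmoothSolution a b c (QTensor.uniaxialDatum δ α) Q →
          QTensor.IsDecomposition a δ Q A V → A ≠ 0) := by
  obtain ⟨ha, hb, hc, -⟩ : 0 < a ∧ 0 < b ∧ 0 < c ∧ 27 * a * c < b ^ 2 := habc
  obtain ⟨R, hR, hRev⟩ := QTensor.exists_contraction_radius ha (b := b) (c := c)
  obtain ⟨α₁, hα₁, hex⟩ := QTensor.exists_mild_solution ha hb hc hδ hR hRev.self_of_nhds
  have h6 : 0 < Real.sqrt 6 := by positivity
  -- The first bound gives the mild solution; the second gives √6 α < η.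
  refine ⟨min α₁ (η / Real.sqrt 6), by positivity, fun α hα hαlt => ?_⟩
  obtain ⟨K, w, hK, hKR, hKb, hdec, hw⟩ := hex α hα (hαlt.trans_le (min_le_left _ _))
  have hsol := QTensor.isSmoothSolution_of_mild ha hb hc hδ hK.le hRev hKR hdec hw
  obtain ⟨A₀, V₀, hA₀, hdecomp⟩ :=
    QTensor.exists_decomposition_of_mild ha hb hc hδ hK.le hKb hα hdec hw
  refine ⟨QTensor.uniaxialDatum_mem_smallData hδ hη hα ?_, ⟨_, A₀, V₀, hsol, hdecomp⟩,
    fun Q A V hQ hd => ?_⟩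
  · have := hαlt.trans_le (min_le_right _ _)
    rwa [lt_div_iff₀ h6, mul_comm] at this
  -- An arbitrary decomposed solution agrees with the constructed one, hence has the same nonzero
  -- coefficient.
  · have hAA : A = A₀ := QTensor.coeff_unique hd.remainder_mem hdecomp.remainder_mem fun t ht =>
      QTensor.decompositionField_unique ha hδ (QTensor.continuous_uniaxialDatum hδ α)
        (fun x => by rw [QTensor.uniaxialDatum_eq]; exact (QTensor.smul_axial_mem _).1)
        hQ hd hsol hdecomp ht 0
    rw [hAA]
    exact hA₀
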